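/- **Concavity of the ground state energy of the Dirac polaron.** Let $\mathcal F_{\rm rad}=\bigoplus_{n\ge 0}\bigotimes_s^n L^2(\mathbb R^3\times\{1,2\})$ be the Boson Fock space over $L^2(\mathbb R^3\times\{1,2\})$, with annihilation operators $a(f)$, creation operators $a(f)^*$ and second quantization $d\Gamma(\cdot)$. Let $\alpha_1,\alpha_2,\alpha_3,\beta$ be $4\times4$ Dirac matrices (Hermitian, $\alpha_j\alpha_l+\alpha_l\alpha_j=2\delta_{jl}$, $\alpha_j\beta+\beta\alpha_j=0$, $\beta^2=1$). Let $\mathbf e^{(1)},\mathbf e^{(2)}:\mathbb R^3\to\mathbb R^3$ be Borel measurable polarization vectors, i.e. $\mathbf e^{(\lambda)}(\mathbf k)\cdot\mathbf e^{(\mu)}(\mathbf k)=\delta_{\lambda\mu}$ and $\mathbf e^{(\lambda)}(\mathbf k)\cdot\mathbf k=0$ for all $\mathbf k$, and let $\rho:\mathbb R^3\to\mathbb C$ satisfy $\rho\in L^2(\mathbb R^3)$ and $|\mathbf k|^{-1}\rho\in L^2(\mathbb R^3)$. Put $$g_j(\mathbf k,\lambda)=|\mathbf k|^{-1/2}\rho(\mathbf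 k)e^{(\lambda)}_j(\mathbf k),\qquad A_j=\tfrac1{\sqrt2}\,\overline{a(g_j)+a(g_j)^*},\qquad j=1,2,3.$$ For $m\ge0$, $\mathbf p\in\mathbb R^3$ and $M,q\in\mathbb R$ let $$H_m(\mathbf p,M,q)=\vec\alpha\cdot\mathbf p+M\beta+d\Gamma(\omega_m)-\vec\alpha\cdot d\Gamma(\mathbf k)-q\,\vec\alpha\cdot\mathbf A,\qquad \omega_m(\mathbf k)=(1+m)|\mathbf k|+m,$$ acting in $\mathbb C^4\otimes\mathcal F_{\rm rad}$ on the intersection of the domains of its summands, and let $$E_m(\mathbf p,M,q)=\inf\sigma\big(\overline{H_m(\mathbf p,M,q)}\big).$$ Then, for each $m\ge0$, the infimum $E_m(\mathbf p,M,q)$ is a (finite) real number for all $(\mathbf p,M,q)$, and $E_m(\mathbf p,M,q)$ is a concave function of $(\mathbf p,M,q)\in\mathbb R^3\times\mathbb R\times\mathbb R$. -/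

import Mathlib

open MeasureTheory
open scoped ComplexConjugate

noncomputable section

namespace DiracPolaron

/-! ## One-photon space and Fock space -/

/-- Momentum space `ℝ³`. -/
abbrev R3 : Type := EuclideanSpace ℝ (Fin 3)

/-- The one-photon configuration space `ℝ³ × {1,2}` (momentum, polarization index). -/
abbrev Photon : Type := R3 × Fin 2

/-- Lebesgue measure on `ℝ³` times counting measure on the polarization indices. -/
abbrev photonMeasure : Measure Photon := (volume : Measure R3).prod Measure.count

/-- The measure on the configurations of `n` photons. -/
abbrev configMeasure (n : ℕ) : Measure (Fin n → Photon) := Measure.pi fun _ => photonMeasure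

/-- The one-photon space `L²(ℝ³ × {1,2})`. -/
abbrev OnePhoton : Type := Lp ℂ 2 photonMeasure

/-- Permuting the photons preserves the measure. -/
theorem measurePreserving_perm {n : ℕ} (s : Equiv.Perm (Fin n)) :
    MeasurePreserving (fun x : Fin n → Photon => x ∘ s) (configMeasure n) (configMeasure n) := by
  have h := measurePreserving_piCongrLeft (fun _ : Fin n => photonMeasure) s.symm
  have e : (fun x : Fin n → Photon => x ∘ s)
      = ⇑(MeasurableEquiv.piCongrLeft (fun _ : Fin n => Photon) s.symm) := by
    funext x i
    have := Equiv.piCongrLeft_apply_apply (fun _ : Fin n => Photon) s.symm x (s i)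
    rw [Equiv.symm_apply_apply] at this
    exact this.symm
  rw [e]
  exact h

/-- The `n`-photon space: the `n`-fold symmetric tensor power of `L²(ℝ³ × {1,2})`, realized as the
square integrable functions of `n` photon variables that are invariant under permutations. -/
def nPhoton (n : ℕ) : Submodule ℂ (Lp ℂ 2 (configMeasure n)) where
  carrier := {f | ∀ s : Equiv.Perm (Fin n),
    Lp.compMeasurePreserving (fun x => x ∘ s) (measurePreserving_perm s) f = f}
  zero_mem' := fun s => map_zero _
  add_mem' := fun {f g} hf hg s => by rw [map_add, hf s, hg s]
  smul_mem' := fun c f hf s => by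
    have := (Lp.compMeasurePreservingₗ ℂ (fun x => x ∘ s)
      (measurePreserving_perm s) (E := ℂ) (p := 2)).map_smul c f
    exact this.trans (congrArg (c • ·) (hf s))

theorem isClosed_nPhoton (n : ℕ) : IsClosed (nPhoton n : Set (Lp ℂ 2 (configMeasure n))) := by
  have : (nPhoton n : Set (Lp ℂ 2 (configMeasure n))) = ⋂ s : Equiv.Perm (Fin n),
      {f | Lp.compMeasurePreserving (fun x => x ∘ s) (measurePreserving_perm s) f = f} := by
    ext f
    simp only [Set.mem_iInter]
    exact Iff.rfl
  rw [this]
  exact isClosed_iInter fun s =>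
    isClosed_eq (Lp.isometry_compMeasurePreserving (measurePreserving_perm s)).continuous
      continuous_id

instance (n : ℕ) : CompleteSpace (nPhoton n) := (isClosed_nPhoton n).completeSpace_coe

/-- The Boson Fock space over `L²(ℝ³ × {1,2})`: the Hilbert space direct sum of the `n`-photon
spaces. -/
abbrev Fock : Type := lp (fun n : ℕ => nPhoton n) 2

/-- The wave function of the `n`-photon component of a Fock space vector. -/
abbrev wave (ψ : Fock) (n : ℕ) : (Fin n → Photon) → ℂ :=
  ((ψ n : nPhoton n) : Lp ℂ 2 (configMeasure n))

theorem wave_add (ψ φ : Fock) (n : ℕ) :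
    wave (ψ + φ) n =ᵐ[configMeasure n] wave ψ n + wave φ n :=
  Lp.coeFn_add ((ψ n : nPhoton n) : Lp ℂ 2 (configMeasure n)) _

theorem wave_smul (c : ℂ) (ψ : Fock) (n : ℕ) :
    wave (c • ψ) n =ᵐ[configMeasure n] c • wave ψ n :=
  Lp.coeFn_smul c ((ψ n : nPhoton n) : Lp ℂ 2 (configMeasure n))

theorem wave_zero (n : ℕ) : wave 0 n =ᵐ[configMeasure n] 0 :=
  Lp.coeFn_zero ℂ 2 (configMeasure n)

theorem wave_ext {ψ φ : Fock} (h : ∀ n, wave ψ n =ᵐ[configMeasure n] wave φ n) : ψ = φ := by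
  apply lp.ext
  funext n
  exact Subtype.ext (Lp.ext (h n))

/-! ## Second quantization of multiplication operators -/

/-- The graph of `dΓ(w)`: the pairs `(ψ, φ)` of Fock space vectors with
`φₙ(x₁,…,xₙ) = (w(x₁) + ⋯ + w(xₙ)) ψₙ(x₁,…,xₙ)` for all `n`. -/
def dGammaGraph (w : Photon → ℝ) : Submodule ℂ (Fock × Fock) where
  carrier := {z | ∀ n, wave z.2 n =ᵐ[configMeasure n]
    fun x => ((∑ i, w (x i) : ℝ) : ℂ) * wave z.1 n x}
  zero_mem' := fun n => by
    filter_upwards [wave_zero n] with x hx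
    simp [hx]
  add_mem' := fun {a b} ha hb n => by
    filter_upwards [ha n, hb n, wave_add a.1 b.1 n, wave_add a.2 b.2 n] with x h1 h2 h3 h4
    simp only [Prod.fst_add, Prod.snd_add, h3, h4, Pi.add_apply, h1, h2]
    ring
  smul_mem' := fun c a ha n => by
    filter_upwards [ha n, wave_smul c a.1 n, wave_smul c a.2 n] with x h1 h3 h4
    simp only [Prod.smul_fst, Prod.smul_snd, h3, h4, Pi.smul_apply, h1, smul_eq_mul]
    ring

theorem dGammaGraph_functional (w : Photon → ℝ) (z : Fock × Fock) (hz : z ∈ dGammaGraph w)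
    (h0 : z.1 = 0) : z.2 = 0 := by
  refine wave_ext fun n => ?_
  filter_upwards [hz n, wave_zero n] with x h1 h2
  simp [h1, h0, h2]

/-- The second quantization `dΓ(w)` of the operator of multiplication by the real function `w` on
`L²(ℝ³ × {1,2})`. It is the closure of the sum of the operators
`w ⊗ 1 ⊗ ⋯ ⊗ 1 + ⋯ + 1 ⊗ ⋯ ⊗ 1 ⊗ w`, i.e. the operator that multiplies the `n`-photon component by
`w(x₁) + ⋯ + w(xₙ)`, on its maximal domain. -/
def dGamma (w : Photon → ℝ) : Fock →ₗ.[ℂ] Fock := (dGammaGraph w).toLinearPMap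

/-! ## Annihilation and creation operators -/

/-- Splitting off the first photon preserves the measure. -/
theorem measurePreserving_cons (n : ℕ) :
    MeasurePreserving (fun z : (Fin n → Photon) × Photon => (Fin.cons z.2 z.1 : Fin (n + 1) → Photon))
      ((configMeasure n).prod photonMeasure) (configMeasure (n + 1)) := by
  have h := (measurePreserving_piFinSuccAbove (fun _ : Fin (n + 1) => photonMeasure) 0).symm
  have e : (fun z : (Fin n → Photon) × Photon => (Fin.cons z.2 z.1 : Fin (n + 1) → Photon))
      = ⇑(MeasurableEquiv.piFinSuccAbove (fun _ : Fin (n + 1) => Photon) 0).symm ∘ Prod.swap := by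
    funext z
    simp [MeasurableEquiv.piFinSuccAbove, Fin.consEquiv]
  rw [e]
  exact h.comp Measure.measurePreserving_swap

theorem ae_cons {n : ℕ} {P : (Fin (n + 1) → Photon) → Prop} (h : ∀ᵐ z ∂configMeasure (n + 1), P z) :
    ∀ᵐ x ∂configMeasure n, ∀ᵐ y ∂photonMeasure, P (Fin.cons y x) :=
  Measure.ae_ae_of_ae_prod ((measurePreserving_cons n).quasiMeasurePreserving.ae h)

theorem integrable_slice (f : OnePhoton) (ψ : Fock) (n : ℕ) :
    ∀ᵐ x ∂configMeasure n,
      Integrable (fun y => conj (f y) * wave ψ (n + 1) (Fin.cons y x)) photonMeasure := by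
  have h : MemLp (fun z : (Fin n → Photon) × Photon => wave ψ (n + 1) (Fin.cons z.2 z.1)) 2
      ((configMeasure n).prod photonMeasure) :=
    (Lp.memLp ((ψ (n + 1) : nPhoton (n + 1)) :
      Lp ℂ 2 (configMeasure (n + 1)))).comp_measurePreserving (measurePreserving_cons n)
  have h2 := (memLp_two_iff_integrable_sq_norm h.1).1 h
  filter_upwards [h2.prod_right_ae, h.1.prodMk_left] with x h3 h4
  have h5 := (memLp_two_iff_integrable_sq_norm h4).2 h3
  exact (Lp.memLp f).star.integrable_mul h5

/-- The graph of the annihilation operator `a(f)`: the pairs `(ψ, φ)` of Fock space vectors with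
`φₙ(x₁,…,xₙ) = √(n+1) ∫ conj f(y) ψₙ₊₁(y,x₁,…,xₙ) dy` for all `n`. -/
def annihilationGraph (f : OnePhoton) : Submodule ℂ (Fock × Fock) where
  carrier := {z | ∀ n, wave z.2 n =ᵐ[configMeasure n] fun x =>
    (Real.sqrt (n + 1) : ℂ) * ∫ y, conj (f y) * wave z.1 (n + 1) (Fin.cons y x) ∂photonMeasure}
  zero_mem' := fun n => by
    filter_upwards [wave_zero n, ae_cons (wave_zero (n + 1))] with x hx hy
    have : ∫ y, conj (f y) * wave 0 (n + 1) (Fin.cons y x) ∂photonMeasure = 0 := by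
      refine integral_eq_zero_of_ae ?_
      filter_upwards [hy] with y hy
      simp [hy]
    simp only [Prod.fst_zero, Prod.snd_zero, hx, this, Pi.zero_apply, mul_zero]
  add_mem' := fun {a b} ha hb n => by
    filter_upwards [ha n, hb n, wave_add a.2 b.2 n, ae_cons (wave_add a.1 b.1 (n + 1)),
      integrable_slice f a.1 n, integrable_slice f b.1 n] with x h1 h2 h3 h4 h5 h6
    have : ∫ y, conj (f y) * wave (a.1 + b.1) (n + 1) (Fin.cons y x) ∂photonMeasure
        = (∫ y, conj (f y) * wave a.1 (n + 1) (Fin.cons y x) ∂photonMeasure)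
          + ∫ y, conj (f y) * wave b.1 (n + 1) (Fin.cons y x) ∂photonMeasure := by
      rw [← integral_add h5 h6]
      refine integral_congr_ae ?_
      filter_upwards [h4] with y hy
      simp only [hy, Pi.add_apply]
      ring
    simp only [Prod.fst_add, Prod.snd_add, h3, Pi.add_apply, h1, h2, this]
    ring
  smul_mem' := fun c a ha n => by
    filter_upwards [ha n, wave_smul c a.2 n, ae_cons (wave_smul c a.1 (n + 1))] with x h1 h3 h4
    have : ∫ y, conj (f y) * wave (c • a.1) (n + 1) (Fin.cons y x) ∂photonMeasure
        = c * ∫ y, conj (f y) * wave a.1 (n + 1) (Fin.cons y x) ∂photonMeasure := by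
      rw [← integral_const_mul]
      refine integral_congr_ae ?_
      filter_upwards [h4] with y hy
      simp only [hy, Pi.smul_apply, smul_eq_mul]
      ring
    simp only [Prod.smul_fst, Prod.smul_snd, h3, Pi.smul_apply, smul_eq_mul, h1, this]
    ring

theorem annihilationGraph_functional (f : OnePhoton) (z : Fock × Fock)
    (hz : z ∈ annihilationGraph f) (h0 : z.1 = 0) : z.2 = 0 := by
  refine wave_ext fun n => ?_
  filter_upwards [hz n, ae_cons (wave_zero (n + 1)), wave_zero n] with x h1 h2 h3
  have : ∫ y, conj (f y) * wave z.1 (n + 1) (Fin.cons y x) ∂photonMeasure = 0 := by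
    refine integral_eq_zero_of_ae ?_
    filter_upwards [h2] with y hy
    simp [h0, hy]
  rw [h1, this, h3]
  simp

/-- The annihilation operator `a(f)`, antilinear in `f`, on its maximal domain. -/
def annihilation (f : OnePhoton) : Fock →ₗ.[ℂ] Fock := (annihilationGraph f).toLinearPMap

/-- The creation operator `a(f)*`, the Hilbert space adjoint of `a(f)`. -/
def creation (f : OnePhoton) : Fock →ₗ.[ℂ] Fock := LinearPMap.adjoint (annihilation f)

/-- The field operator: the closure of `a(f) + a(f)*`, divided by `√2`. -/
def fieldOperator (f : OnePhoton) : Fock →ₗ.[ℂ] Fock :=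
  ((Real.sqrt 2 : ℂ)⁻¹) • (annihilation f + creation f).closure

/-! ## The model -/

/-- The data of the model: `4 × 4` Dirac matrices `α₁, α₂, α₃, β`, Borel measurable polarization
vectors `e⁽¹⁾, e⁽²⁾`, and an ultraviolet cutoff function `ρ ∈ L²(ℝ³) ∩ Dom(|k|⁻¹)`. -/
structure Model where
  α : Fin 3 → Matrix (Fin 4) (Fin 4) ℂ
  β : Matrix (Fin 4) (Fin 4) ℂ
  α_hermitian : ∀ j, (α j).IsHermitian
  β_hermitian : β.IsHermitian
  α_anticomm : ∀ j l, α j * α l + α l * α j = if j = l then 2 else 0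
  αβ_anticomm : ∀ j, α j * β + β * α j = 0
  β_sq : β * β = 1
  e : Fin 2 → R3 → R3
  e_measurable : ∀ l j, Measurable fun k => e l k j
  e_orthonormal : ∀ k l l', inner ℝ (e l k) (e l' k) = if l = l' then 1 else 0
  e_transversal : ∀ k l, inner ℝ (e l k) k = 0
  ρ : R3 → ℂ
  ρ_memLp : MemLp ρ 2 volume
  ρ_dom : MemLp (fun k => ((‖k‖⁻¹ : ℝ) : ℂ) * ρ k) 2 volume

/-- The coupling function `g_j(k,λ) = |k|^{-1/2} ρ(k) e_j^{(λ)}(k)`. -/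
def Model.gFun (S : Model) (j : Fin 3) : Photon → ℂ :=
  fun x => ((‖x.1‖ ^ (-1 / 2 : ℝ) : ℝ) : ℂ) * S.ρ x.1 * ((S.e x.2 x.1 j : ℝ) : ℂ)

theorem Model.gFun_memLp (S : Model) (j : Fin 3) : MemLp (S.gFun j) 2 photonMeasure := by
  have hρm : AEStronglyMeasurable (fun x : Photon => S.ρ x.1) photonMeasure :=
    S.ρ_memLp.1.comp_fst
  have hem : Measurable fun x : Photon => ((S.e x.2 x.1 j : ℝ) : ℂ) := by
    refine Complex.measurable_ofReal.comp ?_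
    exact measurable_from_prod_countable_left fun l => S.e_measurable l j
  have hkm : Measurable fun x : Photon => ((‖x.1‖ ^ (-1 / 2 : ℝ) : ℝ) : ℂ) := by fun_prop
  have hm : AEStronglyMeasurable (S.gFun j) photonMeasure :=
    (hkm.aestronglyMeasurable.mul hρm).mul hem.aestronglyMeasurable
  have hsq : Integrable (fun k => ‖S.ρ k‖ ^ 2 + ‖((‖k‖⁻¹ : ℝ) : ℂ) * S.ρ k‖ ^ 2) volume :=
    ((memLp_two_iff_integrable_sq_norm S.ρ_memLp.1).1 S.ρ_memLp).add
      ((memLp_two_iff_integrable_sq_norm S.ρ_dom.1).1 S.ρ_dom)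
  have hsq' : Integrable (fun x : Photon =>
      ‖S.ρ x.1‖ ^ 2 + ‖((‖x.1‖⁻¹ : ℝ) : ℂ) * S.ρ x.1‖ ^ 2) photonMeasure :=
    hsq.comp_fst (ν := (Measure.count : Measure (Fin 2)))
  refine (memLp_two_iff_integrable_sq_norm hm).2 (hsq'.mono' (hm.norm.pow 2) ?_)
  refine Filter.Eventually.of_forall fun x => ?_
  have he : |S.e x.2 x.1 j| ≤ 1 := by
    have h1 := S.e_orthonormal x.1 x.2 x.2
    rw [if_pos rfl, real_inner_self_eq_norm_sq] at h1
    have h2 : ‖S.e x.2 x.1‖ = 1 := by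
      nlinarith [norm_nonneg (S.e x.2 x.1)]
    have h3 := PiLp.norm_apply_le (S.e x.2 x.1) j
    rwa [h2, Real.norm_eq_abs] at h3
  have hk : (‖x.1‖ ^ (-1 / 2 : ℝ)) ^ 2 = ‖x.1‖⁻¹ := by
    rw [← Real.rpow_natCast, ← Real.rpow_mul (norm_nonneg _)]
    norm_num [Real.rpow_neg_one]
  have hn : ‖S.gFun j x‖ ^ 2 = ‖x.1‖⁻¹ * ‖S.ρ x.1‖ ^ 2 * |S.e x.2 x.1 j| ^ 2 := by
    simp only [Model.gFun, norm_mul, Complex.norm_real, mul_pow, Real.norm_eq_abs, sq_abs, hk]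
  have hinv : 0 ≤ ‖x.1‖⁻¹ := inv_nonneg.2 (norm_nonneg _)
  rw [Real.norm_of_nonneg (by positivity), hn]
  have he2 : |S.e x.2 x.1 j| ^ 2 ≤ 1 := by nlinarith [abs_nonneg (S.e x.2 x.1 j)]
  have h1 : ‖((‖x.1‖⁻¹ : ℝ) : ℂ) * S.ρ x.1‖ ^ 2 = (‖x.1‖⁻¹) ^ 2 * ‖S.ρ x.1‖ ^ 2 := by
    rw [norm_mul, Complex.norm_real, Real.norm_of_nonneg hinv, mul_pow]
  rw [h1]
  have h2 : 0 ≤ ‖x.1‖⁻¹ * ‖S.ρ x.1‖ ^ 2 := by positivity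
  have h3 : ‖x.1‖⁻¹ ≤ 1 + (‖x.1‖⁻¹) ^ 2 := by nlinarith [sq_nonneg (‖x.1‖⁻¹ - 1)]
  nlinarith [mul_le_mul_of_nonneg_left he2 h2,
    mul_le_mul_of_nonneg_right h3 (sq_nonneg ‖S.ρ x.1‖)]

/-- The coupling function `g_j` as an element of `L²(ℝ³ × {1,2})`. -/
def Model.g (S : Model) (j : Fin 3) : OnePhoton := (S.gFun_memLp j).toLp (S.gFun j)

/-- The quantized vector potential `A_j = A_j(0)`. -/
def Model.A (S : Model) (j : Fin 3) : Fock →ₗ.[ℂ] Fock := fieldOperator (S.g j)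

/-- The free photon Hamiltonian `H_f(m) = dΓ(ω_m)`, `ω_m(k) = (1 + m)|k| + m`. -/
def Hf (m : ℝ) : Fock →ₗ.[ℂ] Fock := dGamma fun x => (1 + m) * ‖x.1‖ + m

/-- The component `dΓ(k_j)` of the photon momentum operator. -/
def Prad (j : Fin 3) : Fock →ₗ.[ℂ] Fock := dGamma fun x => x.1 j

/-- The Hilbert space `ℂ⁴ ⊗ 𝓕_rad`. -/
abbrev SpinFock : Type := PiLp 2 fun _ : Fin 4 => Fock

/-- The operator `B ⊗ T` on `ℂ⁴ ⊗ 𝓕_rad`, with domain `ℂ⁴ ⊗ Dom(T)`, for a `4 × 4` matrix `B` and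
an operator `T` on `𝓕_rad`. -/
def tensorOp (B : Matrix (Fin 4) (Fin 4) ℂ) (T : Fock →ₗ.[ℂ] Fock) :
    SpinFock →ₗ.[ℂ] SpinFock where
  domain :=
    { carrier := {Ψ | ∀ s, Ψ s ∈ T.domain}
      zero_mem' := fun s => T.domain.zero_mem
      add_mem' := fun ha hb s => T.domain.add_mem (ha s) (hb s)
      smul_mem' := fun c _ ha s => T.domain.smul_mem c (ha s) }
  toFun :=
    { toFun := fun Ψ => WithLp.toLp 2 fun s => ∑ s', B s s' • T ⟨Ψ.1 s', Ψ.2 s'⟩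
      map_add' := fun Ψ Φ => by
        ext1 s
        change ∑ s', B s s' • T (⟨Ψ.1 s', Ψ.2 s'⟩ + ⟨Φ.1 s', Φ.2 s'⟩)
          = ∑ s', B s s' • T ⟨Ψ.1 s', Ψ.2 s'⟩ + ∑ s', B s s' • T ⟨Φ.1 s', Φ.2 s'⟩
        simp only [LinearPMap.map_add, smul_add, Finset.sum_add_distrib]
      map_smul' := fun c Ψ => by
        ext1 s
        change ∑ s', B s s' • T (c • ⟨Ψ.1 s', Ψ.2 s'⟩) = c • ∑ s', B s s' • T ⟨Ψ.1 s', Ψ.2 s'⟩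
        simp only [LinearPMap.map_smul, Finset.smul_sum]
        exact Finset.sum_congr rfl fun s' _ => smul_comm _ _ _ }

/-- The everywhere defined identity operator on `𝓕_rad`. -/
def idOp : Fock →ₗ.[ℂ] Fock := (LinearMap.id : Fock →ₗ[ℂ] Fock).toPMap ⊤

/-- The fibre Hamiltonian
`H_m(p,M,q) = α·p + Mβ + H_f(m) - α·dΓ(k) - q α·A` on `ℂ⁴ ⊗ 𝓕_rad`, defined on the intersection of
the domains of its summands. -/
def Model.H (S : Model) (m : ℝ) (p : R3) (M q : ℝ) : SpinFock →ₗ.[ℂ] SpinFock :=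
  (∑ j, ((p j : ℝ) : ℂ) • tensorOp (S.α j) idOp) + (M : ℂ) • tensorOp S.β idOp
    + tensorOp 1 (Hf m) - (∑ j, tensorOp (S.α j) (Prad j))
    - (q : ℂ) • ∑ j, tensorOp (S.α j) (S.A j)

/-! ## Spectrum and ground state energy -/

/-- The resolvent set of an operator `T` on a Hilbert space: the `z ∈ ℂ` for which
`T - z : Dom(T) → E` is a bijection with bounded inverse. -/
def resolventSet {E : Type*} [NormedAddCommGroup E] [InnerProductSpace ℂ E]
    (T : E →ₗ.[ℂ] E) : Set ℂ :=
  {z | ∃ R : E →L[ℂ] E, (∀ y, ∃ h : R y ∈ T.domain, T ⟨R y, h⟩ - z • R y = y) ∧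
    ∀ x : T.domain, R (T x - z • (x : E)) = x}

/-- The spectrum of an operator on a Hilbert space. -/
def spectrumOf {E : Type*} [NormedAddCommGroup E] [InnerProductSpace ℂ E]
    (T : E →ₗ.[ℂ] E) : Set ℂ := (resolventSet T)ᶜ

/-- The real points of the spectrum of the closure of `H_m(p,M,q)`. -/
def Model.energySpectrum (S : Model) (m : ℝ) (p : R3) (M q : ℝ) : Set ℝ :=
  {x | (x : ℂ) ∈ spectrumOf (S.H m p M q).closure}

/-- The ground state energy `E_m(p,M,q)`, the infimum of the spectrum of the closure of
`H_m(p,M,q)`. -/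
def Model.groundEnergy (S : Model) (m : ℝ) (p : R3) (M q : ℝ) : ℝ :=
  sInf (S.energySpectrum m p M q)

end DiracPolaron

end

noncomputable section

namespace DiracPolaron

open scoped ComplexConjugate
open Filter Topology

/-! ### From norm domination to form domination for symmetric operators -/

variable {E : Type*} [NormedAddCommGroup E] [InnerProductSpace ℂ E]

/-! For fixed `m ≥ 0` all the operators `H_m(p,M,q)` share one domain, that of `dΓ(ω_m)` in each
spinor component, and on it every expectation value `⟨HΨ,Ψ⟩` is affine in `(p,M,q)`. An infimum of
affine functions is concave, so the matter reduces to the variational principle: the infimum of the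
spectrum of the closure equals the infimum of the expectation values over unit vectors of the domain
(`isGLB_spectrumOf_closure`, `convexCombination_sInf_le`). This principle needs semiboundedness and
a dense range of `H - x` for very negative `x`, that is, essential self-adjointness.

The difficulty is that `α·dΓ(k)` is as large as `dΓ(|k|)`, so the relative bound is one and
Kato–Rellich is out of reach. Wüst's theorem (`denseRange_of_norm_le`) tolerates bound one as soon
as `‖(α·dΓ(k) + q α·A)Ψ‖ ≤ ‖(dΓ(|k|) + C)Ψ‖`, and the Heinz inequality
(`abs_re_inner_le_of_norm_le`) turns the same estimate into semiboundedness. The matrix `α·p + Mβ`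
is a bounded perturbation.

The estimate (`Model.exists_norm_sq_le`) comes from expanding the square. By the Clifford relations
`(α·dΓ(k))² = dΓ(k)²`, which falls short of `dΓ(|k|)²` by a collinearity defect, and the square of
the field is controlled by the form of `dΓ(|k|)`. The cross term is a priori of order 3/2 in
`dΓ(|k|)`. Written as an integral over one photon with momentum `k` and polarization `e` and the
remaining photons with energy `E` and momentum `P`, anticommutation leaves only `2 e·P` and a term
of size `|k|` (`Model.norm_clifford_le`). As `e ⊥ k`, one has `|k| (e·P)² ≤ 2E(|k|E - k·P)`
(`norm_mul_inner_sq_le`), and `|k|E - k·P` summed over the photons is exactly the defect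
(`integral_defect_split`). One copy of the defect is available and one is spent; what is left is of
first order and is absorbed by `C`. -/

theorem re_inner_self_eq (x : E) : (inner ℂ x x).re = ‖x‖ ^ 2 :=
  inner_self_eq_norm_sq (𝕜 := ℂ) x

theorem re_inner_swap_of_symm {D : Submodule ℂ E} {A : D →ₗ[ℂ] E}
    (hA : ∀ x y : D, inner ℂ (A x) (y : E) = inner ℂ (x : E) (A y)) (x y : D) :
    (inner ℂ (A x) (y : E)).re = (inner ℂ (A y) (x : E)).re := by
  rw [hA x y, ← inner_conj_symm, Complex.conj_re]

/-- A symmetric positive form satisfies the arithmetic-geometric mean inequality. -/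
theorem two_mul_abs_re_inner_le {D : Submodule ℂ E} {A : D →ₗ[ℂ] E}
    (hA : ∀ x y : D, inner ℂ (A x) (y : E) = inner ℂ (x : E) (A y))
    (hpos : ∀ x : D, 0 ≤ (inner ℂ (A x) (x : E)).re) (x y : D) :
    2 * |(inner ℂ (A x) (y : E)).re|
      ≤ (inner ℂ (A x) (x : E)).re + (inner ℂ (A y) (y : E)).re := by
  have h1 := hpos (x + y)
  have h2 := hpos (x - y)
  have h3 := re_inner_swap_of_symm hA x y
  simp only [map_add, map_sub, Submodule.coe_add, Submodule.coe_sub, inner_add_left,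
    inner_add_right, inner_sub_left, inner_sub_right, Complex.add_re, Complex.sub_re] at h1 h2
  rw [abs_eq_max_neg]
  rcases max_cases (inner ℂ (A x) (y : E)).re (-(inner ℂ (A x) (y : E)).re) with h | h <;>
    rw [h.1] <;> linarith

/-- A bounded sequence of reals that is convex does not increase in its first step. -/
theorem le_of_convex_of_bounded {u : ℕ → ℝ} {K : ℝ} (hK : ∀ k, u k ≤ K)
    (hu : ∀ k, 2 * u (k + 1) ≤ u k + u (k + 2)) : u 1 ≤ u 0 := by
  by_contra! hlt
  have h1 : ∀ k, u 1 - u 0 ≤ u (k + 1) - u k := by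
    intro k
    induction k with
    | zero => simp
    | succ k ih => have := hu k; linarith
  have h2 : ∀ k : ℕ, u 0 + k * (u 1 - u 0) ≤ u k := by
    intro k
    induction k with
    | zero => simp
    | succ k ih => have := h1 k; push_cast; linarith
  obtain ⟨k, hk⟩ := exists_nat_gt ((K - u 0) / (u 1 - u 0))
  rw [div_lt_iff₀ (by linarith)] at hk
  have := h2 k
  have := hK k
  linarith

/-- Heinz inequality: operator norm domination of symmetric operators implies form domination. -/
theorem abs_re_inner_le_of_norm_le {D : Submodule ℂ E} {A B : D →ₗ[ℂ] E}
    (hA : ∀ x y : D, inner ℂ (A x) (y : E) = inner ℂ (x : E) (A y))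
    (hB : ∀ x y : D, inner ℂ (B x) (y : E) = inner ℂ (x : E) (B y))
    (hsurj : Function.Surjective A) {c : ℝ} (hc : 0 < c)
    (hpos : ∀ x : D, c * ‖(x : E)‖ ^ 2 ≤ (inner ℂ (A x) (x : E)).re)
    (hBA : ∀ x : D, ‖B x‖ ≤ ‖A x‖) (x : D) :
    |(inner ℂ (B x) (x : E)).re| ≤ (inner ℂ (A x) (x : E)).re := by
  have hpos' : ∀ x : D, 0 ≤ (inner ℂ (A x) (x : E)).re :=
    fun x => le_trans (by positivity) (hpos x)
  choose r hr using hsurj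
  -- The orbit of `x` under `A⁻¹B`. It replaces the usual argument with the square root of `A`.
  let s : ℕ → D := fun k => (fun y => r (B y))^[k] x
  have hs : ∀ k, A (s (k + 1)) = B (s k) := by
    intro k
    simp only [s, Function.iterate_succ_apply', hr]
  have hn : ∀ k, ‖A (s k)‖ ≤ ‖A x‖ := by
    intro k
    induction k with
    | zero => simp [s]
    | succ k ih => rw [hs]; exact (hBA _).trans ih
  let u : ℕ → ℝ := fun k => (inner ℂ (A (s k)) (s k : E)).re
  -- Strict positivity gives `c‖y‖ ≤ ‖Ay‖`. Since `‖A (s k)‖` never exceeds `‖A x‖`, this makes `u`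
  -- a bounded sequence.
  have hb : ∀ y : D, (inner ℂ (A y) (y : E)).re ≤ ‖A y‖ ^ 2 / c := by
    intro y
    have h1 := (Complex.re_le_norm _).trans (norm_inner_le_norm (𝕜 := ℂ) (A y) (y : E))
    have h2 := hpos y
    rw [le_div_iff₀ hc]
    by_cases h0 : ‖(y : E)‖ = 0
    · rw [h0, mul_zero] at h1
      nlinarith [sq_nonneg ‖A y‖]
    · have h3 : 0 < ‖(y : E)‖ := lt_of_le_of_ne (norm_nonneg _) (Ne.symm h0)
      have h4 : c * ‖(y : E)‖ ≤ ‖A y‖ := by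
        have : (c * ‖(y : E)‖) * ‖(y : E)‖ ≤ ‖A y‖ * ‖(y : E)‖ := by nlinarith
        exact le_of_mul_le_mul_right this h3
      nlinarith [norm_nonneg (A y)]
  have h10 : u 1 ≤ u 0 := by
    refine le_of_convex_of_bounded (K := ‖A x‖ ^ 2 / c) (fun k => (hb _).trans ?_) fun k => ?_
    · gcongr
      exact hn k
    -- Symmetry of `B` and `A` moves one iteration step from the left slot to the right one; the
    -- mean inequality between `s k` and `s (k + 2)` then says that `u` is convex.
    · have h1 : u (k + 1) = (inner ℂ (A (s k)) (s (k + 2) : E)).re := by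
        simp only [u]
        rw [hs k, hB, ← hs (k + 1), hA]
      rw [h1]
      have := two_mul_abs_re_inner_le hA hpos' (s k) (s (k + 2))
      have := le_abs_self (inner ℂ (A (s k)) (s (k + 2) : E)).re
      linarith
  -- `⟨Bx,x⟩ = ⟨A s₁,x⟩` is at most the mean of `u 1` and `u 0` in absolute value, and `u 1 ≤ u 0`.
  have h2 := two_mul_abs_re_inner_le hA hpos' (s 1) x
  rw [hs 0] at h2
  have e0 : s 0 = x := rfl
  have h3 : u 0 = (inner ℂ (A x) (x : E)).re := rfl
  have h4 : u 1 = (inner ℂ (A (s 1)) (s 1 : E)).re := rfl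
  rw [e0] at h2
  rw [hs 0, e0] at h4
  linarith

/-! ### Wüst's theorem: dense range at relative bound one -/

section Wust

variable [CompleteSpace E] {D : Submodule ℂ E} {A B : D →ₗ[ℂ] E}

/-- Neumann series: if `B` is `A`-contractive, then `A + tB` is surjective for `0 ≤ t < 1`. -/
theorem surjective_add_smul (hinj : Function.Injective A) (hsurj : Function.Surjective A)
    (hBA : ∀ x : D, ‖B x‖ ≤ ‖A x‖) {t : ℝ} (ht0 : 0 ≤ t) (ht1 : t < 1) (y : E) :
    ∃ x : D, A x + (t : ℂ) • B x = y := by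
  let e : D ≃ₗ[ℂ] E := LinearEquiv.ofBijective A ⟨hinj, hsurj⟩
  have he : ∀ z, A (e.symm z) = z := fun z => e.apply_symm_apply z
  -- With `K = BA⁻¹` one has `A + tB = (1 + tK)A`, and `‖tK‖ ≤ t < 1`.
  let K : E →L[ℂ] E := (B ∘ₗ e.symm.toLinearMap).mkContinuous 1 fun z => by
    rw [one_mul]
    have := hBA (e.symm z)
    rwa [he] at this
  have hK : ‖K‖ ≤ 1 := LinearMap.mkContinuous_norm_le _ zero_le_one _
  have hlt : ‖(-(t : ℂ)) • K‖ < 1 := by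
    rw [norm_smul, norm_neg, Complex.norm_real, Real.norm_of_nonneg ht0]
    nlinarith [norm_nonneg K]
  let U := Units.oneSub ((-(t : ℂ)) • K) hlt
  refine ⟨e.symm ((U⁻¹ : (E →L[ℂ] E)ˣ).1 y), ?_⟩
  have h1 : (U.1 * (U⁻¹ : (E →L[ℂ] E)ˣ).1) y = y := by rw [Units.mul_inv]; rfl
  have h2 : U.1 = 1 - (-(t : ℂ)) • K := rfl
  rw [he]
  conv_rhs => rw [← h1]
  rw [h2]
  simp [K]

/-- Wüst's theorem: if `B` is relatively bounded with respect to `A ≥ 0` with bound one, then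
`A + B + s` has dense range for `s > 0`. -/
theorem denseRange_of_norm_le
    (hA : ∀ x y : D, inner ℂ (A x) (y : E) = inner ℂ (x : E) (A y))
    (hB : ∀ x y : D, inner ℂ (B x) (y : E) = inner ℂ (x : E) (B y))
    (hdense : Dense (D : Set E))
    (hsurj : ∀ s : ℝ, 0 ≤ s → ∀ y, ∃ x : D, A x + (s : ℂ) • (x : E) = y)
    {c : ℝ} (hc : 0 < c) (hpos : ∀ x : D, c * ‖(x : E)‖ ^ 2 ≤ (inner ℂ (A x) (x : E)).re)
    (hBA : ∀ x : D, ‖B x‖ ≤ ‖A x‖) {s : ℝ} (hs : 0 < s) :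
    DenseRange fun x : D => A x + B x + (s : ℂ) • (x : E) := by
  have hpos' : ∀ x : D, 0 ≤ (inner ℂ (A x) (x : E)).re :=
    fun x => le_trans (by positivity) (hpos x)
  have hsurjA : Function.Surjective A := fun y => by
    obtain ⟨x, hx⟩ := hsurj 0 le_rfl y
    exact ⟨x, by simpa using hx⟩
  have hform := abs_re_inner_le_of_norm_le hA hB hsurjA hc hpos hBA
  let As : D →ₗ[ℂ] E := A + (s : ℂ) • D.subtype
  have hAs : ∀ x : D, As x = A x + (s : ℂ) • (x : E) := fun x => rfl
  have hinj : Function.Injective As := by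
    rw [injective_iff_map_eq_zero]
    intro x hx
    have h1 : (inner ℂ (As x) (x : E)).re = 0 := by rw [hx, inner_zero_left, Complex.zero_re]
    rw [hAs, inner_add_left, inner_smul_left, Complex.add_re, Complex.conj_ofReal,
      Complex.re_ofReal_mul, re_inner_self_eq] at h1
    have h2 := hpos' x
    have h3 : ‖(x : E)‖ = 0 := by
      by_contra h
      have : 0 < ‖(x : E)‖ ^ 2 := by positivity
      nlinarith
    exact Subtype.ext (norm_eq_zero.1 h3)
  have hBAs : ∀ x : D, ‖B x‖ ≤ ‖As x‖ := by
    intro x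
    refine (hBA x).trans ?_
    have h1 : ‖As x‖ ^ 2 = ‖A x‖ ^ 2 + 2 * (s * (inner ℂ (A x) (x : E)).re)
        + (s * ‖(x : E)‖) ^ 2 := by
      rw [hAs, norm_add_sq (𝕜 := ℂ), inner_smul_right, norm_smul, Complex.norm_real,
        Real.norm_of_nonneg hs.le]
      simp
    have h2 := mul_nonneg hs.le (hpos' x)
    refine (sq_le_sq₀ (norm_nonneg _) (norm_nonneg _)).1 ?_
    nlinarith [sq_nonneg (s * ‖(x : E)‖)]
  let L : D →ₗ[ℂ] E := A + B + (s : ℂ) • D.subtype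
  have hL : ∀ x : D, L x = A x + B x + (s : ℂ) • (x : E) := fun x => rfl
  have hmain : (LinearMap.range L)ᗮ = ⊥ := by
    rw [Submodule.eq_bot_iff]
    intro φ hφ
    by_contra h0
    have hφ0 : 0 < ‖φ‖ := norm_pos_iff.2 h0
    -- `B` cannot be moved onto `φ`, which need not lie in `D`; a nearby `η ∈ D` takes its place.
    obtain ⟨η, hη, hηφ⟩ := Metric.mem_closure_iff.1 (hdense φ) (‖φ‖ / 4) (by positivity)
    rw [dist_eq_norm] at hηφ
    set η' : D := ⟨η, hη⟩ with hη'
    -- So small that `δ⟨Bη,ψ⟩` costs at most a quarter of `‖φ‖²`; the summand `1` keeps the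
    -- denominator positive when `Bη = 0`.
    set δ : ℝ := min 1 (‖φ‖ * s / (4 * (‖B η'‖ + 1))) with hδ
    have hδ0 : 0 < δ := lt_min one_pos (by positivity)
    have hδ1 : δ ≤ 1 := min_le_left _ _
    have hδ2 : δ * (4 * (‖B η'‖ + 1)) ≤ ‖φ‖ * s := by
      rw [← le_div_iff₀ (by positivity)]
      exact min_le_right _ _
    -- Weakening `B` to `(1 - δ)B` makes the equation solvable. The price is the error `δBψ`, which
    -- is bounded uniformly in `δ` and is small when tested against `φ`.
    obtain ⟨ψ, hψ⟩ := surjective_add_smul hinj (fun y => hsurj s hs.le y) hBAs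
      (t := 1 - δ) (by linarith) (by linarith) φ
    have hψ' : A ψ + ((1 - δ : ℝ) : ℂ) • B ψ = φ - (s : ℂ) • (ψ : E) := by
      rw [← hψ, hAs]; abel
    -- Here the Heinz inequality enters: `A + (1 - δ)B` has a nonnegative form, so the shift `s`
    -- alone controls `ψ`.
    have hψn : s * ‖(ψ : E)‖ ≤ ‖φ‖ := by
      have h1 : (inner ℂ φ (ψ : E)).re = (inner ℂ (A ψ) (ψ : E)).re
          + (1 - δ) * (inner ℂ (B ψ) (ψ : E)).re + s * ‖(ψ : E)‖ ^ 2 := by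
        rw [← hψ, hAs, inner_add_left, inner_add_left, inner_smul_left, inner_smul_left,
          Complex.conj_ofReal, Complex.conj_ofReal, Complex.add_re, Complex.add_re,
          Complex.re_ofReal_mul, Complex.re_ofReal_mul, re_inner_self_eq]
        ring
      have h2 := hform ψ
      have h3 := (abs_le.1 h2).1
      have h4 := (Complex.re_le_norm _).trans (norm_inner_le_norm (𝕜 := ℂ) φ (ψ : E))
      have h5 : 0 ≤ (1 - δ) * ((inner ℂ (B ψ) (ψ : E)).re + (inner ℂ (A ψ) (ψ : E)).re) :=
        mul_nonneg (by linarith) (by linarith)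
      have h6 := mul_nonneg hδ0.le (hpos' ψ)
      by_cases h0 : ‖(ψ : E)‖ = 0
      · rw [h0, mul_zero]; exact hφ0.le
      · have h7 : 0 < ‖(ψ : E)‖ := lt_of_le_of_ne (norm_nonneg _) (Ne.symm h0)
        refine le_of_mul_le_mul_right ?_ h7
        nlinarith
    have hBψ : δ * ‖B ψ‖ ≤ 2 * ‖φ‖ := by
      have h1 : ‖φ - (s : ℂ) • (ψ : E)‖ ≤ 2 * ‖φ‖ := by
        refine (norm_sub_le _ _).trans ?_
        rw [norm_smul, Complex.norm_real, Real.norm_of_nonneg hs.le]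
        linarith
      have h2 : ‖A ψ‖ ≤ ‖φ - (s : ℂ) • (ψ : E)‖ + (1 - δ) * ‖B ψ‖ := by
        have : A ψ = (φ - (s : ℂ) • (ψ : E)) - ((1 - δ : ℝ) : ℂ) • B ψ := by rw [← hψ']; abel
        rw [this]
        refine (norm_sub_le _ _).trans ?_
        rw [norm_smul, Complex.norm_real, Real.norm_of_nonneg (by linarith)]
      have h3 := hBA ψ
      linarith
    have hLψ : L ψ = φ + (δ : ℂ) • B ψ := by
      rw [hL, ← hψ, hAs]
      push_cast
      module
    have h1 : inner ℂ φ φ = - ((δ : ℂ) * inner ℂ φ (B ψ)) := by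
      have := (Submodule.mem_orthogonal' _ _).1 hφ (L ψ) ⟨ψ, rfl⟩
      rw [hLψ, inner_add_right, inner_smul_right] at this
      exact eq_neg_of_add_eq_zero_left this
    -- The first term is small because `η` is close to `φ`, the second because `B` now acts on the
    -- fixed vector `η` and `δ` was chosen after it.
    have h2 : inner ℂ φ (B ψ) = inner ℂ (φ - η) (B ψ) + inner ℂ (B η') (ψ : E) := by
      rw [hB, inner_sub_left]
      simp [hη']
    have h3 : ‖φ‖ ^ 2 ≤ δ * (‖φ - η‖ * ‖B ψ‖ + ‖B η'‖ * ‖(ψ : E)‖) := by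
      have h4 : ‖inner ℂ φ φ‖ = ‖φ‖ ^ 2 := by
        rw [inner_self_eq_norm_sq_to_K]
        simp
      rw [← h4, h1, norm_neg, norm_mul, Complex.norm_real, Real.norm_of_nonneg hδ0.le, h2]
      refine mul_le_mul_of_nonneg_left ?_ hδ0.le
      exact (norm_add_le _ _).trans (add_le_add (norm_inner_le_norm _ _) (norm_inner_le_norm _ _))
    have h5 : δ * ‖B η'‖ * ‖(ψ : E)‖ ≤ ‖φ‖ * ‖φ‖ / 4 := by
      have : δ * ‖B η'‖ ≤ ‖φ‖ * s / 4 := by nlinarith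
      calc δ * ‖B η'‖ * ‖(ψ : E)‖ ≤ ‖φ‖ * s / 4 * ‖(ψ : E)‖ := by gcongr
        _ = ‖φ‖ * (s * ‖(ψ : E)‖) / 4 := by ring
        _ ≤ ‖φ‖ * ‖φ‖ / 4 := by gcongr
    have h6 : ‖φ - η‖ * (δ * ‖B ψ‖) ≤ ‖φ‖ / 4 * (2 * ‖φ‖) := by gcongr
    -- The two contributions add up to at most three quarters of `‖φ‖²`.
    nlinarith
  rw [← Submodule.topologicalClosure_eq_top_iff] at hmain
  have h7 : Dense ((LinearMap.range L : Submodule ℂ E) : Set E) :=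
    Submodule.dense_iff_topologicalClosure_eq_top.2 hmain
  exact h7

end Wust

/-! ### The bottom of the spectrum as the infimum of expectation values -/

section Spectrum

variable {T : E →ₗ.[ℂ] E}

/-- A limit `(0, z)` of points of the graph satisfies `⟨z,y⟩ = ⟨0,Ty⟩ = 0` for `y` in the dense
domain, hence `z = 0`. -/
theorem isClosable_of_symm (hdense : Dense (T.domain : Set E))
    (hT : ∀ x y : T.domain, inner ℂ (T x) (y : E) = inner ℂ (x : E) (T y)) : T.IsClosable := by
  refine ⟨T.graph.topologicalClosure.toLinearPMap, ?_⟩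
  rw [Submodule.toLinearPMap_graph_eq]
  intro z hz hz0
  have hcl : ∀ y : T.domain, inner ℂ z.2 (y : E) = inner ℂ z.1 (T y) := by
    intro y
    have hc : IsClosed {z : E × E | inner ℂ z.2 (y : E) = inner ℂ z.1 (T y)} :=
      isClosed_eq (by fun_prop) (by fun_prop)
    refine closure_minimal ?_ hc hz
    intro w hw
    obtain ⟨x, hx1, hx2⟩ := (LinearPMap.mem_graph_iff T).1 hw
    rw [Set.mem_ofPred_eq, ← hx1, ← hx2]
    exact hT x y
  refine hdense.eq_zero_of_inner_left (𝕜 := ℂ) fun v hv => ?_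
  have := hcl ⟨v, hv⟩
  rwa [hz0, inner_zero_left] at this

/-- The graph of the closure is the closure of the graph, so closed relations between argument and
value survive. This carries lower bounds and symmetry over to the closure. -/
theorem closure_graph_induction {P : E × E → Prop} (hclos : T.IsClosable)
    (hP : IsClosed {z | P z}) (h : ∀ x : T.domain, P (x, T x)) (x : T.closure.domain) :
    P (x, T.closure x) := by
  have hx : ((x : E), T.closure x) ∈ T.graph.topologicalClosure := by
    rw [hclos.graph_closure_eq_closure_graph]
    exact LinearPMap.mem_graph _ x
  refine closure_minimal (s := (T.graph : Set (E × E))) ?_ hP hx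
  intro w hw
  obtain ⟨y, hy1, hy2⟩ := (LinearPMap.mem_graph_iff T).1 hw
  have := h y
  rw [hy1, hy2] at this
  exact this

theorem mem_closure_domain_of_tendsto (hclos : T.IsClosable) {u : ℕ → T.domain} {x y : E}
    (hx : Tendsto (fun n => (u n : E)) atTop (𝓝 x)) (hy : Tendsto (fun n => T (u n)) atTop (𝓝 y)) :
    ∃ h : x ∈ T.closure.domain, T.closure ⟨x, h⟩ = y := by
  have hmem : (x, y) ∈ T.closure.graph := by
    rw [← hclos.graph_closure_eq_closure_graph]
    refine mem_closure_of_tendsto (hx.prodMk_nhds hy) (Eventually.of_forall fun n => ?_)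
    exact LinearPMap.mem_graph T (u n)
  obtain ⟨z, hz1, hz2⟩ := (LinearPMap.mem_graph_iff _).1 hmem
  simp only at hz1 hz2
  subst hz1
  exact ⟨z.2, hz2⟩

/-- Cauchy–Schwarz for `v - xu` tested against `u`. With `v = Tu` it makes `T - x` bounded below for
every `x` under a lower form bound of `T`. -/
theorem mul_norm_le_norm_sub {γ x : ℝ} (u v : E) (hγ : γ * ‖u‖ ^ 2 ≤ (inner ℂ v u).re) :
    (γ - x) * ‖u‖ ≤ ‖v - (x : ℂ) • u‖ := by
  have h1 : (inner ℂ (v - (x : ℂ) • u) u).re = (inner ℂ v u).re - x * ‖u‖ ^ 2 := by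
    rw [inner_sub_left, inner_smul_left, Complex.conj_ofReal, Complex.sub_re,
      Complex.re_ofReal_mul, re_inner_self_eq]
  have h2 := (Complex.re_le_norm _).trans (norm_inner_le_norm (𝕜 := ℂ) (v - (x : ℂ) • u) u)
  by_cases h0 : ‖u‖ = 0
  · rw [h0, mul_zero]; exact norm_nonneg _
  · have h7 : 0 < ‖u‖ := lt_of_le_of_ne (norm_nonneg _) (Ne.symm h0)
    refine le_of_mul_le_mul_right ?_ h7
    nlinarith

/-- Density of the range of `T - x` propagates up to the lower bound of `T`. -/
theorem denseRange_of_denseRange [CompleteSpace E] {γ x x' : ℝ}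
    (hγ : ∀ u : T.domain, γ * ‖(u : E)‖ ^ 2 ≤ (inner ℂ (T u) (u : E)).re)
    (hx : DenseRange fun u : T.domain => T u - (x : ℂ) • (u : E)) (hxx' : x ≤ x') (hx' : x' < γ) :
    DenseRange fun u : T.domain => T u - (x' : ℂ) • (u : E) := by
  let L : T.domain →ₗ[ℂ] E := T.toFun - (x' : ℂ) • T.domain.subtype
  have hL : ∀ u, L u = T u - (x' : ℂ) • (u : E) := fun u => rfl
  have hmain : (LinearMap.range L)ᗮ = ⊥ := by
    rw [Submodule.eq_bot_iff]
    intro φ hφ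
    -- A vector orthogonal to the range of `T - x'` sees the range of `T - x` only through `(x' -
    -- x)u`, and `‖u‖ ≤ ‖(T - x)u‖/(γ - x)`. Since that range is dense, `⟨φ,·⟩` has norm at most
    -- `(x' - x)/(γ - x) < 1` times `‖φ‖`.
    have h1 : ∀ u : T.domain, inner ℂ φ (T u - (x : ℂ) • (u : E))
        = ((x' - x : ℝ) : ℂ) * inner ℂ φ (u : E) := by
      intro u
      have := (Submodule.mem_orthogonal' _ _).1 hφ (L u) ⟨u, rfl⟩
      rw [hL, inner_sub_right, inner_smul_right] at this
      rw [inner_sub_right, inner_smul_right]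
      push_cast
      linear_combination this
    have h2 : ∀ y : E, ‖inner ℂ φ y‖ ≤ (x' - x) / (γ - x) * ‖φ‖ * ‖y‖ := by
      intro y
      have hc : IsClosed {y : E | ‖inner ℂ φ y‖ ≤ (x' - x) / (γ - x) * ‖φ‖ * ‖y‖} :=
        isClosed_le (by fun_prop) (by fun_prop)
      refine closure_minimal ?_ hc (hx y)
      rintro _ ⟨u, rfl⟩
      rw [Set.mem_ofPred_eq, h1, norm_mul, Complex.norm_real,
        Real.norm_of_nonneg (by linarith)]
      have h3 := norm_inner_le_norm (𝕜 := ℂ) φ (u : E)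
      have h4 := mul_norm_le_norm_sub (x := x) (u : E) (T u) (hγ u)
      have h5 : ‖(u : E)‖ ≤ ‖T u - (x : ℂ) • (u : E)‖ / (γ - x) := by
        rw [le_div_iff₀ (by linarith)]
        linarith
      calc (x' - x) * ‖inner ℂ φ (u : E)‖ ≤ (x' - x) * (‖φ‖ * ‖(u : E)‖) := by
            gcongr
        _ ≤ (x' - x) * (‖φ‖ * (‖T u - (x : ℂ) • (u : E)‖ / (γ - x))) := by
            gcongr
        _ = _ := by ring
    by_contra h0
    have hφ0 : 0 < ‖φ‖ := norm_pos_iff.2 h0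
    have h3 := h2 φ
    rw [inner_self_eq_norm_sq_to_K] at h3
    have h4 : ‖((‖φ‖ : ℝ) : ℂ) ^ 2‖ = ‖φ‖ ^ 2 := by simp
    have h5 : (x' - x) / (γ - x) < 1 := by
      rw [div_lt_one (by linarith)]
      linarith
    have h6 : ‖φ‖ ^ 2 ≤ (x' - x) / (γ - x) * ‖φ‖ * ‖φ‖ := by rw [← h4]; exact h3
    nlinarith [mul_pos hφ0 hφ0]
  rw [← Submodule.topologicalClosure_eq_top_iff] at hmain
  have h7 : Dense ((LinearMap.range L : Submodule ℂ E) : Set E) :=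
    Submodule.dense_iff_topologicalClosure_eq_top.2 hmain
  exact h7

/-- Below the form bound, `T - x` controls the norm from below. This survives closure and gives
injectivity and a bounded inverse; applied to approximating sequences from the dense range it makes
preimages Cauchy, and the closure contains their limit. -/
theorem mem_resolventSet_closure [CompleteSpace E] {γ x : ℝ} (hclos : T.IsClosable)
    (hγ : ∀ u : T.domain, γ * ‖(u : E)‖ ^ 2 ≤ (inner ℂ (T u) (u : E)).re)
    (hx : DenseRange fun u : T.domain => T u - (x : ℂ) • (u : E)) (hxγ : x < γ) :
    (x : ℂ) ∈ resolventSet T.closure := by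
  have hpos : 0 < γ - x := by linarith
  have hlow : ∀ u : T.closure.domain,
      (γ - x) * ‖(u : E)‖ ≤ ‖T.closure u - (x : ℂ) • (u : E)‖ := by
    refine closure_graph_induction
      (P := fun z : E × E => (γ - x) * ‖z.1‖ ≤ ‖z.2 - (x : ℂ) • z.1‖) hclos ?_ ?_
    · exact isClosed_le (by fun_prop) (by fun_prop)
    · exact fun u => mul_norm_le_norm_sub _ _ (hγ u)
  let L : T.closure.domain →ₗ[ℂ] E := T.closure.toFun - (x : ℂ) • T.closure.domain.subtype
  have hL : ∀ u, L u = T.closure u - (x : ℂ) • (u : E) := fun u => rfl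
  have hinj : Function.Injective L := by
    rw [injective_iff_map_eq_zero]
    intro u hu
    have := hlow u
    rw [← hL, hu, norm_zero] at this
    have h0 : ‖(u : E)‖ ≤ 0 := by nlinarith [norm_nonneg (u : E)]
    exact Subtype.ext (norm_le_zero_iff.1 h0)
  have hsurj : Function.Surjective L := by
    intro y
    obtain ⟨v, hv, hvy⟩ := mem_closure_iff_seq_limit.1 (hx y)
    choose u hu using hv
    have hTu : ∀ n, T (u n) - (x : ℂ) • (u n : E) = v n := hu
    have hcauchy : CauchySeq fun n => (u n : E) := by
      rw [Metric.cauchySeq_iff']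
      intro ε hε
      obtain ⟨N, hN⟩ := Metric.cauchySeq_iff'.1 hvy.cauchySeq ((γ - x) * ε) (by positivity)
      refine ⟨N, fun n hn => ?_⟩
      have h1 := hN n hn
      rw [dist_eq_norm] at h1 ⊢
      have h2 := mul_norm_le_norm_sub (x := x) _ _ (hγ (u n - u N))
      have h3 : T (u n - u N) - (x : ℂ) • ((u n - u N : T.domain) : E) = v n - v N := by
        rw [← hTu, ← hTu, LinearPMap.map_sub, Submodule.coe_sub]
        module
      rw [h3, Submodule.coe_sub] at h2
      exact lt_of_mul_lt_mul_left (h2.trans_lt h1) hpos.le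
    obtain ⟨w, hw⟩ := cauchySeq_tendsto_of_complete hcauchy
    have hTlim : Tendsto (fun n => T (u n)) atTop (𝓝 (y + (x : ℂ) • w)) := by
      have := hvy.add (hw.const_smul (x : ℂ))
      refine this.congr fun n => ?_
      rw [← hTu]
      abel
    obtain ⟨h, h'⟩ := mem_closure_domain_of_tendsto hclos hw hTlim
    exact ⟨⟨w, h⟩, by rw [hL, h']; simp⟩
  let e : T.closure.domain ≃ₗ[ℂ] E := LinearEquiv.ofBijective L ⟨hinj, hsurj⟩
  have he : ∀ y, T.closure (e.symm y) - (x : ℂ) • (e.symm y : E) = y :=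
    fun y => e.apply_symm_apply y
  let R : E →L[ℂ] E := (T.closure.domain.subtype ∘ₗ e.symm.toLinearMap).mkContinuous (γ - x)⁻¹
    fun y => by
      have := hlow (e.symm y)
      rw [he] at this
      rw [inv_mul_eq_div, le_div_iff₀ hpos]
      simpa [mul_comm] using this
  refine ⟨R, fun y => ⟨(e.symm y).2, he y⟩, fun u => ?_⟩
  have : e u = T.closure u - (x : ℂ) • (u : E) := rfl
  change ((e.symm (T.closure u - (x : ℂ) • (u : E)) : T.closure.domain) : E) = u
  rw [← this, e.symm_apply_apply]

/-- A resolvent point that is a lower bound of the form of `T` is strictly below the form. -/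
theorem exists_pos_of_mem_resolventSet {γ : ℝ} (hclos : T.IsClosable)
    (hT : ∀ x y : T.domain, inner ℂ (T x) (y : E) = inner ℂ (x : E) (T y))
    (hγ : ∀ u : T.domain, γ * ‖(u : E)‖ ^ 2 ≤ (inner ℂ (T u) (u : E)).re)
    (h : (γ : ℂ) ∈ resolventSet T.closure) :
    ∃ ε > 0, ∀ u : T.domain, ‖(u : E)‖ = 1 → γ + ε ≤ (inner ℂ (T u) (u : E)).re := by
  obtain ⟨R, hR1, hR2⟩ := h
  have hγ' : ∀ u : T.closure.domain, γ * ‖(u : E)‖ ^ 2 ≤ (inner ℂ (T.closure u) (u : E)).re := by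
    refine closure_graph_induction
      (P := fun z : E × E => γ * ‖z.1‖ ^ 2 ≤ (inner ℂ z.2 z.1).re) hclos ?_ hγ
    exact isClosed_le (by fun_prop) (Complex.continuous_re.comp (by fun_prop))
  have hpos : ∀ y : E, 0 ≤ (inner ℂ (R y) y).re := by
    intro y
    obtain ⟨hy, hy'⟩ := hR1 y
    have h1 := hγ' ⟨R y, hy⟩
    have h2 : (inner ℂ y (R y)).re
        = (inner ℂ (T.closure ⟨R y, hy⟩) (R y)).re - γ * ‖R y‖ ^ 2 := by
      nth_rw 1 [← hy']
      rw [inner_sub_left, inner_smul_left, Complex.conj_ofReal, Complex.sub_re,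
        Complex.re_ofReal_mul, re_inner_self_eq]
    rw [← inner_conj_symm, Complex.conj_re, h2]
    simpa using h1
  have hle := T.le_closure
  -- The gap comes from positivity of the resolvent `R` at `γ`, tested on `y - tu` with `y = (T -
  -- γ)u`. Since `Ry = u` and `⟨Ru,y⟩ = ‖u‖² = 1`, this reads `0 ≤ ⟨Tu,u⟩ - γ - 2t + t²⟨Ru,u⟩`, and
  -- with `t = 1/(‖R‖ + 1)` the loss `t²‖R‖` is at most `t`.
  refine ⟨(‖R‖ + 1)⁻¹, by positivity, fun u hu => ?_⟩
  set y : E := T u - (γ : ℂ) • (u : E) with hy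
  have hRy : R y = u := by
    have h1 := hR2 ⟨u, hle.1 u.2⟩
    have h2 : T.closure ⟨u, hle.1 u.2⟩ = T u := (hle.2 rfl).symm
    rw [h2] at h1
    exact h1
  have hyu : (inner ℂ (R y) y).re = (inner ℂ (T u) (u : E)).re - γ := by
    rw [hRy, ← inner_conj_symm, Complex.conj_re, hy, inner_sub_left, inner_smul_left,
      Complex.conj_ofReal, Complex.sub_re, Complex.re_ofReal_mul, re_inner_self_eq, hu]
    simp
  set t : ℝ := (‖R‖ + 1)⁻¹ with ht
  have ht0 : 0 < t := by positivity
  have htR : t * ‖R‖ ≤ 1 := by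
    rw [ht, inv_mul_le_iff₀ (by positivity)]
    linarith
  have hsymm : inner ℂ (R (u : E)) y = inner ℂ (u : E) (u : E) := by
    obtain ⟨hv, hv'⟩ := hR1 u
    have h1 : ∀ x : T.closure.domain, inner ℂ (T.closure x) (u : E) = inner ℂ (x : E) (T u) := by
      refine closure_graph_induction
        (P := fun z : E × E => inner ℂ z.2 (u : E) = inner ℂ z.1 (T u)) hclos ?_ fun x => hT x u
      exact isClosed_eq (by fun_prop) (by fun_prop)
    have h2 := h1 ⟨R u, hv⟩
    conv_rhs => enter [2]; rw [← hv']
    rw [inner_sub_left, h2, hy, inner_sub_right, inner_smul_left, inner_smul_right,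
      Complex.conj_ofReal]
  have h1 := hpos (y - (t : ℂ) • (u : E))
  have h2 : (inner ℂ (R (y - (t : ℂ) • (u : E))) (y - (t : ℂ) • (u : E))).re
      = (inner ℂ (R y) y).re - 2 * t + t ^ 2 * (inner ℂ (R (u : E)) (u : E)).re := by
    clear_value y
    rw [map_sub, map_smul, inner_sub_left, inner_sub_right, inner_sub_right, inner_smul_left,
      inner_smul_left, inner_smul_right, inner_smul_right, hsymm, hRy, Complex.conj_ofReal]
    simp only [Complex.sub_re, Complex.re_ofReal_mul, re_inner_self_eq, hu]
    ring
  have h3 : (inner ℂ (R (u : E)) (u : E)).re ≤ ‖R‖ := by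
    have := (Complex.re_le_norm _).trans (norm_inner_le_norm (𝕜 := ℂ) (R (u : E)) (u : E))
    have h4 := R.le_opNorm (u : E)
    rw [hu, mul_one] at this h4
    exact this.trans h4
  rw [h2, hyu] at h1
  nlinarith [mul_le_mul_of_nonneg_left h3 (sq_nonneg t)]

/-- The set of expectation values of an operator on unit vectors of its domain. -/
def formValues (T : E →ₗ.[ℂ] E) : Set ℝ :=
  {r | ∃ u : T.domain, ‖(u : E)‖ = 1 ∧ (inner ℂ (T u) (u : E)).re = r}

theorem formValues_nonempty [Nontrivial E] (hdense : Dense (T.domain : Set E)) :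
    (formValues T).Nonempty := by
  obtain ⟨x, hx⟩ := exists_ne (0 : E)
  obtain ⟨v, hv, hvx⟩ := Metric.mem_closure_iff.1 (hdense x) ‖x‖ (norm_pos_iff.2 hx)
  have hv0 : v ≠ 0 := by
    rintro rfl
    simp at hvx
  refine ⟨_, ((‖v‖⁻¹ : ℝ) : ℂ) • ⟨v, hv⟩, ?_, rfl⟩
  rw [Submodule.coe_smul, norm_smul, Complex.norm_real, norm_inv, norm_norm,
    inv_mul_cancel₀ (norm_ne_zero_iff.2 hv0)]

theorem sInf_formValues_mul_le (hbdd : BddBelow (formValues T)) (u : T.domain) :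
    sInf (formValues T) * ‖(u : E)‖ ^ 2 ≤ (inner ℂ (T u) (u : E)).re := by
  by_cases h0 : ‖(u : E)‖ = 0
  · rw [h0, norm_eq_zero.1 h0]
    simp
  · have h1 : (inner ℂ (T u) (u : E)).re / ‖(u : E)‖ ^ 2 ∈ formValues T := by
      refine ⟨((‖(u : E)‖⁻¹ : ℝ) : ℂ) • u, ?_, ?_⟩
      · rw [Submodule.coe_smul, norm_smul, Complex.norm_real, norm_inv, norm_norm,
          inv_mul_cancel₀ h0]
      · rw [LinearPMap.map_smul, Submodule.coe_smul, inner_smul_left, inner_smul_right,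
          Complex.conj_ofReal, Complex.re_ofReal_mul, Complex.re_ofReal_mul]
        field_simp
    have h2 := csInf_le hbdd h1
    rwa [le_div_iff₀ (by positivity)] at h2

/-- For a symmetric, semibounded, essentially self-adjoint operator the infimum of the real
spectrum of the closure is the infimum of the expectation values. -/
theorem isGLB_spectrumOf_closure [CompleteSpace E] [Nontrivial E]
    (hdense : Dense (T.domain : Set E))
    (hT : ∀ x y : T.domain, inner ℂ (T x) (y : E) = inner ℂ (x : E) (T y))
    (hbdd : BddBelow (formValues T)) {x₀ : ℝ}
    (hrange : ∀ x < x₀, DenseRange fun u : T.domain => T u - (x : ℂ) • (u : E)) :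
    IsGLB {x : ℝ | (x : ℂ) ∈ spectrumOf T.closure} (sInf (formValues T)) := by
  have hclos := isClosable_of_symm hdense hT
  have hγ := sInf_formValues_mul_le hbdd
  constructor
  · intro x hx
    by_contra! hlt
    -- Density of the range is known only below `x₀`; it is carried upwards to `x` from a point
    -- below both `x` and `x₀`.
    refine hx (mem_resolventSet_closure hclos hγ ?_ hlt)
    exact denseRange_of_denseRange hγ (hrange (min x x₀ - 1) (by
      have := min_le_right x x₀; linarith)) (by have := min_le_left x x₀; linarith) hlt
  · intro b hb
    -- The infimum of the expectation values is itself in the spectrum: a resolvent point there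
    -- would leave a gap above it. In particular the spectrum is nonempty.
    refine hb (Set.mem_ofPred_eq ▸ fun hres => ?_)
    obtain ⟨ε, hε, h⟩ := exists_pos_of_mem_resolventSet hclos hT hγ hres
    have : sInf (formValues T) + ε ≤ sInf (formValues T) := by
      refine le_csInf (formValues_nonempty hdense) ?_
      rintro _ ⟨u, hu, rfl⟩
      exact h u hu
    linarith

end Spectrum

end DiracPolaron

namespace DiracPolaron

theorem hasSum_of_eq {V : Type*} [AddCommMonoid V] [TopologicalSpace V] {f g : ℕ → V} {a : V}
    (hg : HasSum g a) (h : ∀ n, f n = g n) : HasSum f a := by rwa [funext h]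

/-! ### Wave functions -/

theorem stronglyMeasurable_wave (ψ : Fock) (n : ℕ) : StronglyMeasurable (wave ψ n) :=
  Lp.stronglyMeasurable _

theorem memLp_wave (ψ : Fock) (n : ℕ) : MemLp (wave ψ n) 2 (configMeasure n) :=
  Lp.memLp ((ψ n : nPhoton n) : Lp ℂ 2 (configMeasure n))

theorem integrable_norm_sq_wave (ψ : Fock) (n : ℕ) :
    Integrable (fun x => ‖wave ψ n x‖ ^ 2) (configMeasure n) :=
  (memLp_two_iff_integrable_sq_norm (memLp_wave ψ n).1).1 (memLp_wave ψ n)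

theorem wave_perm (ψ : Fock) (n : ℕ) (s : Equiv.Perm (Fin n)) :
    (fun x => wave ψ n (x ∘ s)) =ᵐ[configMeasure n] wave ψ n := by
  have h1 := Lp.coeFn_compMeasurePreserving
    ((ψ n : nPhoton n) : Lp ℂ 2 (configMeasure n)) (measurePreserving_perm s)
  rw [(ψ n).2 s] at h1
  exact h1.symm

theorem hasSum_inner_wave (ψ φ : Fock) :
    HasSum (fun n => ∫ x, inner ℂ (wave ψ n x) (wave φ n x) ∂configMeasure n) (inner ℂ ψ φ) :=
  lp.hasSum_inner ψ φ

theorem integrable_inner_of_memLp {α V : Type*} [MeasurableSpace α] {μ : Measure α}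
    [NormedAddCommGroup V] [InnerProductSpace ℂ V] {u v : α → V}
    (hu : MemLp u 2 μ) (hv : MemLp v 2 μ) : Integrable (fun x => inner ℂ (u x) (v x)) μ := by
  refine (L2.integrable_inner (𝕜 := ℂ) (hu.toLp u) (hv.toLp v)).congr ?_
  filter_upwards [hu.coeFn_toLp, hv.coeFn_toLp] with x h1 h2
  rw [h1, h2]

theorem inner_toLp_eq {α V : Type*} [MeasurableSpace α] {μ : Measure α}
    [NormedAddCommGroup V] [InnerProductSpace ℂ V] {u v : α → V}
    (hu : MemLp u 2 μ) (hv : MemLp v 2 μ) :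
    inner ℂ (hu.toLp u) (hv.toLp v) = ∫ x, inner ℂ (u x) (v x) ∂μ := by
  rw [L2.inner_def]
  refine integral_congr_ae ?_
  filter_upwards [hu.coeFn_toLp, hv.coeFn_toLp] with x h1 h2
  rw [h1, h2]

theorem integral_inner_self_eq {α V : Type*} [MeasurableSpace α] {μ : Measure α}
    [NormedAddCommGroup V] [InnerProductSpace ℂ V] (u : α → V) :
    ∫ x, inner ℂ (u x) (u x) ∂μ = ((∫ x, ‖u x‖ ^ 2 ∂μ : ℝ) : ℂ) := by
  rw [← integral_complex_ofReal]
  refine integral_congr_ae (Filter.Eventually.of_forall fun x => ?_)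
  simp only [inner_self_eq_norm_sq_to_K]
  simp

theorem norm_toLp_sq_eq {α V : Type*} [MeasurableSpace α] {μ : Measure α}
    [NormedAddCommGroup V] [InnerProductSpace ℂ V] {u : α → V} (hu : MemLp u 2 μ) :
    ‖hu.toLp u‖ ^ 2 = ∫ x, ‖u x‖ ^ 2 ∂μ := by
  rw [← re_inner_self_eq, inner_toLp_eq, integral_inner_self_eq, Complex.ofReal_re]

theorem norm_integral_inner_sq_le {α V : Type*} [MeasurableSpace α] {μ : Measure α}
    [NormedAddCommGroup V] [InnerProductSpace ℂ V] {u v : α → V}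
    (hu : MemLp u 2 μ) (hv : MemLp v 2 μ) :
    ‖∫ x, inner ℂ (u x) (v x) ∂μ‖ ^ 2 ≤ (∫ x, ‖u x‖ ^ 2 ∂μ) * ∫ x, ‖v x‖ ^ 2 ∂μ := by
  rw [← inner_toLp_eq hu hv, ← norm_toLp_sq_eq hu, ← norm_toLp_sq_eq hv, ← mul_pow]
  gcongr
  exact norm_inner_le_norm _ _

theorem hasSum_norm_sq_wave (ψ : Fock) :
    HasSum (fun n => ∫ x, ‖wave ψ n x‖ ^ 2 ∂configMeasure n) (‖ψ‖ ^ 2) := by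
  have h := Complex.hasSum_re (hasSum_inner_wave ψ ψ)
  rw [re_inner_self_eq] at h
  simpa only [integral_inner_self_eq, Complex.ofReal_re] using h

/-- Fock space vectors from square summable families of symmetric functions. -/
theorem exists_fock_of_summable (f : ∀ n, (Fin n → Photon) → ℂ)
    (hf : ∀ n, MemLp (f n) 2 (configMeasure n))
    (hs : ∀ n (s : Equiv.Perm (Fin n)), (fun x => f n (x ∘ s)) =ᵐ[configMeasure n] f n)
    (hsum : Summable fun n => ∫ x, ‖f n x‖ ^ 2 ∂configMeasure n) :
    ∃ φ : Fock, ∀ n, wave φ n =ᵐ[configMeasure n] f n := by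
  have hmem : ∀ n, (hf n).toLp (f n) ∈ nPhoton n := by
    intro n s
    refine Lp.ext ?_
    have h1 := Lp.coeFn_compMeasurePreserving ((hf n).toLp (f n)) (measurePreserving_perm s)
    have h2 := (measurePreserving_perm s).quasiMeasurePreserving.ae (hf n).coeFn_toLp
    filter_upwards [h1, h2, (hf n).coeFn_toLp, hs n s] with x h1 h2 h3 h4
    rw [h1, Function.comp_apply, h2, h3, ← h4]
  have hnorm : ∀ n, ‖(⟨(hf n).toLp (f n), hmem n⟩ : nPhoton n)‖ ^ 2
      = ∫ x, ‖f n x‖ ^ 2 ∂configMeasure n := fun n => norm_toLp_sq_eq (hf n)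
  refine ⟨⟨fun n => ⟨(hf n).toLp (f n), hmem n⟩, memℓp_gen ?_⟩, fun n => (hf n).coeFn_toLp⟩
  refine hsum.congr fun n => ?_
  rw [← hnorm]
  simp

/-- Multiplication of a Fock space vector by a family of symmetric functions. -/
theorem exists_mul_wave (ψ χ : Fock) (F : ∀ n, (Fin n → Photon) → ℝ) (hF : ∀ n, Measurable (F n))
    (hs : ∀ n (s : Equiv.Perm (Fin n)) x, F n (x ∘ s) = F n x)
    (hb : ∀ n, ∀ᵐ x ∂configMeasure n, ‖(F n x : ℂ) * wave ψ n x‖ ≤ ‖wave χ n x‖) :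
    ∃ φ : Fock, (∀ n, wave φ n =ᵐ[configMeasure n] fun x => (F n x : ℂ) * wave ψ n x)
      ∧ ‖φ‖ ≤ ‖χ‖ := by
  have hm : ∀ n, MemLp (fun x => (F n x : ℂ) * wave ψ n x) 2 (configMeasure n) := fun n =>
    (memLp_wave χ n).of_le ((Complex.measurable_ofReal.comp (hF n)).aestronglyMeasurable.mul
      (stronglyMeasurable_wave ψ n).aestronglyMeasurable) (hb n)
  have hle : ∀ n, ∫ x, ‖(F n x : ℂ) * wave ψ n x‖ ^ 2 ∂configMeasure n
      ≤ ∫ x, ‖wave χ n x‖ ^ 2 ∂configMeasure n := by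
    intro n
    refine integral_mono_ae ((memLp_two_iff_integrable_sq_norm (hm n).1).1 (hm n))
      (integrable_norm_sq_wave χ n) ?_
    filter_upwards [hb n] with x hx
    gcongr
  have hsum : Summable fun n => ∫ x, ‖(F n x : ℂ) * wave ψ n x‖ ^ 2 ∂configMeasure n :=
    Summable.of_nonneg_of_le (fun n => integral_nonneg fun x => by positivity) hle
      (hasSum_norm_sq_wave χ).summable
  obtain ⟨φ, hφ⟩ := exists_fock_of_summable _ hm (fun n s => by
    filter_upwards [wave_perm ψ n s] with x hx
    rw [hs, hx]) hsum
  refine ⟨φ, hφ, ?_⟩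
  rw [← sq_le_sq₀ (norm_nonneg _) (norm_nonneg _)]
  refine hasSum_le (fun n => ?_) (hasSum_norm_sq_wave φ) (hasSum_norm_sq_wave χ)
  refine le_trans (le_of_eq (integral_congr_ae ?_)) (hle n)
  filter_upwards [hφ n] with x hx
  rw [hx]

/-! ### Second quantization -/

/-- The sum of the one-photon quantity `w` over a configuration. -/
def sumOver (w : Photon → ℝ) {n : ℕ} (x : Fin n → Photon) : ℝ := ∑ i, w (x i)

theorem measurable_sumOver {w : Photon → ℝ} (hw : Measurable w) (n : ℕ) :
    Measurable fun x : Fin n → Photon => sumOver w x := by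
  unfold sumOver
  fun_prop

theorem sumOver_perm (w : Photon → ℝ) {n : ℕ} (s : Equiv.Perm (Fin n)) (x : Fin n → Photon) :
    sumOver w (x ∘ s) = sumOver w x :=
  Equiv.sum_comp s fun i => w (x i)

theorem dGamma_graph (w : Photon → ℝ) : (dGamma w).graph = dGammaGraph w :=
  Submodule.toLinearPMap_graph_eq _ (dGammaGraph_functional w)

theorem wave_dGamma (w : Photon → ℝ) (ψ : (dGamma w).domain) (n : ℕ) :
    wave (dGamma w ψ) n =ᵐ[configMeasure n]
      fun x => (sumOver w x : ℂ) * wave (ψ : Fock) n x := by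
  have h := (dGamma w).mem_graph ψ
  rw [dGamma_graph] at h
  exact h n

theorem exists_dGamma_eq {w : Photon → ℝ} {ψ φ : Fock}
    (h : ∀ n, wave φ n =ᵐ[configMeasure n] fun x => (sumOver w x : ℂ) * wave ψ n x) :
    ∃ hψ : ψ ∈ (dGamma w).domain, dGamma w ⟨ψ, hψ⟩ = φ := by
  have h1 : (ψ, φ) ∈ (dGamma w).graph := by
    rw [dGamma_graph]
    exact h
  obtain ⟨y, hy1, hy2⟩ := (LinearPMap.mem_graph_iff _).1 h1
  simp only at hy1 hy2
  subst hy1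
  exact ⟨y.2, hy2⟩

/-- Pointwise domination by `dΓ(w')ψ` makes the product with `sumOver w` square summable. -/
theorem dGamma_domain_le {w w' : Photon → ℝ} (hw : Measurable w)
    (h : ∀ n (x : Fin n → Photon), |sumOver w x| ≤ |sumOver w' x|) {ψ : Fock}
    (hψ : ψ ∈ (dGamma w').domain) : ψ ∈ (dGamma w).domain := by
  obtain ⟨φ, hφ, -⟩ := exists_mul_wave ψ (dGamma w' ⟨ψ, hψ⟩) (fun n x => sumOver w x)
    (measurable_sumOver hw) (fun n s x => sumOver_perm w s x) (fun n => by
      filter_upwards [wave_dGamma w' ⟨ψ, hψ⟩ n] with x hx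
      rw [hx, norm_mul, norm_mul, Complex.norm_real, Complex.norm_real]
      gcongr
      exact h n x)
  exact (exists_dGamma_eq hφ).1

theorem dGamma_symm (w : Photon → ℝ) (ψ φ : (dGamma w).domain) :
    inner ℂ (dGamma w ψ) (φ : Fock) = inner ℂ (ψ : Fock) (dGamma w φ) := by
  refine (hasSum_inner_wave _ _).unique ?_
  convert hasSum_inner_wave (ψ : Fock) (dGamma w φ) using 2 with n
  refine integral_congr_ae ?_
  filter_upwards [wave_dGamma w ψ n, wave_dGamma w φ n] with x h1 h2
  simp only [h1, h2, ← smul_eq_mul, inner_smul_left, inner_smul_right, Complex.conj_ofReal]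

theorem hasSum_re_inner_dGamma (w : Photon → ℝ) (ψ : (dGamma w).domain) :
    HasSum (fun n => ∫ x, sumOver w x * ‖wave (ψ : Fock) n x‖ ^ 2 ∂configMeasure n)
      (inner ℂ (dGamma w ψ) (ψ : Fock)).re := by
  have h := Complex.hasSum_re (hasSum_inner_wave (dGamma w ψ) ψ)
  convert h using 2 with n
  have h1 : ∫ x, inner ℂ (wave (dGamma w ψ) n x) (wave (ψ : Fock) n x) ∂configMeasure n
      = ∫ x, ((sumOver w x * ‖wave (ψ : Fock) n x‖ ^ 2 : ℝ) : ℂ) ∂configMeasure n := by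
    refine integral_congr_ae ?_
    filter_upwards [wave_dGamma w ψ n] with x hx
    rw [hx, ← smul_eq_mul, inner_smul_left, Complex.conj_ofReal, inner_self_eq_norm_sq_to_K]
    push_cast
    rfl
  rw [h1, integral_complex_ofReal, Complex.ofReal_re]

theorem integrable_sumOver_mul {w : Photon → ℝ} (ψ : (dGamma w).domain) (n : ℕ) :
    Integrable (fun x => sumOver w x * ‖wave (ψ : Fock) n x‖ ^ 2) (configMeasure n) := by
  have h := integrable_inner_of_memLp (memLp_wave (dGamma w ψ) n) (memLp_wave (ψ : Fock) n)
  refine h.re.congr ?_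
  filter_upwards [wave_dGamma w ψ n] with x hx
  rw [hx, ← smul_eq_mul, inner_smul_left, Complex.conj_ofReal, inner_self_eq_norm_sq_to_K]
  change (((sumOver w x : ℝ) : ℂ) * ((‖wave (ψ : Fock) n x‖ : ℝ) : ℂ) ^ 2).re = _
  rw [← Complex.ofReal_pow, ← Complex.ofReal_mul, Complex.ofReal_re]

/-- The preimage is `y` multiplied by `(sumOver w + c)⁻¹`. A positive `c` is needed since `sumOver
w` vanishes on the vacuum sector. -/
theorem dGamma_add_surjective {w : Photon → ℝ} (hw : Measurable w) (h0 : ∀ k, 0 ≤ w k) {c : ℝ}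
    (hc : 0 < c) (y : Fock) : ∃ ψ : (dGamma w).domain, dGamma w ψ + (c : ℂ) • (ψ : Fock) = y := by
  have hpos : ∀ n (x : Fin n → Photon), 0 ≤ sumOver w x :=
    fun n x => Finset.sum_nonneg fun i _ => h0 _
  obtain ⟨φ, hφ, -⟩ := exists_mul_wave y ((c⁻¹ : ℂ) • y) (fun n x => (sumOver w x + c)⁻¹)
    (fun n => ((measurable_sumOver hw n).add_const c).inv)
    (fun n s x => by rw [sumOver_perm]) (fun n => by
      filter_upwards [wave_smul (c⁻¹ : ℂ) y n] with x hx
      have h1 := hpos n x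
      rw [hx, Pi.smul_apply, smul_eq_mul, norm_mul, norm_mul, norm_inv (c : ℂ),
        Complex.norm_real, Complex.norm_real, Real.norm_of_nonneg hc.le,
        Real.norm_of_nonneg (by positivity)]
      gcongr
      have := hpos n x
      linarith)
  obtain ⟨χ, hχ, -⟩ := exists_mul_wave y y (fun n x => sumOver w x * (sumOver w x + c)⁻¹)
    (fun n => (measurable_sumOver hw n).mul ((measurable_sumOver hw n).add_const c).inv)
    (fun n s x => by rw [sumOver_perm]) (fun n => by
      refine Filter.Eventually.of_forall fun x => ?_
      have := hpos n x
      rw [norm_mul, Complex.norm_real, Real.norm_of_nonneg (by positivity)]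
      refine mul_le_of_le_one_left (norm_nonneg _) ?_
      rw [← div_eq_mul_inv, div_le_one (by positivity)]
      linarith)
  obtain ⟨hmem, heq⟩ := exists_dGamma_eq (w := w) (ψ := φ) (φ := χ) (fun n => by
    filter_upwards [hφ n, hχ n] with x h1 h2
    rw [h1, h2]
    push_cast
    ring)
  refine ⟨⟨φ, hmem⟩, ?_⟩
  rw [heq]
  refine wave_ext fun n => ?_
  filter_upwards [wave_add χ ((c : ℂ) • φ) n, wave_smul (c : ℂ) φ n, hφ n, hχ n] with x h1 h2 h3 h4
  rw [h1, Pi.add_apply, h2, Pi.smul_apply, h3, h4, smul_eq_mul]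
  have h5 : ((sumOver w x : ℂ) + c) ≠ 0 := by
    have := hpos n x
    have h6 : sumOver w x + c ≠ 0 := by positivity
    exact_mod_cast h6
  push_cast
  field_simp

theorem dGamma_nonneg {w : Photon → ℝ} (h0 : ∀ k, 0 ≤ w k) (ψ : (dGamma w).domain) :
    0 ≤ (inner ℂ (dGamma w ψ) (ψ : Fock)).re :=
  (hasSum_re_inner_dGamma w ψ).nonneg fun n => integral_nonneg fun x =>
    mul_nonneg (Finset.sum_nonneg fun i _ => h0 _) (by positivity)

/-- A vector orthogonal to the domain has the form `(dΓ(w) + 1)ψ` and is orthogonal to `ψ`, so `ψ =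
0` by positivity. -/
theorem dGamma_dense {w : Photon → ℝ} (hw : Measurable w) (h0 : ∀ k, 0 ≤ w k) :
    Dense ((dGamma w).domain : Set Fock) := by
  rw [Submodule.dense_iff_topologicalClosure_eq_top, Submodule.topologicalClosure_eq_top_iff,
    Submodule.eq_bot_iff]
  intro φ hφ
  obtain ⟨ψ, hψ⟩ := dGamma_add_surjective hw h0 one_pos φ
  have h1 : inner ℂ φ (ψ : Fock) = 0 := (Submodule.mem_orthogonal' _ _).1 hφ ψ ψ.2
  have h2 : (inner ℂ φ (ψ : Fock)).re
      = (inner ℂ (dGamma w ψ) (ψ : Fock)).re + ‖(ψ : Fock)‖ ^ 2 := by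
    rw [← hψ, inner_add_left, inner_smul_left, Complex.conj_ofReal, Complex.add_re,
      Complex.re_ofReal_mul, re_inner_self_eq, one_mul]
  rw [h1, Complex.zero_re] at h2
  have h3 := dGamma_nonneg h0 ψ
  have h4 : ‖(ψ : Fock)‖ = 0 := by nlinarith [norm_nonneg (ψ : Fock)]
  have h5 : ψ = 0 := Subtype.ext (norm_eq_zero.1 h4)
  rw [← hψ, h5]
  simp

end DiracPolaron

namespace DiracPolaron

/-! ### Splitting off a photon -/

/-- The measure on pairs of an `n`-photon configuration and a further photon. -/
abbrev splitMeasure (n : ℕ) : Measure ((Fin n → Photon) × Photon) :=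
  (configMeasure n).prod photonMeasure

/-- Adding a photon to a configuration. -/
def consConfig {n : ℕ} (z : (Fin n → Photon) × Photon) : Fin (n + 1) → Photon := Fin.cons z.2 z.1

theorem measurePreserving_consConfig (n : ℕ) :
    MeasurePreserving (consConfig (n := n)) (splitMeasure n) (configMeasure (n + 1)) :=
  measurePreserving_cons n

@[simp] theorem consConfig_zero {n : ℕ} (z : (Fin n → Photon) × Photon) :
    consConfig z 0 = z.2 := rfl

theorem sumOver_consConfig (w : Photon → ℝ) {n : ℕ} (z : (Fin n → Photon) × Photon) :
    sumOver w (consConfig z) = w z.2 + sumOver w z.1 := by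
  simp [sumOver, consConfig, Fin.sum_univ_succ]

theorem integral_consConfig {V : Type*} [NormedAddCommGroup V] [NormedSpace ℝ V] {n : ℕ}
    {F : (Fin (n + 1) → Photon) → V} (hF : AEStronglyMeasurable F (configMeasure (n + 1))) :
    ∫ z, F (consConfig z) ∂splitMeasure n = ∫ x, F x ∂configMeasure (n + 1) := by
  have h := measurePreserving_consConfig n
  rw [← h.map_eq] at hF ⊢
  exact (integral_map h.measurable.aemeasurable hF).symm

theorem memLp_wave_consConfig (ψ : Fock) (n : ℕ) :
    MemLp (fun z => wave ψ (n + 1) (consConfig z)) 2 (splitMeasure n) :=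
  (memLp_wave ψ (n + 1)).comp_measurePreserving (measurePreserving_consConfig n)

/-- In the integral of a sum over photons of symmetric quantities all photons contribute equally. -/
theorem integral_sum_symm {n : ℕ} {h : Photon → (Fin (n + 1) → Photon) → ℝ}
    {F : (Fin (n + 1) → Photon) → ℝ} (h0 : ∀ y x, 0 ≤ h y x) (hF0 : ∀ x, 0 ≤ F x)
    (hperm : ∀ y (s : Equiv.Perm (Fin (n + 1))) x, h y (x ∘ s) = h y x)
    (hF : ∀ s : Equiv.Perm (Fin (n + 1)), (fun x => F (x ∘ s)) =ᵐ[configMeasure (n + 1)] F)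
    (hm : AEStronglyMeasurable (fun x => h (x 0) x * F x) (configMeasure (n + 1)))
    (hint : Integrable (fun x => (∑ j, h (x j) x) * F x) (configMeasure (n + 1))) :
    Integrable (fun z => h z.2 (consConfig z) * F (consConfig z)) (splitMeasure n) ∧
      (n + 1) * ∫ z, h z.2 (consConfig z) * F (consConfig z) ∂splitMeasure n
        = ∫ x, (∑ j, h (x j) x) * F x ∂configMeasure (n + 1) := by
  have hint0 : Integrable (fun x => h (x 0) x * F x) (configMeasure (n + 1)) := by
    refine hint.mono' hm (Filter.Eventually.of_forall fun x => ?_)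
    rw [Real.norm_of_nonneg (mul_nonneg (h0 _ _) (hF0 _))]
    exact mul_le_mul_of_nonneg_right
      (Finset.single_le_sum (f := fun j => h (x j) x) (fun j _ => h0 _ _) (Finset.mem_univ 0))
      (hF0 x)
  -- Exchanging photons `0` and `j` turns the `j`-th summand into the zeroth, and the exchange
  -- preserves the measure.
  have hj : ∀ j, (fun x : Fin (n + 1) → Photon => h (x j) x * F x)
      =ᵐ[configMeasure (n + 1)] fun x => (fun x => h (x 0) x * F x) (x ∘ Equiv.swap 0 j) := by
    intro j
    filter_upwards [hF (Equiv.swap 0 j)] with x hx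
    simp only [hx, hperm, Function.comp_apply, Equiv.swap_apply_left]
  have hintj : ∀ j, Integrable (fun x => h (x j) x * F x) (configMeasure (n + 1)) := fun j =>
    ((measurePreserving_perm (Equiv.swap 0 j)).integrable_comp_of_integrable hint0).congr
      (hj j).symm
  have hvalj : ∀ j, ∫ x, h (x j) x * F x ∂configMeasure (n + 1)
      = ∫ x, h (x 0) x * F x ∂configMeasure (n + 1) := by
    intro j
    have hmp := measurePreserving_perm (Equiv.swap 0 j)
    have h1 := integral_map (μ := configMeasure (n + 1)) hmp.measurable.aemeasurable
      (f := fun x => h (x 0) x * F x) (by rw [hmp.map_eq]; exact hm)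
    rw [hmp.map_eq] at h1
    rw [integral_congr_ae (hj j), h1]
  refine ⟨(measurePreserving_consConfig n).integrable_comp_of_integrable hint0, ?_⟩
  have h1 := integral_consConfig hint0.aestronglyMeasurable
  simp only [consConfig_zero] at h1
  rw [h1]
  simp_rw [Finset.sum_mul]
  rw [integral_finsetSum _ fun j _ => hintj j]
  simp [hvalj]

/-! ### Annihilation -/

/-- The wave functions of `a(f)ψ`. -/
def annWave (f : OnePhoton) (ψ : Fock) (n : ℕ) (x : Fin n → Photon) : ℂ :=
  (Real.sqrt (n + 1) : ℂ) * ∫ y, conj (f y) * wave ψ (n + 1) (Fin.cons y x) ∂photonMeasure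

theorem stronglyMeasurable_annWave (f : OnePhoton) (ψ : Fock) (n : ℕ) :
    StronglyMeasurable (annWave f ψ n) := by
  refine StronglyMeasurable.const_mul ?_ _
  refine StronglyMeasurable.integral_prod_right'
    (f := fun z : (Fin n → Photon) × Photon => conj (f z.2) * wave ψ (n + 1) (consConfig z)) ?_
  refine StronglyMeasurable.mul ?_ ?_
  · exact Complex.continuous_conj.comp_stronglyMeasurable
      ((Lp.stronglyMeasurable f).comp_measurable measurable_snd)
  · exact (stronglyMeasurable_wave ψ (n + 1)).comp_measurable
      (measurePreserving_consConfig n).measurable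

theorem annWave_perm (f : OnePhoton) (ψ : Fock) (n : ℕ) (s : Equiv.Perm (Fin n)) :
    (fun x => annWave f ψ n (x ∘ s)) =ᵐ[configMeasure n] annWave f ψ n := by
  -- The permutation of `n` photons is extended to `n + 1` photons by fixing the annihilated one in
  -- front.
  have h1 := ae_cons (wave_perm ψ (n + 1) (Equiv.Perm.decomposeFin.symm (0, s)))
  filter_upwards [h1] with x hx
  unfold annWave
  congr 1
  refine integral_congr_ae ?_
  filter_upwards [hx] with y hy
  rw [← hy]
  congr 2
  funext i
  refine Fin.cases ?_ (fun i => ?_) i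
  · simp
  · simp

/-- `f = √ω W` with a nonnegative weight `ω` and a square integrable function `W`. -/
structure IsWeighted (f : OnePhoton) (ω : Photon → ℝ) (W : Photon → ℂ) : Prop where
  measurable : Measurable ω
  nonneg : ∀ y, 0 ≤ ω y
  memLp : MemLp W 2 photonMeasure
  eq : ∀ᵐ y ∂photonMeasure, f y = (Real.sqrt (ω y) : ℂ) * W y

variable {f : OnePhoton} {ω : Photon → ℝ} {W : Photon → ℂ}

/-- With weight one, `dΓ(ω)` is the number operator. This puts vectors with a fixed number of
photons in the domain of `a(f)` for every square integrable `f`. -/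
theorem isWeighted_one (f : OnePhoton) : IsWeighted f (fun _ => 1) f :=
  ⟨measurable_const, fun _ => zero_le_one, Lp.memLp f, by simp⟩

theorem norm_sq_wave_perm (ψ : Fock) (n : ℕ) (s : Equiv.Perm (Fin n)) :
    (fun x => ‖wave ψ n (x ∘ s)‖ ^ 2) =ᵐ[configMeasure n] fun x => ‖wave ψ n x‖ ^ 2 := by
  filter_upwards [wave_perm ψ n s] with x hx
  rw [hx]

theorem integral_weight_split (hω : Measurable ω) (h0 : ∀ y, 0 ≤ ω y) (ψ : Fock) (n : ℕ)
    (hint : Integrable (fun x => sumOver ω x * ‖wave ψ (n + 1) x‖ ^ 2) (configMeasure (n + 1))) :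
    Integrable (fun z => ω z.2 * ‖wave ψ (n + 1) (consConfig z)‖ ^ 2) (splitMeasure n) ∧
      (n + 1) * ∫ z, ω z.2 * ‖wave ψ (n + 1) (consConfig z)‖ ^ 2 ∂splitMeasure n
        = ∫ x, sumOver ω x * ‖wave ψ (n + 1) x‖ ^ 2 ∂configMeasure (n + 1) := by
  refine integral_sum_symm (h := fun y _ => ω y) (F := fun x => ‖wave ψ (n + 1) x‖ ^ 2)
    (fun y _ => h0 y) (fun x => by positivity) (fun _ _ _ => rfl)
    (norm_sq_wave_perm ψ (n + 1)) ?_ hint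
  have h1 : Measurable fun x : Fin (n + 1) → Photon => ω (x 0) := hω.comp (measurable_pi_apply 0)
  exact h1.aestronglyMeasurable.mul
    ((stronglyMeasurable_wave ψ (n + 1)).norm.pow 2).aestronglyMeasurable

/-- Cauchy–Schwarz in the annihilated photon, with the weight moved from `f` to `√ω ψ`. By symmetry
the factor `n + 1` turns the weight of that photon into the sum of the weights of all photons. -/
theorem integral_norm_annWave_sq_le (hf : IsWeighted f ω W) (ψ : Fock) (n : ℕ)
    (hint : Integrable (fun x => sumOver ω x * ‖wave ψ (n + 1) x‖ ^ 2) (configMeasure (n + 1))) :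
    MemLp (annWave f ψ n) 2 (configMeasure n) ∧
      ∫ x, ‖annWave f ψ n x‖ ^ 2 ∂configMeasure n ≤ (∫ y, ‖W y‖ ^ 2 ∂photonMeasure)
        * ∫ x, sumOver ω x * ‖wave ψ (n + 1) x‖ ^ 2 ∂configMeasure (n + 1) := by
  obtain ⟨hi, hv⟩ := integral_weight_split hf.measurable hf.nonneg ψ n hint
  have hbound : ∀ᵐ x ∂configMeasure n, ‖annWave f ψ n x‖ ^ 2
      ≤ (n + 1) * (∫ y, ‖W y‖ ^ 2 ∂photonMeasure)
        * ∫ y, ω y * ‖wave ψ (n + 1) (consConfig (x, y))‖ ^ 2 ∂photonMeasure := by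
    filter_upwards [hi.prod_right_ae] with x hx
    have hns : ∀ y, ‖(Real.sqrt (ω y) : ℂ) * wave ψ (n + 1) (consConfig (x, y))‖ ^ 2
        = ω y * ‖wave ψ (n + 1) (consConfig (x, y))‖ ^ 2 := by
      intro y
      rw [norm_mul, mul_pow, Complex.norm_real, Real.norm_of_nonneg (Real.sqrt_nonneg _),
        Real.sq_sqrt (hf.nonneg y)]
    have hm : MemLp (fun y => (Real.sqrt (ω y) : ℂ) * wave ψ (n + 1) (consConfig (x, y))) 2
        photonMeasure := by
      have hmeas : StronglyMeasurable fun y =>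
          (Real.sqrt (ω y) : ℂ) * wave ψ (n + 1) (consConfig (x, y)) := by
        refine StronglyMeasurable.mul ?_ ?_
        · exact (Complex.measurable_ofReal.comp hf.measurable.sqrt).stronglyMeasurable
        · exact (stronglyMeasurable_wave ψ (n + 1)).comp_measurable
            ((measurePreserving_consConfig n).measurable.comp measurable_prodMk_left)
      rw [memLp_two_iff_integrable_sq_norm hmeas.aestronglyMeasurable]
      simpa only [hns] using hx
    have h1 := norm_integral_inner_sq_le hf.memLp hm
    simp_rw [hns] at h1
    have h2 : ∫ y, inner ℂ (W y) ((Real.sqrt (ω y) : ℂ) * wave ψ (n + 1) (consConfig (x, y)))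
          ∂photonMeasure
        = ∫ y, conj (f y) * wave ψ (n + 1) (Fin.cons y x) ∂photonMeasure := by
      refine integral_congr_ae ?_
      filter_upwards [hf.eq] with y hy
      rw [hy, RCLike.inner_apply, map_mul, Complex.conj_ofReal]
      simp only [consConfig]
      ring
    rw [h2] at h1
    unfold annWave
    rw [norm_mul, mul_pow, Complex.norm_real, Real.norm_of_nonneg (Real.sqrt_nonneg _),
      Real.sq_sqrt (by positivity), mul_assoc]
    gcongr
  have hI := hi.integral_prod_left.const_mul ((n + 1) * (∫ y, ‖W y‖ ^ 2 ∂photonMeasure))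
  have hmeas := (stronglyMeasurable_annWave f ψ n).aestronglyMeasurable (μ := configMeasure n)
  have hsq : Integrable (fun x => ‖annWave f ψ n x‖ ^ 2) (configMeasure n) := by
    refine hI.mono' (hmeas.norm.pow 2) ?_
    filter_upwards [hbound] with x hx
    rwa [Real.norm_of_nonneg (by positivity)]
  refine ⟨(memLp_two_iff_integrable_sq_norm hmeas).2 hsq, ?_⟩
  refine (integral_mono_ae hsq hI hbound).trans (le_of_eq ?_)
  rw [integral_const_mul, ← integral_prod _ hi, ← hv]
  ring

theorem annihilation_graph (f : OnePhoton) : (annihilation f).graph = annihilationGraph f :=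
  Submodule.toLinearPMap_graph_eq _ (annihilationGraph_functional f)

theorem wave_annihilation (f : OnePhoton) (ψ : (annihilation f).domain) (n : ℕ) :
    wave (annihilation f ψ) n =ᵐ[configMeasure n] annWave f ψ n := by
  have h := (annihilation f).mem_graph ψ
  rw [annihilation_graph] at h
  exact h n

theorem mem_annihilation_domain (hf : IsWeighted f ω W) (ψ : Fock)
    (hint : ∀ n, Integrable (fun x => sumOver ω x * ‖wave ψ n x‖ ^ 2) (configMeasure n))
    (hsum : Summable fun n => ∫ x, sumOver ω x * ‖wave ψ n x‖ ^ 2 ∂configMeasure n) :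
    ψ ∈ (annihilation f).domain := by
  have h1 := fun n => integral_norm_annWave_sq_le hf ψ n (hint (n + 1))
  obtain ⟨φ, hφ⟩ := exists_fock_of_summable (annWave f ψ) (fun n => (h1 n).1) (annWave_perm f ψ)
    (Summable.of_nonneg_of_le (fun n => integral_nonneg fun x => by positivity)
      (fun n => (h1 n).2) (((summable_nat_add_iff 1).2 hsum).mul_left _))
  refine LinearPMap.mem_domain_iff.2 ⟨φ, ?_⟩
  rw [annihilation_graph]
  exact hφ

theorem mem_annihilation_domain_of_dGamma (hf : IsWeighted f ω W) (ψ : (dGamma ω).domain) :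
    (ψ : Fock) ∈ (annihilation f).domain :=
  mem_annihilation_domain hf ψ (integrable_sumOver_mul ψ) (hasSum_re_inner_dGamma ω ψ).summable

theorem norm_annihilation_sq_le (hf : IsWeighted f ω W) (ψ : (dGamma ω).domain) :
    ‖annihilation f ⟨ψ, mem_annihilation_domain_of_dGamma hf ψ⟩‖ ^ 2
      ≤ (∫ y, ‖W y‖ ^ 2 ∂photonMeasure) * (inner ℂ (dGamma ω ψ) (ψ : Fock)).re := by
  have h1 := fun n => (integral_norm_annWave_sq_le hf (ψ : Fock) n
    (integrable_sumOver_mul ψ (n + 1))).2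
  have h2 := hasSum_re_inner_dGamma ω ψ
  -- Sector `n` of `a(f)ψ` is bounded by sector `n + 1` of `ψ`, so the series of weights starts at
  -- one; the vacuum term left out is nonnegative.
  have h3 := (hasSum_nat_add_iff' 1).2 h2
  have h4 : ∀ n, 0 ≤ ∫ x, sumOver ω x * ‖wave (ψ : Fock) n x‖ ^ 2 ∂configMeasure n := fun n =>
    integral_nonneg fun x => mul_nonneg (Finset.sum_nonneg fun i _ => hf.nonneg _) (by positivity)
  have h5 := hasSum_norm_sq_wave (annihilation f ⟨ψ, mem_annihilation_domain_of_dGamma hf ψ⟩)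
  refine (hasSum_le (fun n => ?_) h5 (h3.mul_left (∫ y, ‖W y‖ ^ 2 ∂photonMeasure))).trans ?_
  · refine le_trans (le_of_eq (integral_congr_ae ?_)) (h1 n)
    filter_upwards [wave_annihilation f ⟨ψ, mem_annihilation_domain_of_dGamma hf ψ⟩ n] with x hx
    rw [hx]
  · refine mul_le_mul_of_nonneg_left ?_ (integral_nonneg fun x => by positivity)
    rw [Finset.sum_range_one]
    linarith [h4 0]

theorem annihilation_dense (hf : IsWeighted f ω W) :
    Dense ((annihilation f).domain : Set Fock) :=
  (dGamma_dense hf.measurable hf.nonneg).mono fun ψ hψ =>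
    mem_annihilation_domain_of_dGamma hf ⟨ψ, hψ⟩

end DiracPolaron

namespace DiracPolaron

variable {f : OnePhoton} {ω : Photon → ℝ} {W : Photon → ℂ}

/-! ### Vectors with a fixed number of photons -/

/-- The projection of a Fock space vector to the `n`-photon sector. -/
def sector (n : ℕ) (η : Fock) : Fock := lp.single 2 n (η n)

theorem wave_sector_self (n : ℕ) (η : Fock) : wave (sector n η) n = wave η n := by
  unfold wave sector
  rw [lp.single_apply_self]

theorem wave_sector_of_ne {n k : ℕ} (h : k ≠ n) (η : Fock) :
    wave (sector n η) k =ᵐ[configMeasure k] 0 := by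
  unfold wave sector
  rw [lp.single_apply_ne _ _ _ h]
  exact Lp.coeFn_zero ℂ 2 (configMeasure k)

theorem sumOver_one {n : ℕ} (x : Fin n → Photon) : sumOver (fun _ => 1) x = n := by
  simp [sumOver]

theorem sector_mem_annihilation_domain (f : OnePhoton) (n : ℕ) (η : Fock) :
    sector n η ∈ (annihilation f).domain := by
  refine mem_annihilation_domain (isWeighted_one f) _ (fun k => ?_) ?_
  · simp only [sumOver_one]
    exact (integrable_norm_sq_wave _ k).const_mul _
  · refine summable_of_ne_finset_zero (s := {n}) fun k hk => ?_
    refine integral_eq_zero_of_ae ?_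
    filter_upwards [wave_sector_of_ne (by simpa using hk : k ≠ n) η] with x hx
    simp [hx]

theorem annWave_sector (f : OnePhoton) (n : ℕ) (η : Fock) :
    annWave f (sector (n + 1) η) n = annWave f η n := by
  unfold annWave
  rw [wave_sector_self]

theorem annWave_sector_of_ne (f : OnePhoton) {n k : ℕ} (h : k ≠ n) (η : Fock) :
    annWave f (sector (n + 1) η) k =ᵐ[configMeasure k] 0 := by
  filter_upwards [ae_cons (wave_sector_of_ne (by simpa using h : k + 1 ≠ n + 1) η)] with x hx
  have : ∫ y, conj (f y) * wave (sector (n + 1) η) (k + 1) (Fin.cons y x) ∂photonMeasure = 0 := by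
    refine integral_eq_zero_of_ae ?_
    filter_upwards [hx] with y hy
    simp [hy]
  simp [annWave, this]

/-! ### Creation -/

/-- The adjointness of annihilation and creation, sector by sector. -/
theorem integral_inner_creation (hd : Dense ((annihilation f).domain : Set Fock))
    (ψ : (creation f).domain) (η : Fock) (n : ℕ) :
    ∫ x, inner ℂ (wave (creation f ψ) (n + 1) x) (wave η (n + 1) x) ∂configMeasure (n + 1)
      = ∫ x, inner ℂ (wave (ψ : Fock) n x) (annWave f η n x) ∂configMeasure n := by
  -- Testing against a vector with exactly `n + 1` photons makes each side of the adjoint relation a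
  -- single term.
  have hadj := LinearPMap.adjoint_isFormalAdjoint hd ψ
    ⟨sector (n + 1) η, sector_mem_annihilation_domain f (n + 1) η⟩
  have h1 := hasSum_inner_wave (creation f ψ) (sector (n + 1) η)
  have h2 := hasSum_inner_wave (ψ : Fock)
    (annihilation f ⟨sector (n + 1) η, sector_mem_annihilation_domain f (n + 1) η⟩)
  have h3 := h1.unique (hasSum_single (n + 1) fun k hk => integral_eq_zero_of_ae (by
    filter_upwards [wave_sector_of_ne hk η] with x hx
    simp [hx]))
  have h4 := h2.unique (hasSum_single n fun k hk => integral_eq_zero_of_ae (by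
    filter_upwards [annWave_sector_of_ne f hk η, wave_annihilation f
      ⟨sector (n + 1) η, sector_mem_annihilation_domain f (n + 1) η⟩ k] with x hx hx'
    simp [hx', hx]))
  rw [wave_sector_self] at h3
  rw [← h3]
  refine Eq.trans hadj (h4.trans (integral_congr_ae ?_))
  filter_upwards [wave_annihilation f
      ⟨sector (n + 1) η, sector_mem_annihilation_domain f (n + 1) η⟩ n] with x hx
  rw [hx, annWave_sector]

/-- The quadratic `βt² - 2ct + N` is nonnegative for all `t`, so its discriminant is not positive.
This recovers a product bound from a family of additive bounds, and the additive ones can be summed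
over sectors. -/
theorem sq_le_mul_of_forall {c β N : ℝ} (hc : 0 ≤ c) (hβ : 0 ≤ β) (hN : 0 ≤ N)
    (h : ∀ t > 0, 2 * c ≤ t * β + t⁻¹ * N) : c ^ 2 ≤ β * N := by
  have h1 : ∀ t : ℝ, 0 ≤ β * (t * t) + (-(2 * c)) * t + N := by
    intro t
    rcases le_or_gt t 0 with ht | ht
    · nlinarith [mul_nonneg hc (neg_nonneg.2 ht), mul_self_nonneg t]
    · have h2 := mul_le_mul_of_nonneg_left (h t ht) ht.le
      have h3 : t * (t * β + t⁻¹ * N) = β * (t * t) + N := by field_simp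
      rw [h3] at h2
      linarith
  have := discrim_le_zero h1
  unfold discrim at this
  nlinarith

/-- The creation bound without commutators. One splits `|f(y)|² = |W(y)|² Ω · ω(y)/Ω`, with `Ω` the
total weight of all `n + 1` photons. The factor `|W|²Ω`, with `Ω = ω(y) + sumOver ω x`, goes with
`ψ` and gives the two terms on the right; the factor `ω(y)/Ω` goes with `φ`, and symmetrization
makes these ratios sum to at most one. -/
theorem two_mul_norm_integral_inner_annWave_le (hf : IsWeighted f ω W) (ψ φ : Fock) (n : ℕ)
    (hint : Integrable (fun x => sumOver ω x * ‖wave ψ n x‖ ^ 2) (configMeasure n))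
    {t : ℝ} (ht : 0 < t) :
    2 * ‖∫ x, inner ℂ (wave ψ n x) (annWave f φ n x) ∂configMeasure n‖
      ≤ t * ((∫ y, ‖f y‖ ^ 2 ∂photonMeasure) * (∫ x, ‖wave ψ n x‖ ^ 2 ∂configMeasure n)
          + (∫ y, ‖W y‖ ^ 2 ∂photonMeasure)
            * ∫ x, sumOver ω x * ‖wave ψ n x‖ ^ 2 ∂configMeasure n)
        + t⁻¹ * ∫ x, ‖wave φ (n + 1) x‖ ^ 2 ∂configMeasure (n + 1) := by
  have hω0 : ∀ {k : ℕ} (x : Fin k → Photon), 0 ≤ sumOver ω x :=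
    fun x => Finset.sum_nonneg fun i _ => hf.nonneg _
  have hfsq : Integrable (fun y => ‖f y‖ ^ 2) photonMeasure :=
    (memLp_two_iff_integrable_sq_norm (Lp.memLp f).1).1 (Lp.memLp f)
  have hWsq : Integrable (fun y => ‖W y‖ ^ 2) photonMeasure :=
    (memLp_two_iff_integrable_sq_norm hf.memLp.1).1 hf.memLp
  -- Only an inequality: when the total weight vanishes, the quotients are zero by convention.
  have hsum : ∀ x : Fin (n + 1) → Photon, (∑ j, ω (x j) / sumOver ω x) ≤ 1 := by
    intro x
    rw [← Finset.sum_div]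
    exact div_self_le_one _
  have hmw := ((stronglyMeasurable_wave φ (n + 1)).norm.pow 2).aestronglyMeasurable
    (μ := configMeasure (n + 1))
  have hdiv : ∀ j, Measurable fun x : Fin (n + 1) → Photon => ω (x j) / sumOver ω x := fun j =>
    (hf.measurable.comp (measurable_pi_apply j)).div (measurable_sumOver hf.measurable _)
  have hI0 : Integrable (fun x => (∑ j, ω (x j) / sumOver ω x) * ‖wave φ (n + 1) x‖ ^ 2)
      (configMeasure (n + 1)) := by
    refine (integrable_norm_sq_wave φ (n + 1)).mono'
      ((Finset.measurable_sum _ fun j _ => hdiv j).aestronglyMeasurable.mul hmw)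
      (Filter.Eventually.of_forall fun x => ?_)
    rw [Real.norm_of_nonneg (mul_nonneg (Finset.sum_nonneg fun j _ =>
      div_nonneg (hf.nonneg _) (hω0 x)) (by positivity))]
    exact mul_le_of_le_one_left (by positivity) (hsum x)
  obtain ⟨hI1, hV1⟩ := integral_sum_symm (h := fun y x => ω y / sumOver ω x)
    (F := fun x => ‖wave φ (n + 1) x‖ ^ 2) (fun y x => div_nonneg (hf.nonneg y) (hω0 x))
    (fun x => by positivity) (fun y s x => by rw [sumOver_perm]) (norm_sq_wave_perm φ (n + 1))
    ((hdiv 0).aestronglyMeasurable.mul hmw) hI0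
  have hV1' : (n + 1) * ∫ z, ω z.2 / sumOver ω (consConfig z) * ‖wave φ (n + 1) (consConfig z)‖ ^ 2
      ∂splitMeasure n ≤ ∫ x, ‖wave φ (n + 1) x‖ ^ 2 ∂configMeasure (n + 1) := by
    rw [hV1]
    exact integral_mono hI0 (integrable_norm_sq_wave φ (n + 1)) fun x =>
      mul_le_of_le_one_left (by positivity) (hsum x)
  have hI2 : Integrable (fun z : (Fin n → Photon) × Photon =>
      ‖wave ψ n z.1‖ ^ 2 * ‖f z.2‖ ^ 2) (splitMeasure n) :=
    (integrable_norm_sq_wave ψ n).mul_prod hfsq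
  have hI3 : Integrable (fun z : (Fin n → Photon) × Photon =>
      (sumOver ω z.1 * ‖wave ψ n z.1‖ ^ 2) * ‖W z.2‖ ^ 2) (splitMeasure n) :=
    hint.mul_prod hWsq
  have hV2 : ∫ z : (Fin n → Photon) × Photon, ‖wave ψ n z.1‖ ^ 2 * ‖f z.2‖ ^ 2 ∂splitMeasure n
      = (∫ x, ‖wave ψ n x‖ ^ 2 ∂configMeasure n) * ∫ y, ‖f y‖ ^ 2 ∂photonMeasure :=
    integral_prod_mul (fun x => ‖wave ψ n x‖ ^ 2) (fun y => ‖f y‖ ^ 2)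
  have hV3 : ∫ z : (Fin n → Photon) × Photon,
        (sumOver ω z.1 * ‖wave ψ n z.1‖ ^ 2) * ‖W z.2‖ ^ 2 ∂splitMeasure n
      = (∫ x, sumOver ω x * ‖wave ψ n x‖ ^ 2 ∂configMeasure n)
        * ∫ y, ‖W y‖ ^ 2 ∂photonMeasure :=
    integral_prod_mul (fun x => sumOver ω x * ‖wave ψ n x‖ ^ 2) (fun y => ‖W y‖ ^ 2)
  set B : (Fin n → Photon) × Photon → ℝ := fun z =>
    t * (‖wave ψ n z.1‖ ^ 2 * ‖f z.2‖ ^ 2 + (sumOver ω z.1 * ‖wave ψ n z.1‖ ^ 2) * ‖W z.2‖ ^ 2)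
      + t⁻¹ * ((n + 1) * (ω z.2 / sumOver ω (consConfig z)
        * ‖wave φ (n + 1) (consConfig z)‖ ^ 2)) with hB
  have hI23 : Integrable (fun z : (Fin n → Photon) × Photon => ‖wave ψ n z.1‖ ^ 2 * ‖f z.2‖ ^ 2
      + (sumOver ω z.1 * ‖wave ψ n z.1‖ ^ 2) * ‖W z.2‖ ^ 2) (splitMeasure n) := hI2.add hI3
  have hBint : Integrable B (splitMeasure n) :=
    (hI23.const_mul t).add ((hI1.const_mul _).const_mul _)
  have hBval : ∫ z, B z ∂splitMeasure n
      ≤ t * ((∫ y, ‖f y‖ ^ 2 ∂photonMeasure) * (∫ x, ‖wave ψ n x‖ ^ 2 ∂configMeasure n)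
          + (∫ y, ‖W y‖ ^ 2 ∂photonMeasure)
            * ∫ x, sumOver ω x * ‖wave ψ n x‖ ^ 2 ∂configMeasure n)
        + t⁻¹ * ∫ x, ‖wave φ (n + 1) x‖ ^ 2 ∂configMeasure (n + 1) := by
    rw [hB, integral_add (hI23.const_mul t) ((hI1.const_mul _).const_mul _),
      integral_const_mul, integral_const_mul, integral_const_mul, integral_add hI2 hI3, hV2, hV3]
    linarith [mul_le_mul_of_nonneg_left hV1' (inv_nonneg.2 ht.le)]
  have hpt : ∀ᵐ z ∂splitMeasure n,
      2 * (‖wave ψ n z.1‖ * (Real.sqrt (n + 1) * (‖f z.2‖ * ‖wave φ (n + 1) (consConfig z)‖)))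
        ≤ B z := by
    have hfz : ∀ᵐ z ∂splitMeasure n, f z.2 = (Real.sqrt (ω z.2) : ℂ) * W z.2 :=
      Measure.quasiMeasurePreserving_snd.ae hf.eq
    filter_upwards [hfz] with z hz
    have hfn : ‖f z.2‖ ^ 2 = ω z.2 * ‖W z.2‖ ^ 2 := by
      rw [hz, norm_mul, mul_pow, Complex.norm_real, Real.norm_of_nonneg (Real.sqrt_nonneg _),
        Real.sq_sqrt (hf.nonneg _)]
    have hs : sumOver ω (consConfig z) = ω z.2 + sumOver ω z.1 := sumOver_consConfig ω z
    have ho := hf.nonneg z.2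
    have hO := hω0 z.1
    have hn1 : Real.sqrt (n + 1) ^ 2 = n + 1 := Real.sq_sqrt (by positivity)
    have hprod : ‖f z.2‖ ^ 2 = (‖W z.2‖ ^ 2 * sumOver ω (consConfig z))
        * (ω z.2 / sumOver ω (consConfig z)) := by
      rcases eq_or_ne (sumOver ω (consConfig z)) 0 with h0 | h0
      · have : ω z.2 = 0 := by linarith
        rw [hfn, this]; simp
      · rw [hfn]; field_simp
    set r := ω z.2 / sumOver ω (consConfig z) with hr
    have hr0 : 0 ≤ r := div_nonneg ho (hω0 _)
    set a := ‖W z.2‖ ^ 2 * sumOver ω (consConfig z) with ha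
    have ha0 : 0 ≤ a := mul_nonneg (by positivity) (hω0 _)
    have hfn' : ‖f z.2‖ = Real.sqrt a * Real.sqrt r := by
      rw [← Real.sqrt_mul ha0, ← hprod, Real.sqrt_sq (norm_nonneg _)]
    have hBz : B z = t * (Real.sqrt a * ‖wave ψ n z.1‖) ^ 2
        + t⁻¹ * (Real.sqrt (n + 1) * (Real.sqrt r * ‖wave φ (n + 1) (consConfig z)‖)) ^ 2 := by
      simp only [hB, mul_pow, hn1, Real.sq_sqrt ha0, Real.sq_sqrt hr0, hfn]
      rw [← hr, ha, hs]
      ring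
    rw [hBz, hfn']
    set u := Real.sqrt a * ‖wave ψ n z.1‖
    set v := Real.sqrt (n + 1) * (Real.sqrt r * ‖wave φ (n + 1) (consConfig z)‖)
    have h1 : 2 * (u * v) ≤ t * u ^ 2 + t⁻¹ * v ^ 2 := by
      have h2 : 0 ≤ t⁻¹ * (t * u - v) ^ 2 := by positivity
      have h3 : t⁻¹ * (t * u - v) ^ 2 = t * u ^ 2 + t⁻¹ * v ^ 2 - 2 * (u * v) := by
        field_simp
        ring
      linarith
    refine le_trans (le_of_eq ?_) h1
    simp only [u, v]
    ring
  have hIL : Integrable (fun z : (Fin n → Photon) × Photon =>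
      2 * (‖wave ψ n z.1‖ * (Real.sqrt (n + 1) * (‖f z.2‖ * ‖wave φ (n + 1) (consConfig z)‖))))
      (splitMeasure n) := by
    refine hBint.mono' ?_ ?_
    · have h1 : StronglyMeasurable fun z : (Fin n → Photon) × Photon => ‖wave ψ n z.1‖ :=
        ((stronglyMeasurable_wave ψ n).comp_measurable measurable_fst).norm
      have h2 : StronglyMeasurable fun z : (Fin n → Photon) × Photon => ‖f z.2‖ :=
        ((Lp.stronglyMeasurable f).comp_measurable measurable_snd).norm
      have h3 : StronglyMeasurable fun z : (Fin n → Photon) × Photon =>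
          ‖wave φ (n + 1) (consConfig z)‖ :=
        ((stronglyMeasurable_wave φ (n + 1)).comp_measurable
          (measurePreserving_consConfig n).measurable).norm
      exact ((h1.mul ((h2.mul h3).const_mul _)).const_mul _).aestronglyMeasurable
    · filter_upwards [hpt] with z hz
      rwa [Real.norm_of_nonneg (by positivity)]
  refine le_trans ?_ ((integral_mono_ae hIL hBint hpt).trans hBval)
  rw [integral_const_mul]
  have hIL' := hIL.const_mul (2⁻¹ : ℝ)
  simp only [inv_mul_cancel_left₀ (two_ne_zero' ℝ)] at hIL'
  rw [integral_prod _ hIL']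
  gcongr
  refine (norm_integral_le_integral_norm _).trans ?_
  refine integral_mono_of_nonneg (Filter.Eventually.of_forall fun x => norm_nonneg _)
    hIL'.integral_prod_left (Filter.Eventually.of_forall fun x => ?_)
  simp only
  rw [integral_const_mul, integral_const_mul]
  refine (norm_inner_le_norm _ _).trans ?_
  gcongr
  unfold annWave
  rw [norm_mul, Complex.norm_real, Real.norm_of_nonneg (Real.sqrt_nonneg _)]
  gcongr
  refine (norm_integral_le_integral_norm _).trans (le_of_eq ?_)
  simp [consConfig]

/-- The sector bounds are summed with one common `t`, and only then is `t` optimized. This is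
Cauchy–Schwarz across the sectors. -/
theorem norm_inner_annihilation_sq_le (hf : IsWeighted f ω W) (ψ : (dGamma ω).domain)
    (φ : (annihilation f).domain) :
    ‖inner ℂ (ψ : Fock) (annihilation f φ)‖ ^ 2
      ≤ ((∫ y, ‖f y‖ ^ 2 ∂photonMeasure) * ‖(ψ : Fock)‖ ^ 2
        + (∫ y, ‖W y‖ ^ 2 ∂photonMeasure) * (inner ℂ (dGamma ω ψ) (ψ : Fock)).re)
        * ‖(φ : Fock)‖ ^ 2 := by
  have hpos := dGamma_nonneg hf.nonneg ψ
  have hF : 0 ≤ ∫ y, ‖f y‖ ^ 2 ∂photonMeasure := integral_nonneg fun y => by positivity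
  have hW : 0 ≤ ∫ y, ‖W y‖ ^ 2 ∂photonMeasure := integral_nonneg fun y => by positivity
  refine sq_le_mul_of_forall (norm_nonneg _) (by positivity) (by positivity) fun t ht => ?_
  have h1 := hasSum_inner_wave (ψ : Fock) (annihilation f φ)
  have h2 := ((((hasSum_norm_sq_wave (ψ : Fock)).mul_left (∫ y, ‖f y‖ ^ 2 ∂photonMeasure)).add
    ((hasSum_re_inner_dGamma ω ψ).mul_left (∫ y, ‖W y‖ ^ 2 ∂photonMeasure))).mul_left t)
  have h3 := ((hasSum_nat_add_iff' 1).2 (hasSum_norm_sq_wave (φ : Fock))).mul_left t⁻¹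
  have h4 := (h2.add h3).mul_left (2⁻¹ : ℝ)
  have h5 := tsum_of_norm_bounded h4 (f := fun n =>
    ∫ x, inner ℂ (wave (ψ : Fock) n x) (wave (annihilation f φ) n x) ∂configMeasure n) fun n => ?_
  · rw [h1.tsum_eq] at h5
    have h6 : (0 : ℝ) ≤ t⁻¹ * ∫ x, ‖wave (φ : Fock) 0 x‖ ^ 2 ∂configMeasure 0 :=
      mul_nonneg (by positivity) (integral_nonneg fun x => by positivity)
    rw [Finset.sum_range_one, mul_sub] at h5
    linarith
  · have h6 := two_mul_norm_integral_inner_annWave_le hf (ψ : Fock) (φ : Fock) n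
      (integrable_sumOver_mul ψ n) ht
    have h7 : ∫ x, inner ℂ (wave (ψ : Fock) n x) (wave (annihilation f φ) n x) ∂configMeasure n
        = ∫ x, inner ℂ (wave (ψ : Fock) n x) (annWave f φ n x) ∂configMeasure n := by
      refine integral_congr_ae ?_
      filter_upwards [wave_annihilation f φ n] with x hx
      rw [hx]
    rw [h7]
    linarith

/-- The preceding bound makes `φ ↦ ⟨ψ, a(f)φ⟩` continuous, which is membership in the domain of the
adjoint. -/
theorem mem_creation_domain_of_dGamma (hf : IsWeighted f ω W) (ψ : (dGamma ω).domain) :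
    (ψ : Fock) ∈ (creation f).domain := by
  refine (LinearPMap.mem_adjoint_domain_iff _ _).2 ?_
  refine AddMonoidHomClass.continuous_of_bound _ (Real.sqrt
    ((∫ y, ‖f y‖ ^ 2 ∂photonMeasure) * ‖(ψ : Fock)‖ ^ 2
        + (∫ y, ‖W y‖ ^ 2 ∂photonMeasure) * (inner ℂ (dGamma ω ψ) (ψ : Fock)).re)) fun φ => ?_
  have h := norm_inner_annihilation_sq_le hf ψ φ
  have h1 := Real.sqrt_le_sqrt h
  rw [Real.sqrt_mul' _ (by positivity), Real.sqrt_sq (norm_nonneg _),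
    Real.sqrt_sq (norm_nonneg _)] at h1
  exact h1

/-- By density of the domain of `a(f)` the bound on `⟨a(f)*ψ, φ⟩` holds for all `φ`; the choice `φ =
a(f)*ψ` gives the norm. -/
theorem norm_creation_sq_le (hf : IsWeighted f ω W) (ψ : (dGamma ω).domain) :
    ‖creation f ⟨ψ, mem_creation_domain_of_dGamma hf ψ⟩‖ ^ 2
      ≤ (∫ y, ‖f y‖ ^ 2 ∂photonMeasure) * ‖(ψ : Fock)‖ ^ 2
        + (∫ y, ‖W y‖ ^ 2 ∂photonMeasure) * (inner ℂ (dGamma ω ψ) (ψ : Fock)).re := by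
  set z := creation f ⟨ψ, mem_creation_domain_of_dGamma hf ψ⟩ with hz
  set β := (∫ y, ‖f y‖ ^ 2 ∂photonMeasure) * ‖(ψ : Fock)‖ ^ 2
        + (∫ y, ‖W y‖ ^ 2 ∂photonMeasure) * (inner ℂ (dGamma ω ψ) (ψ : Fock)).re with hβ
  have h1 : ∀ φ : Fock, ‖inner ℂ z φ‖ ^ 2 ≤ β * ‖φ‖ ^ 2 := by
    intro φ
    have hc : IsClosed {φ : Fock | ‖inner ℂ z φ‖ ^ 2 ≤ β * ‖φ‖ ^ 2} :=
      isClosed_le (by fun_prop) (by fun_prop)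
    refine closure_minimal (fun φ hφ => ?_) hc (annihilation_dense hf φ)
    have hadj := LinearPMap.adjoint_isFormalAdjoint (annihilation_dense hf)
      ⟨ψ, mem_creation_domain_of_dGamma hf ψ⟩ ⟨φ, hφ⟩
    have h2 : inner ℂ z φ = inner ℂ (ψ : Fock) (annihilation f ⟨φ, hφ⟩) := hadj
    rw [Set.mem_ofPred_eq, h2]
    exact norm_inner_annihilation_sq_le hf ψ ⟨φ, hφ⟩
  have h2 := h1 z
  have h3 : ‖inner ℂ z z‖ = ‖z‖ ^ 2 := by
    rw [inner_self_eq_norm_sq_to_K]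
    simp
  rw [h3] at h2
  by_cases h0 : ‖z‖ = 0
  · rw [h0, zero_pow two_ne_zero]
    have hpos := dGamma_nonneg hf.nonneg ψ
    have hF : 0 ≤ ∫ y, ‖f y‖ ^ 2 ∂photonMeasure := integral_nonneg fun y => by positivity
    have hW : 0 ≤ ∫ y, ‖W y‖ ^ 2 ∂photonMeasure := integral_nonneg fun y => by positivity
    rw [hβ]
    positivity
  · have h4 : 0 < ‖z‖ ^ 2 := by positivity
    nlinarith

/-! ### The field operator -/

theorem fieldOperator_eq (hf : IsWeighted f ω W) (ψ : (dGamma ω).domain) :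
    ∃ h : (ψ : Fock) ∈ (fieldOperator f).domain, fieldOperator f ⟨ψ, h⟩
      = ((Real.sqrt 2 : ℂ)⁻¹) • (annihilation f ⟨ψ, mem_annihilation_domain_of_dGamma hf ψ⟩
        + creation f ⟨ψ, mem_creation_domain_of_dGamma hf ψ⟩) := by
  have hle := (annihilation f + creation f).le_closure
  have hmem : (ψ : Fock) ∈ (annihilation f + creation f).domain :=
    ⟨mem_annihilation_domain_of_dGamma hf ψ, mem_creation_domain_of_dGamma hf ψ⟩
  refine ⟨hle.1 hmem, ?_⟩
  have h1 : (annihilation f + creation f).closure ⟨ψ, hle.1 hmem⟩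
      = (annihilation f + creation f) ⟨ψ, hmem⟩ := (hle.2 rfl).symm
  change ((Real.sqrt 2 : ℂ)⁻¹) • (annihilation f + creation f).closure ⟨ψ, hle.1 hmem⟩ = _
  rw [h1]
  rfl

theorem inner_annihilation_add_creation (hf : IsWeighted f ω W) (ψ φ : (dGamma ω).domain) :
    inner ℂ (annihilation f ⟨ψ, mem_annihilation_domain_of_dGamma hf ψ⟩
        + creation f ⟨ψ, mem_creation_domain_of_dGamma hf ψ⟩) (φ : Fock)
      = inner ℂ (ψ : Fock) (annihilation f ⟨φ, mem_annihilation_domain_of_dGamma hf φ⟩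
        + creation f ⟨φ, mem_creation_domain_of_dGamma hf φ⟩) := by
  have hadj := LinearPMap.adjoint_isFormalAdjoint (annihilation_dense hf)
  have h1 := hadj ⟨ψ, mem_creation_domain_of_dGamma hf ψ⟩
    ⟨φ, mem_annihilation_domain_of_dGamma hf φ⟩
  have h2 := hadj.symm ⟨ψ, mem_annihilation_domain_of_dGamma hf ψ⟩
    ⟨φ, mem_creation_domain_of_dGamma hf φ⟩
  rw [inner_add_left, inner_add_right, add_comm]
  exact congrArg₂ _ h1 h2

end DiracPolaron

namespace DiracPolaron

/-! ### Matrices acting on spinors -/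

section Matrices

variable {F : Type*} [NormedAddCommGroup F] [InnerProductSpace ℂ F]

/-- The action of a `4 × 4` matrix on `ℂ⁴ ⊗ F`. -/
def matAct (B : Matrix (Fin 4) (Fin 4) ℂ) :
    PiLp 2 (fun _ : Fin 4 => F) →ₗ[ℂ] PiLp 2 (fun _ : Fin 4 => F) where
  toFun v := WithLp.toLp 2 fun s => ∑ s', B s s' • v s'
  map_add' v w := by
    ext s
    simp [Finset.sum_add_distrib]
  map_smul' c v := by
    ext s
    simp only [PiLp.smul_apply, RingHom.id_apply, Finset.smul_sum]
    exact Finset.sum_congr rfl fun s' _ => smul_comm _ _ _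

theorem matAct_apply (B : Matrix (Fin 4) (Fin 4) ℂ) (v : PiLp 2 (fun _ : Fin 4 => F)) (s : Fin 4) :
    matAct B v s = ∑ s', B s s' • v s' := rfl

theorem matAct_mul (B C : Matrix (Fin 4) (Fin 4) ℂ) (v : PiLp 2 (fun _ : Fin 4 => F)) :
    matAct (B * C) v = matAct B (matAct C v) := by
  ext s
  simp only [matAct_apply, Matrix.mul_apply, Finset.sum_smul, Finset.smul_sum, smul_smul]
  exact Finset.sum_comm

theorem matAct_add_left (B C : Matrix (Fin 4) (Fin 4) ℂ) (v : PiLp 2 (fun _ : Fin 4 => F)) :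
    matAct (B + C) v = matAct B v + matAct C v := by
  ext s
  simp [matAct_apply, add_smul, Finset.sum_add_distrib]

theorem matAct_smul_left (c : ℂ) (B : Matrix (Fin 4) (Fin 4) ℂ)
    (v : PiLp 2 (fun _ : Fin 4 => F)) : matAct (c • B) v = c • matAct B v := by
  ext s
  simp [matAct_apply, Finset.smul_sum, smul_smul]

theorem matAct_sum_left {ι : Type*} (t : Finset ι) (B : ι → Matrix (Fin 4) (Fin 4) ℂ)
    (v : PiLp 2 (fun _ : Fin 4 => F)) : matAct (∑ i ∈ t, B i) v = ∑ i ∈ t, matAct (B i) v := by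
  classical
  induction t using Finset.induction_on with
  | empty => ext s; simp [matAct_apply]
  | insert i t hi ih => rw [Finset.sum_insert hi, Finset.sum_insert hi, matAct_add_left, ih]

theorem matAct_one (v : PiLp 2 (fun _ : Fin 4 => F)) : matAct 1 v = v := by
  ext s
  simp [matAct_apply, Matrix.one_apply, ite_smul]

theorem inner_matAct_left {B : Matrix (Fin 4) (Fin 4) ℂ} (hB : B.IsHermitian)
    (v w : PiLp 2 (fun _ : Fin 4 => F)) : inner ℂ (matAct B v) w = inner ℂ v (matAct B w) := by
  simp only [PiLp.inner_apply, matAct_apply, sum_inner, inner_sum, inner_smul_left,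
    inner_smul_right]
  rw [Finset.sum_comm]
  refine Finset.sum_congr rfl fun s _ => Finset.sum_congr rfl fun s' _ => ?_
  rw [← hB.apply s s']
  simp

theorem norm_matAct_sq {B : Matrix (Fin 4) (Fin 4) ℂ} (hB : B.IsHermitian) {c : ℝ}
    (hBB : B * B = (c : ℂ) • (1 : Matrix (Fin 4) (Fin 4) ℂ)) (v : PiLp 2 (fun _ : Fin 4 => F)) :
    ‖matAct B v‖ ^ 2 = c * ‖v‖ ^ 2 := by
  rw [← re_inner_self_eq, inner_matAct_left hB, ← matAct_mul, hBB, matAct_smul_left, matAct_one,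
    inner_smul_right, Complex.re_ofReal_mul, re_inner_self_eq]

end Matrices

/-! ### The matrices `α · u` and the Clifford relations -/

section Slash

variable (S : Model)

/-- The matrix `α · u`. -/
def Model.slash (u : R3) : Matrix (Fin 4) (Fin 4) ℂ := ∑ j, ((u j : ℝ) : ℂ) • S.α j

theorem Model.slash_isHermitian (u : R3) : (S.slash u).IsHermitian := by
  unfold Model.slash Matrix.IsHermitian
  rw [Matrix.conjTranspose_sum]
  refine Finset.sum_congr rfl fun j _ => ?_
  rw [Matrix.conjTranspose_smul, (S.α_hermitian j).eq]
  simp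

theorem Model.slash_add (u v : R3) : S.slash (u + v) = S.slash u + S.slash v := by
  simp [Model.slash, add_smul, Finset.sum_add_distrib]

theorem Model.slash_anticomm (u v : R3) : S.slash u * S.slash v + S.slash v * S.slash u
    = ((2 * inner ℝ u v : ℝ) : ℂ) • (1 : Matrix (Fin 4) (Fin 4) ℂ) := by
  have h1 : S.slash u * S.slash v + S.slash v * S.slash u
      = ∑ j, ∑ l, (((u j : ℝ) : ℂ) * ((v l : ℝ) : ℂ)) • (S.α j * S.α l + S.α l * S.α j) := by
    unfold Model.slash
    simp only [Finset.sum_mul, Finset.mul_sum, smul_add, Finset.sum_add_distrib,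
      Matrix.smul_mul, Matrix.mul_smul, smul_smul]
    congr 1
    · rw [Finset.sum_comm]
      exact Finset.sum_congr rfl fun j _ => Finset.sum_congr rfl fun l _ => by rw [mul_comm]
  rw [h1]
  simp only [S.α_anticomm, smul_ite, smul_zero, Finset.sum_ite_eq, Finset.mem_univ, if_true]
  have h2 : (2 : Matrix (Fin 4) (Fin 4) ℂ) = (2 : ℂ) • 1 := by
    ext i j
    simp [Matrix.ofNat_apply, Matrix.one_apply]
  rw [h2]
  simp only [smul_smul, ← Finset.sum_smul, PiLp.inner_apply]
  congr 1
  push_cast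
  rw [Finset.mul_sum]
  refine Finset.sum_congr rfl fun j _ => ?_
  simp
  ring

theorem Model.slash_sq (u : R3) :
    S.slash u * S.slash u = ((‖u‖ ^ 2 : ℝ) : ℂ) • (1 : Matrix (Fin 4) (Fin 4) ℂ) := by
  have h := S.slash_anticomm u u
  rw [← two_smul ℂ, real_inner_self_eq_norm_sq] at h
  have h2 := congrArg (fun B => (2⁻¹ : ℂ) • B) h
  simp only [smul_smul] at h2
  rw [inv_mul_cancel₀ two_ne_zero, one_smul] at h2
  rw [h2]
  congr 1
  push_cast
  ring

theorem Model.norm_matAct_slash {F : Type*} [NormedAddCommGroup F] [InnerProductSpace ℂ F] (u : R3)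
    (v : PiLp 2 (fun _ : Fin 4 => F)) : ‖matAct (S.slash u) v‖ = ‖u‖ * ‖v‖ := by
  have h := norm_matAct_sq (S.slash_isHermitian u) (S.slash_sq u) v
  rw [← mul_pow] at h
  exact (sq_eq_sq₀ (norm_nonneg _) (by positivity)).1 h

theorem Model.α_sq (j : Fin 3) :
    S.α j * S.α j = ((1 : ℝ) : ℂ) • (1 : Matrix (Fin 4) (Fin 4) ℂ) := by
  have h := S.α_anticomm j j
  rw [if_pos rfl] at h
  have h2 : (2 : Matrix (Fin 4) (Fin 4) ℂ) = (2 : ℂ) • 1 := by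
    ext i j
    simp [Matrix.ofNat_apply, Matrix.one_apply]
  rw [← two_smul ℂ, h2] at h
  have h3 := congrArg (fun B => (2⁻¹ : ℂ) • B) h
  simp only [smul_smul] at h3
  rw [inv_mul_cancel₀ two_ne_zero, one_smul] at h3
  rw [h3]
  simp

theorem Model.norm_matAct_α {F : Type*} [NormedAddCommGroup F] [InnerProductSpace ℂ F] (j : Fin 3)
    (v : PiLp 2 (fun _ : Fin 4 => F)) : ‖matAct (S.α j) v‖ = ‖v‖ := by
  have h := norm_matAct_sq (S.α_hermitian j) (S.α_sq j) v
  rw [one_mul] at h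
  exact (sq_eq_sq₀ (norm_nonneg _) (by positivity)).1 h

/-- The Clifford relations cancel the part of the interaction that grows with the photon
momentum. -/
theorem Model.norm_clifford_le {e P k : R3} (he : ‖e‖ = 1) (v v' : EuclideanSpace ℂ (Fin 4))
    (c : ℂ) :
    |(inner ℂ (matAct (S.slash P) v) (c • matAct (S.slash e) v')
      + inner ℂ v (c • matAct (S.slash e) (matAct (S.slash (k + P)) v'))).re|
      ≤ ‖c‖ * (‖v‖ * ‖v'‖ * (2 * |inner ℝ e P| + ‖k‖)) := by
  -- Moving `α·P` across the inner product produces the anticommutator of `α·P` and `α·e`, which is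
  -- the scalar `2 e·P`. Only the component of `P` along `e` and the single momentum `k` remain.
  have h1 : inner ℂ (matAct (S.slash P) v) (c • matAct (S.slash e) v')
      + inner ℂ v (c • matAct (S.slash e) (matAct (S.slash (k + P)) v'))
      = c * (inner ℂ v (((2 * inner ℝ e P : ℝ) : ℂ) • v')
        + inner ℂ v (matAct (S.slash e) (matAct (S.slash k) v'))) := by
    have h2 : ((2 * inner ℝ e P : ℝ) : ℂ) • v' = matAct (S.slash P) (matAct (S.slash e) v')
        + matAct (S.slash e) (matAct (S.slash P) v') := by
      rw [← matAct_mul, ← matAct_mul, ← matAct_add_left, add_comm, S.slash_anticomm,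
        matAct_smul_left, matAct_one]
    rw [h2, inner_smul_right, inner_smul_right, inner_matAct_left (S.slash_isHermitian P),
      S.slash_add, matAct_add_left, map_add, inner_add_right, inner_add_right]
    ring
  rw [h1]
  refine (Complex.abs_re_le_norm _).trans ?_
  rw [norm_mul]
  gcongr
  refine (norm_add_le _ _).trans ?_
  have h3 := norm_inner_le_norm (𝕜 := ℂ) v (((2 * inner ℝ e P : ℝ) : ℂ) • v')
  have h4 := norm_inner_le_norm (𝕜 := ℂ) v (matAct (S.slash e) (matAct (S.slash k) v'))
  rw [S.norm_matAct_slash, S.norm_matAct_slash, he, one_mul] at h4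
  rw [norm_smul, Complex.norm_real, Real.norm_eq_abs, abs_mul, abs_two] at h3
  linarith

/-- Transversality bounds the interaction by the collinearity defect. -/
theorem norm_mul_inner_sq_le {e P k : R3} {r : ℝ} (he : ‖e‖ = 1) (hek : inner ℝ e k = 0)
    (hP : ‖P‖ ≤ r) : ‖k‖ * (inner ℝ e P) ^ 2 ≤ 2 * r * (‖k‖ * r - inner ℝ k P) := by
  have hr : 0 ≤ r := (norm_nonneg _).trans hP
  have hkP := abs_le.1 (abs_real_inner_le_norm k P)
  have hkPr : ‖k‖ * ‖P‖ ≤ ‖k‖ * r := by gcongr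
  rcases eq_or_lt_of_le (norm_nonneg k) with h0 | h0
  · rw [← h0] at hkP ⊢
    have : inner ℝ k P = 0 := by
      have h1 : k = 0 := norm_eq_zero.1 h0.symm
      simp [h1]
    simp [this]
  · have h1 : ‖k‖ ^ 2 * (inner ℝ e P) ^ 2 + (inner ℝ k P) ^ 2 ≤ ‖k‖ ^ 2 * ‖P‖ ^ 2 := by
      -- The part of `P` orthogonal to both `e` and `k`; its squared norm being nonnegative is
      -- Bessel's inequality for these two orthogonal directions.
      set w : R3 := P - (inner ℝ e P) • e - (inner ℝ k P / ‖k‖ ^ 2) • k with hw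
      have h2 : 0 ≤ inner ℝ w w := real_inner_self_nonneg
      have h3 : inner ℝ w w = ‖P‖ ^ 2 - (inner ℝ e P) ^ 2 - (inner ℝ k P) ^ 2 / ‖k‖ ^ 2 := by
        rw [hw]
        simp only [inner_sub_left, inner_sub_right, inner_smul_left, inner_smul_right,
          real_inner_self_eq_norm_sq, he, hek, real_inner_comm e k, real_inner_comm e P,
          real_inner_comm k P, RCLike.conj_to_real]
        have hke : inner ℝ k e = 0 := by rw [real_inner_comm]; exact hek
        field_simp
        ring
      rw [h3] at h2
      have h4 := mul_nonneg (sq_nonneg ‖k‖) h2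
      have h5 : ‖k‖ ^ 2 * (‖P‖ ^ 2 - (inner ℝ e P) ^ 2 - (inner ℝ k P) ^ 2 / ‖k‖ ^ 2)
          = ‖k‖ ^ 2 * ‖P‖ ^ 2 - ‖k‖ ^ 2 * (inner ℝ e P) ^ 2 - (inner ℝ k P) ^ 2 := by
        field_simp
      linarith
    refine le_of_mul_le_mul_left ?_ h0
    -- The difference of squares `|k|²|P|² - (k·P)²` is factored. The first factor is the defect,
    -- the second is at most `2|k|r`, and the `|k|` in it cancels against the left side.
    have h6 : (‖k‖ * ‖P‖ - inner ℝ k P) * (‖k‖ * ‖P‖ + inner ℝ k P)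
        ≤ (‖k‖ * r - inner ℝ k P) * (2 * (‖k‖ * r)) :=
      mul_le_mul (by linarith) (by linarith) (by linarith) (by linarith)
    nlinarith

end Slash

end DiracPolaron

namespace DiracPolaron

/-! ### Spinor wave functions -/

/-- The `ℂ⁴`-valued wave function of the `n`-photon component. -/
def vec (Ψ : SpinFock) (n : ℕ) (x : Fin n → Photon) : EuclideanSpace ℂ (Fin 4) :=
  WithLp.toLp 2 fun s => wave (Ψ s) n x

theorem norm_sq_vec (Ψ : SpinFock) (n : ℕ) (x : Fin n → Photon) :
    ‖vec Ψ n x‖ ^ 2 = ∑ s, ‖wave (Ψ s) n x‖ ^ 2 := by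
  rw [EuclideanSpace.norm_sq_eq]
  rfl

theorem inner_vec (Ψ Φ : SpinFock) (n : ℕ) (x : Fin n → Photon) :
    inner ℂ (vec Ψ n x) (vec Φ n x) = ∑ s, inner ℂ (wave (Ψ s) n x) (wave (Φ s) n x) := rfl

theorem stronglyMeasurable_vec (Ψ : SpinFock) (n : ℕ) : StronglyMeasurable (vec Ψ n) := by
  refine (PiLp.continuous_toLp 2 (fun _ : Fin 4 => ℂ)).comp_stronglyMeasurable ?_
  exact (measurable_pi_lambda _ fun s =>
    (stronglyMeasurable_wave (Ψ s) n).measurable).stronglyMeasurable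

theorem integrable_norm_sq_vec (Ψ : SpinFock) (n : ℕ) :
    Integrable (fun x => ‖vec Ψ n x‖ ^ 2) (configMeasure n) := by
  simp only [norm_sq_vec]
  exact integrable_finsetSum _ fun s _ => integrable_norm_sq_wave (Ψ s) n

theorem hasSum_inner_vec (Ψ Φ : SpinFock) :
    HasSum (fun n => ∫ x, inner ℂ (vec Ψ n x) (vec Φ n x) ∂configMeasure n) (inner ℂ Ψ Φ) := by
  rw [PiLp.inner_apply]
  convert hasSum_sum fun s (_ : s ∈ Finset.univ) => hasSum_inner_wave (Ψ s) (Φ s) using 2 with n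
  simp only [inner_vec]
  exact integral_finsetSum _ fun s _ =>
    integrable_inner_of_memLp (memLp_wave (Ψ s) n) (memLp_wave (Φ s) n)

theorem hasSum_norm_sq_vec (Ψ : SpinFock) :
    HasSum (fun n => ∫ x, ‖vec Ψ n x‖ ^ 2 ∂configMeasure n) (‖Ψ‖ ^ 2) := by
  have h := Complex.hasSum_re (hasSum_inner_vec Ψ Ψ)
  rw [re_inner_self_eq] at h
  simpa only [integral_inner_self_eq, Complex.ofReal_re] using h

theorem vec_add (Ψ Φ : SpinFock) (n : ℕ) :
    vec (Ψ + Φ) n =ᵐ[configMeasure n] fun x => vec Ψ n x + vec Φ n x := by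
  have h := ae_all_iff.2 fun s => wave_add (Ψ s) (Φ s) n
  filter_upwards [h] with x hx
  ext s
  exact hx s

theorem vec_zero (n : ℕ) : vec 0 n =ᵐ[configMeasure n] fun _ => 0 := by
  filter_upwards [wave_zero n] with x hx
  ext s
  exact hx

theorem vec_sum {ι : Type*} (t : Finset ι) (Ψ : ι → SpinFock) (n : ℕ) :
    vec (∑ i ∈ t, Ψ i) n =ᵐ[configMeasure n] fun x => ∑ i ∈ t, vec (Ψ i) n x := by
  classical
  induction t using Finset.induction_on with
  | empty => simpa using vec_zero n
  | insert i t hi ih =>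
    rw [Finset.sum_insert hi]
    filter_upwards [vec_add (Ψ i) (∑ i ∈ t, Ψ i) n, ih] with x h1 h2
    rw [h1, h2, Finset.sum_insert hi]

theorem wave_sum {ι : Type*} (t : Finset ι) (ψ : ι → Fock) (n : ℕ) :
    wave (∑ i ∈ t, ψ i) n =ᵐ[configMeasure n] fun x => ∑ i ∈ t, wave (ψ i) n x := by
  classical
  induction t using Finset.induction_on with
  | empty =>
    simp only [Finset.sum_empty]
    exact wave_zero n
  | insert i t hi ih =>
    rw [Finset.sum_insert hi]
    filter_upwards [wave_add (ψ i) (∑ i ∈ t, ψ i) n, ih] with x h1 h2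
    rw [h1, Finset.sum_insert hi, Pi.add_apply, h2]

theorem vec_matAct (B : Matrix (Fin 4) (Fin 4) ℂ) (Ψ : SpinFock) (n : ℕ) :
    vec (matAct B Ψ) n =ᵐ[configMeasure n] fun x => matAct B (vec Ψ n x) := by
  have h1 := ae_all_iff.2 fun s => wave_sum Finset.univ (fun s' => B s s' • Ψ s') n
  have h2 := ae_all_iff.2 fun s => ae_all_iff.2 fun s' => wave_smul (B s s') (Ψ s') n
  filter_upwards [h1, h2] with x h1 h2
  ext s
  rw [matAct_apply]
  exact (h1 s).trans (Finset.sum_congr rfl fun s' _ => h2 s s')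

/-! ### The interaction, sector by sector -/

theorem memLp_mul_wave (f : OnePhoton) (u : Fock) (n : ℕ) :
    MemLp (fun z : (Fin n → Photon) × Photon => f z.2 * wave u n z.1) 2 (splitMeasure n) := by
  have hm : StronglyMeasurable fun z : (Fin n → Photon) × Photon => f z.2 * wave u n z.1 :=
    ((Lp.stronglyMeasurable f).comp_measurable measurable_snd).mul
      ((stronglyMeasurable_wave u n).comp_measurable measurable_fst)
  rw [memLp_two_iff_integrable_sq_norm hm.aestronglyMeasurable]
  have h1 := (integrable_norm_sq_wave u n).mul_prod
    ((memLp_two_iff_integrable_sq_norm (Lp.memLp f).1).1 (Lp.memLp f))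
  refine h1.congr (Filter.Eventually.of_forall fun z => ?_)
  simp only [norm_mul, mul_pow]
  ring

theorem integrable_split (f : OnePhoton) (u η : Fock) (n : ℕ) :
    Integrable (fun z : (Fin n → Photon) × Photon =>
      inner ℂ (wave u n z.1) (conj (f z.2) * wave η (n + 1) (consConfig z))) (splitMeasure n) := by
  refine (integrable_inner_of_memLp (memLp_mul_wave f u n) (memLp_wave_consConfig η n)).congr
    (Filter.Eventually.of_forall fun z => ?_)
  simp only [RCLike.inner_apply, map_mul]
  ring

theorem integral_inner_annWave (f : OnePhoton) (u η : Fock) (n : ℕ) :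
    ∫ x, inner ℂ (wave u n x) (annWave f η n x) ∂configMeasure n
      = (Real.sqrt (n + 1) : ℂ) * ∫ z, inner ℂ (wave u n z.1)
        (conj (f z.2) * wave η (n + 1) (consConfig z)) ∂splitMeasure n := by
  rw [integral_prod _ (integrable_split f u η n), ← integral_const_mul]
  refine integral_congr_ae (Filter.Eventually.of_forall fun x => ?_)
  simp only [annWave, RCLike.inner_apply]
  rw [integral_mul_const]
  simp only [consConfig]
  ring

/-- The interaction density `⟨Φ, α·ḡ U⟩`. -/
def interaction (g : Fin 3 → OnePhoton) (B : Fin 3 → Matrix (Fin 4) (Fin 4) ℂ) (Φ U : SpinFock)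
    (n : ℕ) (z : (Fin n → Photon) × Photon) : ℂ :=
  inner ℂ (vec Φ n z.1) (∑ j, conj (g j z.2) • matAct (B j) (vec U (n + 1) (consConfig z)))

theorem interaction_eq (g : Fin 3 → OnePhoton) (B : Fin 3 → Matrix (Fin 4) (Fin 4) ℂ)
    (Φ U : SpinFock) (n : ℕ) (z : (Fin n → Photon) × Photon) :
    interaction g B Φ U n z = ∑ s, ∑ j, ∑ s', B j s s' * inner ℂ (wave (Φ s) n z.1)
      (conj (g j z.2) * wave (U s') (n + 1) (consConfig z)) := by
  unfold interaction
  rw [PiLp.inner_apply]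
  refine Finset.sum_congr rfl fun s _ => ?_
  rw [WithLp.ofLp_sum, Finset.sum_apply, inner_sum]
  refine Finset.sum_congr rfl fun j _ => ?_
  simp only [PiLp.smul_apply, matAct_apply, RCLike.inner_apply, smul_eq_mul, vec,
    Finset.mul_sum, Finset.sum_mul]
  exact Finset.sum_congr rfl fun s' _ => by ring

theorem integrable_interaction (g : Fin 3 → OnePhoton) (B : Fin 3 → Matrix (Fin 4) (Fin 4) ℂ)
    (Φ U : SpinFock) (n : ℕ) : Integrable (interaction g B Φ U n) (splitMeasure n) := by
  have : interaction g B Φ U n = fun z => ∑ s, ∑ j, ∑ s', B j s s' * inner ℂ (wave (Φ s) n z.1)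
      (conj (g j z.2) * wave (U s') (n + 1) (consConfig z)) :=
    funext fun z => interaction_eq g B Φ U n z
  rw [this]
  exact integrable_finsetSum _ fun s _ => integrable_finsetSum _ fun j _ =>
    integrable_finsetSum _ fun s' _ => (integrable_split _ _ _ n).const_mul _

theorem sum_integral_inner_annWave (g : Fin 3 → OnePhoton)
    (B : Fin 3 → Matrix (Fin 4) (Fin 4) ℂ) (Φ U : SpinFock) (n : ℕ) :
    ∑ s, ∑ j, ∑ s', B j s s' * ∫ x, inner ℂ (wave (Φ s) n x) (annWave (g j) (U s') n x)
        ∂configMeasure n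
      = (Real.sqrt (n + 1) : ℂ) * ∫ z, interaction g B Φ U n z ∂splitMeasure n := by
  simp only [interaction_eq]
  rw [integral_finsetSum _ fun s _ => integrable_finsetSum _ fun j _ =>
    integrable_finsetSum _ fun s' _ => (integrable_split _ _ _ n).const_mul _, Finset.mul_sum]
  refine Finset.sum_congr rfl fun s _ => ?_
  rw [integral_finsetSum _ fun j _ =>
    integrable_finsetSum _ fun s' _ => (integrable_split _ _ _ n).const_mul _, Finset.mul_sum]
  refine Finset.sum_congr rfl fun j _ => ?_
  rw [integral_finsetSum _ fun s' _ => (integrable_split _ _ _ n).const_mul _, Finset.mul_sum]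
  refine Finset.sum_congr rfl fun s' _ => ?_
  rw [integral_inner_annWave, integral_const_mul]
  ring

theorem integral_inner_vec_annihilation (g : Fin 3 → OnePhoton)
    (B : Fin 3 → Matrix (Fin 4) (Fin 4) ℂ) (Φ Ψ : SpinFock)
    (hΨ : ∀ j s, Ψ s ∈ (annihilation (g j)).domain) (n : ℕ) :
    ∫ x, inner ℂ (vec Φ n x) (vec (∑ j, matAct (B j)
        (WithLp.toLp 2 fun s => annihilation (g j) ⟨Ψ s, hΨ j s⟩)) n x) ∂configMeasure n
      = (Real.sqrt (n + 1) : ℂ) * ∫ z, interaction g B Φ Ψ n z ∂splitMeasure n := by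
  rw [← sum_integral_inner_annWave]
  set a : Fin 3 → SpinFock := fun j => WithLp.toLp 2 fun s => annihilation (g j) ⟨Ψ s, hΨ j s⟩
  have h1 : ∫ x, inner ℂ (vec Φ n x) (vec (∑ j, matAct (B j) (a j)) n x) ∂configMeasure n
      = ∫ x, ∑ s, ∑ j, ∑ s', B j s s' * inner ℂ (wave (Φ s) n x) (wave (a j s') n x)
        ∂configMeasure n := by
    have h2 := ae_all_iff.2 fun j => vec_matAct (B j) (a j) n
    refine integral_congr_ae ?_
    filter_upwards [vec_sum Finset.univ (fun j => matAct (B j) (a j)) n, h2] with x h1 h2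
    rw [h1]
    simp only [h2]
    rw [PiLp.inner_apply]
    refine Finset.sum_congr rfl fun s _ => ?_
    rw [WithLp.ofLp_sum, Finset.sum_apply, inner_sum]
    refine Finset.sum_congr rfl fun j _ => ?_
    simp only [matAct_apply, RCLike.inner_apply, smul_eq_mul, vec, Finset.sum_mul]
    exact Finset.sum_congr rfl fun s' _ => by ring
  have hI : ∀ s j s', Integrable (fun x => B j s s' * inner ℂ (wave (Φ s) n x) (wave (a j s') n x))
      (configMeasure n) := fun s j s' =>
    (integrable_inner_of_memLp (memLp_wave _ n) (memLp_wave _ n)).const_mul _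
  rw [h1, integral_finsetSum _ fun s _ => integrable_finsetSum _ fun j _ =>
    integrable_finsetSum _ fun s' _ => hI s j s']
  refine Finset.sum_congr rfl fun s _ => ?_
  rw [integral_finsetSum _ fun j _ => integrable_finsetSum _ fun s' _ => hI s j s']
  refine Finset.sum_congr rfl fun j _ => ?_
  rw [integral_finsetSum _ fun s' _ => hI s j s']
  refine Finset.sum_congr rfl fun s' _ => ?_
  rw [integral_const_mul]
  congr 1
  refine integral_congr_ae ?_
  filter_upwards [wave_annihilation (g j) ⟨Ψ s', hΨ j s'⟩ n] with x hx
  simp only [a]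
  rw [hx]

/-- Hermiticity moves the matrices and adjointness the field onto `U`, so creation yields the same
density as annihilation, with the roles of the two vectors exchanged. Both halves of the cross term
can then be added under one integral. -/
theorem integral_inner_creation_vec (g : Fin 3 → OnePhoton)
    (B : Fin 3 → Matrix (Fin 4) (Fin 4) ℂ) (hB : ∀ j, (B j).IsHermitian)
    (hd : ∀ j, Dense ((annihilation (g j)).domain : Set Fock)) (U Ψ : SpinFock)
    (hΨ : ∀ j s, Ψ s ∈ (creation (g j)).domain) (n : ℕ) :
    ∫ x, inner ℂ (vec (∑ j, matAct (B j)
        (WithLp.toLp 2 fun s => creation (g j) ⟨Ψ s, hΨ j s⟩)) (n + 1) x) (vec U (n + 1) x)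
        ∂configMeasure (n + 1)
      = (Real.sqrt (n + 1) : ℂ) * ∫ z, interaction g B Ψ U n z ∂splitMeasure n := by
  rw [← sum_integral_inner_annWave]
  set c : Fin 3 → SpinFock := fun j => WithLp.toLp 2 fun s => creation (g j) ⟨Ψ s, hΨ j s⟩
  have h1 : ∫ x, inner ℂ (vec (∑ j, matAct (B j) (c j)) (n + 1) x) (vec U (n + 1) x)
        ∂configMeasure (n + 1)
      = ∫ x, ∑ s, ∑ j, ∑ s', B j s s'
        * inner ℂ (wave (c j s) (n + 1) x) (wave (U s') (n + 1) x) ∂configMeasure (n + 1) := by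
    have h2 := ae_all_iff.2 fun j => vec_matAct (B j) (c j) (n + 1)
    refine integral_congr_ae ?_
    filter_upwards [vec_sum Finset.univ (fun j => matAct (B j) (c j)) (n + 1), h2] with x h1 h2
    rw [h1, Finset.sum_comm, sum_inner]
    refine Finset.sum_congr rfl fun j _ => ?_
    rw [h2, inner_matAct_left (hB j), PiLp.inner_apply]
    refine Finset.sum_congr rfl fun s _ => ?_
    simp only [matAct_apply, RCLike.inner_apply, smul_eq_mul, vec, Finset.sum_mul]
    exact Finset.sum_congr rfl fun s' _ => by ring
  have hI : ∀ s j s', Integrable (fun x => B j s s'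
      * inner ℂ (wave (c j s) (n + 1) x) (wave (U s') (n + 1) x)) (configMeasure (n + 1)) :=
    fun s j s' => (integrable_inner_of_memLp (memLp_wave _ _) (memLp_wave _ _)).const_mul _
  rw [h1, integral_finsetSum _ fun s _ => integrable_finsetSum _ fun j _ =>
    integrable_finsetSum _ fun s' _ => hI s j s']
  refine Finset.sum_congr rfl fun s _ => ?_
  rw [integral_finsetSum _ fun j _ => integrable_finsetSum _ fun s' _ => hI s j s']
  refine Finset.sum_congr rfl fun j _ => ?_
  rw [integral_finsetSum _ fun s' _ => hI s j s']
  refine Finset.sum_congr rfl fun s' _ => ?_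
  rw [integral_const_mul]
  congr 1
  exact integral_inner_creation (hd j) ⟨Ψ s, hΨ j s⟩ (U s') n

end DiracPolaron

namespace DiracPolaron

/-! ### Energy and momentum of photon configurations -/

/-- The photon energy `|k|`. -/
def photonEnergy (x : Photon) : ℝ := ‖x.1‖

/-- The total momentum of a photon configuration. -/
def totalMomentum {n : ℕ} (x : Fin n → Photon) : R3 := ∑ i, (x i).1

theorem measurable_photonEnergy : Measurable photonEnergy := measurable_fst.norm

theorem photonEnergy_nonneg (x : Photon) : 0 ≤ photonEnergy x := norm_nonneg _

theorem sumOver_photonEnergy_nonneg {n : ℕ} (x : Fin n → Photon) : 0 ≤ sumOver photonEnergy x :=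
  Finset.sum_nonneg fun _ _ => photonEnergy_nonneg _

theorem norm_totalMomentum_le {n : ℕ} (x : Fin n → Photon) :
    ‖totalMomentum x‖ ≤ sumOver photonEnergy x := norm_sum_le _ _

theorem totalMomentum_perm {n : ℕ} (s : Equiv.Perm (Fin n)) (x : Fin n → Photon) :
    totalMomentum (x ∘ s) = totalMomentum x := Equiv.sum_comp s fun i => (x i).1

theorem totalMomentum_consConfig {n : ℕ} (z : (Fin n → Photon) × Photon) :
    totalMomentum (consConfig z) = z.2.1 + totalMomentum z.1 := by
  simp [totalMomentum, consConfig, Fin.sum_univ_succ]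

theorem totalMomentum_apply {n : ℕ} (x : Fin n → Photon) (j : Fin 3) :
    totalMomentum x j = sumOver (fun y => y.1 j) x := by
  simp [totalMomentum, sumOver]

theorem measurable_totalMomentum (n : ℕ) :
    Measurable fun x : Fin n → Photon => totalMomentum x := by
  unfold totalMomentum
  exact Finset.measurable_sum _ fun i _ => (measurable_pi_apply i).fst

theorem abs_sumOver_coord_le {n : ℕ} (x : Fin n → Photon) (j : Fin 3) :
    |sumOver (fun y => y.1 j) x| ≤ sumOver photonEnergy x := by
  rw [← totalMomentum_apply, ← Real.norm_eq_abs]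
  exact (PiLp.norm_apply_le _ j).trans (norm_totalMomentum_le x)

theorem measurable_coord (j : Fin 3) : Measurable fun y : Photon => y.1 j := by fun_prop

theorem mem_Prad_domain {ψ : Fock} (hψ : ψ ∈ (dGamma photonEnergy).domain) (j : Fin 3) :
    ψ ∈ (Prad j).domain :=
  dGamma_domain_le (measurable_coord j)
    (fun _ x => (abs_sumOver_coord_le x j).trans (le_abs_self _)) hψ

/-- An operator on Fock space acting on each spinor component. -/
def componentwise (T : Fock →ₗ.[ℂ] Fock) (Ψ : SpinFock) (h : ∀ s, Ψ s ∈ T.domain) : SpinFock :=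
  WithLp.toLp 2 fun s => T ⟨Ψ s, h s⟩

theorem vec_componentwise_dGamma (w : Photon → ℝ) (Ψ : SpinFock)
    (h : ∀ s, Ψ s ∈ (dGamma w).domain) (n : ℕ) :
    vec (componentwise (dGamma w) Ψ h) n =ᵐ[configMeasure n]
      fun x => (sumOver w x : ℂ) • vec Ψ n x := by
  have h1 := ae_all_iff.2 fun s => wave_dGamma w ⟨Ψ s, h s⟩ n
  filter_upwards [h1] with x hx
  ext s
  exact hx s

variable (S : Model)

/-- `α · dΓ(k) Ψ`. -/
def Model.momentumTerm (Ψ : SpinFock) (h : ∀ s, Ψ s ∈ (dGamma photonEnergy).domain) : SpinFock :=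
  ∑ j, matAct (S.α j) (componentwise (Prad j) Ψ fun s => mem_Prad_domain (h s) j)

variable {Ψ : SpinFock}

theorem Model.vec_momentumTerm (h : ∀ s, Ψ s ∈ (dGamma photonEnergy).domain) (n : ℕ) :
    vec (S.momentumTerm Ψ h) n =ᵐ[configMeasure n]
      fun x => matAct (S.slash (totalMomentum x)) (vec Ψ n x) := by
  have h1 := ae_all_iff.2 fun j => vec_matAct (S.α j)
    (componentwise (Prad j) Ψ fun s => mem_Prad_domain (h s) j) n
  have h2 := ae_all_iff.2 fun j => vec_componentwise_dGamma (fun y => y.1 j) Ψ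
    (fun s => mem_Prad_domain (h s) j) n
  filter_upwards [h1, h2, vec_sum Finset.univ (fun j => matAct (S.α j)
    (componentwise (Prad j) Ψ fun s => mem_Prad_domain (h s) j)) n] with x h1 h2 h3
  unfold Model.momentumTerm
  rw [h3]
  unfold Model.slash
  rw [matAct_sum_left]
  refine Finset.sum_congr rfl fun j _ => ?_
  rw [h1]
  unfold Prad
  rw [h2, map_smul, matAct_smul_left, totalMomentum_apply]

theorem Model.norm_vec_momentumTerm (h : ∀ s, Ψ s ∈ (dGamma photonEnergy).domain) (n : ℕ) :
    ∀ᵐ x ∂configMeasure n, ‖vec (S.momentumTerm Ψ h) n x‖ ^ 2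
      = ‖totalMomentum x‖ ^ 2 * ‖vec Ψ n x‖ ^ 2 := by
  filter_upwards [S.vec_momentumTerm h n] with x hx
  rw [hx, S.norm_matAct_slash, mul_pow]

theorem norm_vec_energy (h : ∀ s, Ψ s ∈ (dGamma photonEnergy).domain) (n : ℕ) :
    ∀ᵐ x ∂configMeasure n, ‖vec (componentwise (dGamma photonEnergy) Ψ h) n x‖ ^ 2
      = sumOver photonEnergy x ^ 2 * ‖vec Ψ n x‖ ^ 2 := by
  filter_upwards [vec_componentwise_dGamma photonEnergy Ψ h n] with x hx
  rw [hx, norm_smul, mul_pow, Complex.norm_real, Real.norm_eq_abs, sq_abs]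

theorem integrable_defect (h : ∀ s, Ψ s ∈ (dGamma photonEnergy).domain) (n : ℕ) :
    Integrable (fun x => (sumOver photonEnergy x ^ 2 - ‖totalMomentum x‖ ^ 2) * ‖vec Ψ n x‖ ^ 2)
      (configMeasure n) := by
  refine ((integrable_norm_sq_vec (componentwise (dGamma photonEnergy) Ψ h) n).mono' ?_ ?_)
  · exact (((measurable_sumOver measurable_photonEnergy n).pow_const 2).sub
      ((measurable_totalMomentum n).norm.pow_const 2)).aestronglyMeasurable.mul
      ((stronglyMeasurable_vec Ψ n).norm.pow 2).aestronglyMeasurable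
  · filter_upwards [norm_vec_energy h n] with x hx
    have h1 := norm_totalMomentum_le x
    have h2 : ‖totalMomentum x‖ ^ 2 ≤ sumOver photonEnergy x ^ 2 := by gcongr
    rw [hx, Real.norm_of_nonneg (mul_nonneg (by linarith) (by positivity))]
    gcongr
    linarith [sq_nonneg ‖totalMomentum x‖]

/-- The collinearity defect `dΓ(|k|)² - dΓ(k)²`. -/
theorem Model.hasSum_defect (h : ∀ s, Ψ s ∈ (dGamma photonEnergy).domain) :
    HasSum (fun n => ∫ x, (sumOver photonEnergy x ^ 2 - ‖totalMomentum x‖ ^ 2) * ‖vec Ψ n x‖ ^ 2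
        ∂configMeasure n)
      (‖componentwise (dGamma photonEnergy) Ψ h‖ ^ 2 - ‖S.momentumTerm Ψ h‖ ^ 2) := by
  refine hasSum_of_eq ((hasSum_norm_sq_vec (componentwise (dGamma photonEnergy) Ψ h)).sub
      (hasSum_norm_sq_vec (S.momentumTerm Ψ h))) fun n => ?_
  rw [← integral_sub (integrable_norm_sq_vec _ n) (integrable_norm_sq_vec _ n)]
  refine integral_congr_ae ?_
  filter_upwards [norm_vec_energy h n, S.norm_vec_momentumTerm h n] with x h1 h2
  rw [h1, h2]
  ring

theorem integrable_energy_vec (h : ∀ s, Ψ s ∈ (dGamma photonEnergy).domain) (n : ℕ) :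
    Integrable (fun x => sumOver photonEnergy x * ‖vec Ψ n x‖ ^ 2) (configMeasure n) := by
  simp only [norm_sq_vec, Finset.mul_sum]
  exact integrable_finsetSum _ fun s _ => integrable_sumOver_mul ⟨Ψ s, h s⟩ n

theorem hasSum_energy_vec (h : ∀ s, Ψ s ∈ (dGamma photonEnergy).domain) :
    HasSum (fun n => ∫ x, sumOver photonEnergy x * ‖vec Ψ n x‖ ^ 2 ∂configMeasure n)
      (inner ℂ (componentwise (dGamma photonEnergy) Ψ h) Ψ).re := by
  rw [PiLp.inner_apply, Complex.re_sum]
  have h1 := hasSum_sum fun s (_ : s ∈ Finset.univ) =>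
    hasSum_re_inner_dGamma photonEnergy ⟨Ψ s, h s⟩
  refine hasSum_of_eq h1 fun n => ?_
  simp only [norm_sq_vec, Finset.mul_sum]
  exact integral_finsetSum _ fun s _ => integrable_sumOver_mul ⟨Ψ s, h s⟩ n

theorem norm_sq_vec_perm (Ψ : SpinFock) (n : ℕ) (s : Equiv.Perm (Fin n)) :
    (fun x => ‖vec Ψ n (x ∘ s)‖ ^ 2) =ᵐ[configMeasure n] fun x => ‖vec Ψ n x‖ ^ 2 := by
  have h1 := ae_all_iff.2 fun t => norm_sq_wave_perm (Ψ t) n s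
  filter_upwards [h1] with x hx
  simp only [norm_sq_vec, hx]

theorem integral_energy_split (h : ∀ s, Ψ s ∈ (dGamma photonEnergy).domain) (n : ℕ) :
    Integrable (fun z => ‖z.2.1‖ * ‖vec Ψ (n + 1) (consConfig z)‖ ^ 2) (splitMeasure n) ∧
      (n + 1) * ∫ z, ‖z.2.1‖ * ‖vec Ψ (n + 1) (consConfig z)‖ ^ 2 ∂splitMeasure n
        = ∫ x, sumOver photonEnergy x * ‖vec Ψ (n + 1) x‖ ^ 2 ∂configMeasure (n + 1) := by
  refine integral_sum_symm (h := fun y _ => photonEnergy y)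
    (F := fun x => ‖vec Ψ (n + 1) x‖ ^ 2) (fun y _ => photonEnergy_nonneg y)
    (fun x => by positivity) (fun _ _ _ => rfl) (norm_sq_vec_perm Ψ (n + 1)) ?_
    (integrable_energy_vec h (n + 1))
  exact (measurable_photonEnergy.comp (measurable_pi_apply 0)).aestronglyMeasurable.mul
    ((stronglyMeasurable_vec Ψ (n + 1)).norm.pow 2).aestronglyMeasurable

/-- The defect is the sum over photons of `|k_j| E - k_j·P`, with `E` and `P` the total energy and
momentum, and by symmetry each photon contributes equally. In the contribution of one photon its own
part `|k|² - k·k` drops out, so `E` and `P` may be replaced by those of the other photons. -/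
theorem integral_defect_split (h : ∀ s, Ψ s ∈ (dGamma photonEnergy).domain) (n : ℕ) :
    Integrable (fun z => (‖z.2.1‖ * sumOver photonEnergy z.1 - inner ℝ z.2.1 (totalMomentum z.1))
        * ‖vec Ψ (n + 1) (consConfig z)‖ ^ 2) (splitMeasure n) ∧
      (n + 1) * ∫ z, (‖z.2.1‖ * sumOver photonEnergy z.1 - inner ℝ z.2.1 (totalMomentum z.1))
        * ‖vec Ψ (n + 1) (consConfig z)‖ ^ 2 ∂splitMeasure n
        = ∫ x, (sumOver photonEnergy x ^ 2 - ‖totalMomentum x‖ ^ 2) * ‖vec Ψ (n + 1) x‖ ^ 2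
          ∂configMeasure (n + 1) := by
  have hsum : ∀ x : Fin (n + 1) → Photon,
      ∑ j, (‖(x j).1‖ * sumOver photonEnergy x - inner ℝ (x j).1 (totalMomentum x))
        = sumOver photonEnergy x ^ 2 - ‖totalMomentum x‖ ^ 2 := by
    intro x
    rw [Finset.sum_sub_distrib, ← Finset.sum_mul, ← sum_inner, ← real_inner_self_eq_norm_sq, sq]
    rfl
  have hcons : ∀ z : (Fin n → Photon) × Photon,
      ‖z.2.1‖ * sumOver photonEnergy (consConfig z) - inner ℝ z.2.1 (totalMomentum (consConfig z))
        = ‖z.2.1‖ * sumOver photonEnergy z.1 - inner ℝ z.2.1 (totalMomentum z.1) := by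
    intro z
    rw [sumOver_consConfig, totalMomentum_consConfig, inner_add_right, real_inner_self_eq_norm_sq,
      photonEnergy]
    ring
  have hmeas : Measurable fun x : Fin (n + 1) → Photon =>
      ‖(x 0).1‖ * sumOver photonEnergy x - inner ℝ (x 0).1 (totalMomentum x) := by
    have h1 : Measurable fun x : Fin (n + 1) → Photon => (x 0).1 := (measurable_pi_apply 0).fst
    exact (h1.norm.mul (measurable_sumOver measurable_photonEnergy _)).sub
      (h1.inner (measurable_totalMomentum _))
  have key := integral_sum_symm
    (h := fun y x => ‖y.1‖ * sumOver photonEnergy x - inner ℝ y.1 (totalMomentum x))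
    (F := fun x => ‖vec Ψ (n + 1) x‖ ^ 2) (fun y x => by
      have h1 := (abs_le.1 (abs_real_inner_le_norm y.1 (totalMomentum x))).2
      have h2 := mul_le_mul_of_nonneg_left (norm_totalMomentum_le x) (norm_nonneg y.1)
      linarith)
    (fun x => by positivity) (fun y s x => by rw [sumOver_perm, totalMomentum_perm])
    (norm_sq_vec_perm Ψ (n + 1))
    (hmeas.aestronglyMeasurable.mul
      ((stronglyMeasurable_vec Ψ (n + 1)).norm.pow 2).aestronglyMeasurable)
    (by simpa only [hsum] using integrable_defect h (n + 1))
  simpa only [hsum, hcons] using key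

/-! ### The coupling functions -/

/-- The scalar coupling `|k|^{-1/2} ρ(k)`. -/
def Model.amplitude (y : Photon) : ℂ := ((‖y.1‖ ^ (-1 / 2 : ℝ) : ℝ) : ℂ) * S.ρ y.1

theorem Model.g_ae_eq (j : Fin 3) :
    S.g j =ᵐ[photonMeasure] fun y => S.amplitude y * ((S.e y.2 y.1 j : ℝ) : ℂ) :=
  (S.gFun_memLp j).coeFn_toLp

/-- Also valid at `r = 0`, where both sides vanish by convention, so the point `k = 0` needs no
separate treatment later. -/
theorem rpow_neg_half_eq {r : ℝ} (hr : 0 ≤ r) : r ^ (-1 / 2 : ℝ) = Real.sqrt r * r⁻¹ := by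
  rcases eq_or_lt_of_le hr with h0 | h0
  · rw [← h0, Real.zero_rpow (by norm_num)]
    simp
  · rw [Real.sqrt_eq_rpow, ← Real.rpow_neg_one, ← Real.rpow_add h0]
    norm_num

theorem Model.norm_amplitude (y : Photon) :
    ‖S.amplitude y‖ = Real.sqrt ‖y.1‖ * (‖y.1‖⁻¹ * ‖S.ρ y.1‖) := by
  rw [Model.amplitude, norm_mul, Complex.norm_real, rpow_neg_half_eq (norm_nonneg _),
    Real.norm_of_nonneg (by positivity), mul_assoc]

theorem Model.norm_amplitude_mul (y : Photon) :
    ‖S.amplitude y‖ * ‖y.1‖ = Real.sqrt ‖y.1‖ * ‖S.ρ y.1‖ := by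
  rw [S.norm_amplitude]
  rcases eq_or_ne ‖y.1‖ 0 with h0 | h0
  · simp [h0]
  · field_simp

theorem Model.norm_e (l : Fin 2) (k : R3) : ‖S.e l k‖ = 1 := by
  have h1 := S.e_orthonormal k l l
  rw [if_pos rfl, real_inner_self_eq_norm_sq] at h1
  nlinarith [norm_nonneg (S.e l k)]

theorem Model.integrable_ρ_sq : Integrable (fun y : Photon => ‖S.ρ y.1‖ ^ 2) photonMeasure :=
  ((memLp_two_iff_integrable_sq_norm S.ρ_memLp.1).1 S.ρ_memLp).comp_fst
    (ν := (Measure.count : Measure (Fin 2)))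

theorem Model.integrable_inv_ρ_sq :
    Integrable (fun y : Photon => (‖y.1‖⁻¹ * ‖S.ρ y.1‖) ^ 2) photonMeasure := by
  have h1 := ((memLp_two_iff_integrable_sq_norm S.ρ_dom.1).1 S.ρ_dom).comp_fst
    (ν := (Measure.count : Measure (Fin 2)))
  refine h1.congr (Filter.Eventually.of_forall fun y => ?_)
  simp

/-- The coupling is `√|k|` times `|k|⁻¹ρ e_j`, and the latter is square integrable by the infrared
condition on `ρ`. -/
theorem Model.isWeighted_g (j : Fin 3) : IsWeighted (S.g j) photonEnergy
    (fun y => ((‖y.1‖⁻¹ : ℝ) : ℂ) * S.ρ y.1 * ((S.e y.2 y.1 j : ℝ) : ℂ)) := by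
  refine ⟨measurable_photonEnergy, photonEnergy_nonneg, ?_, ?_⟩
  · have hem : Measurable fun x : Photon => ((S.e x.2 x.1 j : ℝ) : ℂ) := by
      refine Complex.measurable_ofReal.comp ?_
      exact measurable_from_prod_countable_left fun l => S.e_measurable l j
    have hm : AEStronglyMeasurable (fun y : Photon =>
        ((‖y.1‖⁻¹ : ℝ) : ℂ) * S.ρ y.1 * ((S.e y.2 y.1 j : ℝ) : ℂ)) photonMeasure :=
      (S.ρ_dom.1.comp_fst).mul hem.aestronglyMeasurable
    refine (memLp_two_iff_integrable_sq_norm hm).2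
      (S.integrable_inv_ρ_sq.mono' (hm.norm.pow 2) (Filter.Eventually.of_forall fun y => ?_))
    have h1 := PiLp.norm_apply_le (S.e y.2 y.1) j
    rw [S.norm_e] at h1
    rw [Real.norm_of_nonneg (by positivity), norm_mul, norm_mul, Complex.norm_real,
      Complex.norm_real, norm_inv, norm_norm]
    refine pow_le_pow_left₀ (by positivity) ?_ 2
    exact mul_le_of_le_one_right (by positivity) h1
  · filter_upwards [S.g_ae_eq j] with y hy
    rw [hy, Model.amplitude, rpow_neg_half_eq (norm_nonneg _), photonEnergy]
    push_cast
    ring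

theorem Model.interaction_ae_eq (Φ U : SpinFock) (n : ℕ) :
    ∀ᵐ z ∂splitMeasure n, interaction S.g S.α Φ U n z = inner ℂ (vec Φ n z.1)
      (conj (S.amplitude z.2) • matAct (S.slash (S.e z.2.2 z.2.1))
        (vec U (n + 1) (consConfig z))) := by
  have h1 : ∀ᵐ z ∂splitMeasure n, ∀ j, S.g j z.2
      = S.amplitude z.2 * ((S.e z.2.2 z.2.1 j : ℝ) : ℂ) :=
    ae_all_iff.2 fun j => Measure.quasiMeasurePreserving_snd.ae (S.g_ae_eq j)
  filter_upwards [h1] with z hz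
  unfold interaction Model.slash
  congr 1
  rw [matAct_sum_left, Finset.smul_sum]
  refine Finset.sum_congr rfl fun j _ => ?_
  rw [hz, matAct_smul_left, smul_smul, map_mul, Complex.conj_ofReal]

end DiracPolaron

namespace DiracPolaron

variable (S : Model) {Ψ : SpinFock}

/-! ### The form bound for the cross terms -/

/-- The pointwise form of the bound of the cross terms. -/
theorem coupling_le {a b k E D W ρ v v' q N G eP : ℝ} (hN : 0 ≤ N) (hk : 0 ≤ k) (hE : 0 ≤ E)
    (hD : 0 ≤ D) (hW : 0 ≤ W) (hρ : 0 ≤ ρ) (hv : 0 ≤ v) (hv' : 0 ≤ v')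
    (hG : G = Real.sqrt k * W) (hGk : G * k = Real.sqrt k * ρ) (heP : k * eP ^ 2 ≤ 2 * E * D)
    (ha : |a| ≤ G * (v * v' * (2 * |eP| + k))) (hb : b = Real.sqrt 2 * q) :
    b * Real.sqrt N * a ≤ N * (D * v' ^ 2) + 4 * q ^ 2 * (E * v ^ 2 * W ^ 2)
      + (N * (k * v' ^ 2) + q ^ 2 * (v ^ 2 * ρ ^ 2)) := by
  have h2 : Real.sqrt 2 ^ 2 = 2 := Real.sq_sqrt zero_le_two
  have h2' : Real.sqrt 2 ≤ 2 := by nlinarith [Real.sqrt_nonneg 2]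
  have hsN := Real.sq_sqrt hN
  have hsE := Real.sq_sqrt hE
  have hsD := Real.sq_sqrt hD
  have hsk := Real.sq_sqrt hk
  -- The transversality bound in square-root form: the growing factor `|e·P|` is traded for `√E √D`.
  have hek : Real.sqrt k * |eP| ≤ Real.sqrt 2 * (Real.sqrt E * Real.sqrt D) := by
    refine (sq_le_sq₀ (by positivity) (by positivity)).1 ?_
    rw [mul_pow, mul_pow, mul_pow, hsk, hsE, hsD, h2, sq_abs]
    linarith
  have h3 : |a| ≤ 2 * Real.sqrt 2 * (Real.sqrt E * Real.sqrt D * W * v * v')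
      + Real.sqrt k * ρ * v * v' := by
    refine ha.trans ?_
    have h4 : G * (v * v' * (2 * |eP| + k))
        = 2 * (W * v * v') * (Real.sqrt k * |eP|) + (G * k) * v * v' := by
      rw [hG]
      ring
    rw [h4, hGk]
    have := mul_le_mul_of_nonneg_left hek (by positivity : 0 ≤ 2 * (W * v * v'))
    linarith
  have h5 : b * Real.sqrt N * a ≤ Real.sqrt 2 * |q| * Real.sqrt N * |a| := by
    refine (le_abs_self _).trans (le_of_eq ?_)
    rw [hb, abs_mul, abs_mul, abs_mul, abs_of_nonneg (Real.sqrt_nonneg 2),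
      abs_of_nonneg (Real.sqrt_nonneg N)]
  have h6 := mul_le_mul_of_nonneg_left h3
    (by positivity : 0 ≤ Real.sqrt 2 * |q| * Real.sqrt N)
  have h7 : Real.sqrt 2 * |q| * Real.sqrt N
        * (2 * Real.sqrt 2 * (Real.sqrt E * Real.sqrt D * W * v * v') + Real.sqrt k * ρ * v * v')
      = 2 * ((Real.sqrt N * Real.sqrt D * v') * (2 * |q| * W * Real.sqrt E * v))
        + Real.sqrt 2 * ((Real.sqrt N * Real.sqrt k * v') * (|q| * ρ * v)) := by
    linear_combination
      (2 * |q| * Real.sqrt N * (Real.sqrt E * Real.sqrt D * W * v * v')) * h2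
  -- The factors are balanced so that the defect term `N D v'²` appears with coefficient exactly
  -- one, all that the square of `dΓ(|k|)` can supply; every constant goes to the energy term.
  have h8 := two_mul_le_add_sq (Real.sqrt N * Real.sqrt D * v') (2 * |q| * W * Real.sqrt E * v)
  have h9 := two_mul_le_add_sq (Real.sqrt N * Real.sqrt k * v') (|q| * ρ * v)
  have h10 : Real.sqrt 2 * ((Real.sqrt N * Real.sqrt k * v') * (|q| * ρ * v))
      ≤ 2 * ((Real.sqrt N * Real.sqrt k * v') * (|q| * ρ * v)) := by
    gcongr
  have e1 : (Real.sqrt N * Real.sqrt D * v') ^ 2 = N * (D * v' ^ 2) := by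
    rw [mul_pow, mul_pow, hsN, hsD]; ring
  have e2 : (2 * |q| * W * Real.sqrt E * v) ^ 2 = 4 * q ^ 2 * (E * v ^ 2 * W ^ 2) := by
    rw [mul_pow, mul_pow, mul_pow, mul_pow, hsE, sq_abs]; ring
  have e3 : (Real.sqrt N * Real.sqrt k * v') ^ 2 = N * (k * v' ^ 2) := by
    rw [mul_pow, mul_pow, hsN, hsk]; ring
  have e4 : (|q| * ρ * v) ^ 2 = q ^ 2 * (v ^ 2 * ρ ^ 2) := by
    rw [mul_pow, mul_pow, sq_abs]; ring
  linarith

/-- The Clifford and transversality bounds are used with `P` and `E` the momentum and energy of the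
photons other than the distinguished one. -/
theorem Model.coupling_ae_le (h : ∀ s, Ψ s ∈ (dGamma photonEnergy).domain) (q : ℝ) (n : ℕ) :
    ∀ᵐ z ∂splitMeasure n, Real.sqrt 2 * q * Real.sqrt (n + 1)
        * (interaction S.g S.α (S.momentumTerm Ψ h) Ψ n z
          + interaction S.g S.α Ψ (S.momentumTerm Ψ h) n z).re
      ≤ (n + 1) * ((‖z.2.1‖ * sumOver photonEnergy z.1 - inner ℝ z.2.1 (totalMomentum z.1))
          * ‖vec Ψ (n + 1) (consConfig z)‖ ^ 2)
        + 4 * q ^ 2 * (sumOver photonEnergy z.1 * ‖vec Ψ n z.1‖ ^ 2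
          * (‖z.2.1‖⁻¹ * ‖S.ρ z.2.1‖) ^ 2)
        + ((n + 1) * (‖z.2.1‖ * ‖vec Ψ (n + 1) (consConfig z)‖ ^ 2)
          + q ^ 2 * (‖vec Ψ n z.1‖ ^ 2 * ‖S.ρ z.2.1‖ ^ 2)) := by
  have h1 : ∀ᵐ z ∂splitMeasure n, vec (S.momentumTerm Ψ h) n z.1
      = matAct (S.slash (totalMomentum z.1)) (vec Ψ n z.1) :=
    Measure.quasiMeasurePreserving_fst.ae (S.vec_momentumTerm h n)
  have h2 : ∀ᵐ z ∂splitMeasure n, vec (S.momentumTerm Ψ h) (n + 1) (consConfig z)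
      = matAct (S.slash (totalMomentum (consConfig z))) (vec Ψ (n + 1) (consConfig z)) :=
    (measurePreserving_consConfig n).quasiMeasurePreserving.ae (S.vec_momentumTerm h (n + 1))
  filter_upwards [h1, h2, S.interaction_ae_eq (S.momentumTerm Ψ h) Ψ n,
    S.interaction_ae_eq Ψ (S.momentumTerm Ψ h) n] with z h1 h2 h3 h4
  have hcl := S.norm_clifford_le (e := S.e z.2.2 z.2.1) (P := totalMomentum z.1) (k := z.2.1)
    (S.norm_e _ _) (vec Ψ n z.1) (vec Ψ (n + 1) (consConfig z)) (conj (S.amplitude z.2))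
  rw [RCLike.norm_conj] at hcl
  rw [h3, h4, h1, h2, totalMomentum_consConfig]
  have hP := norm_totalMomentum_le z.1
  have hD : 0 ≤ ‖z.2.1‖ * sumOver photonEnergy z.1 - inner ℝ z.2.1 (totalMomentum z.1) := by
    have h5 := (abs_le.1 (abs_real_inner_le_norm z.2.1 (totalMomentum z.1))).2
    have h6 := mul_le_mul_of_nonneg_left hP (norm_nonneg z.2.1)
    linarith
  exact coupling_le (by positivity) (norm_nonneg _) (sumOver_photonEnergy_nonneg _) hD
    (by positivity) (norm_nonneg _) (norm_nonneg _) (norm_nonneg _) (S.norm_amplitude z.2)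
    (S.norm_amplitude_mul z.2)
    (norm_mul_inner_sq_le (S.norm_e _ _) (S.e_transversal _ _) hP) hcl rfl

theorem Model.sector_coupling_le (h : ∀ s, Ψ s ∈ (dGamma photonEnergy).domain) (q : ℝ) (n : ℕ) :
    Real.sqrt 2 * q *
        ((Real.sqrt (n + 1) : ℂ) * ∫ z, interaction S.g S.α (S.momentumTerm Ψ h) Ψ n z
            ∂splitMeasure n
          + (Real.sqrt (n + 1) : ℂ) * ∫ z, interaction S.g S.α Ψ (S.momentumTerm Ψ h) n z
            ∂splitMeasure n).re
      ≤ ∫ x, (sumOver photonEnergy x ^ 2 - ‖totalMomentum x‖ ^ 2) * ‖vec Ψ (n + 1) x‖ ^ 2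
          ∂configMeasure (n + 1)
        + 4 * q ^ 2 * ((∫ x, sumOver photonEnergy x * ‖vec Ψ n x‖ ^ 2 ∂configMeasure n)
          * ∫ y, (‖y.1‖⁻¹ * ‖S.ρ y.1‖) ^ 2 ∂photonMeasure)
        + (∫ x, sumOver photonEnergy x * ‖vec Ψ (n + 1) x‖ ^ 2 ∂configMeasure (n + 1)
          + q ^ 2 * ((∫ x, ‖vec Ψ n x‖ ^ 2 ∂configMeasure n)
            * ∫ y, ‖S.ρ y.1‖ ^ 2 ∂photonMeasure)) := by
  obtain ⟨hD, hD'⟩ := integral_defect_split h n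
  obtain ⟨hE, hE'⟩ := integral_energy_split h n
  have hW : Integrable (fun z : (Fin n → Photon) × Photon =>
      (sumOver photonEnergy z.1 * ‖vec Ψ n z.1‖ ^ 2) * (‖z.2.1‖⁻¹ * ‖S.ρ z.2.1‖) ^ 2)
      (splitMeasure n) := (integrable_energy_vec h n).mul_prod S.integrable_inv_ρ_sq
  have hR : Integrable (fun z : (Fin n → Photon) × Photon =>
      ‖vec Ψ n z.1‖ ^ 2 * ‖S.ρ z.2.1‖ ^ 2) (splitMeasure n) :=
    (integrable_norm_sq_vec Ψ n).mul_prod S.integrable_ρ_sq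
  have hW' := integral_prod_mul (μ := configMeasure n) (ν := photonMeasure)
    (fun x => sumOver photonEnergy x * ‖vec Ψ n x‖ ^ 2) (fun y => (‖y.1‖⁻¹ * ‖S.ρ y.1‖) ^ 2)
  have hR' := integral_prod_mul (μ := configMeasure n) (ν := photonMeasure)
    (fun x => ‖vec Ψ n x‖ ^ 2) (fun y => ‖S.ρ y.1‖ ^ 2)
  have hI1 := integrable_interaction S.g S.α (S.momentumTerm Ψ h) Ψ n
  have hI2 := integrable_interaction S.g S.α Ψ (S.momentumTerm Ψ h) n
  have hI : Integrable (fun z => interaction S.g S.α (S.momentumTerm Ψ h) Ψ n z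
          + interaction S.g S.α Ψ (S.momentumTerm Ψ h) n z) (splitMeasure n) := hI1.add hI2
  have hlhs : Real.sqrt 2 * q *
        ((Real.sqrt (n + 1) : ℂ) * ∫ z, interaction S.g S.α (S.momentumTerm Ψ h) Ψ n z
            ∂splitMeasure n
          + (Real.sqrt (n + 1) : ℂ) * ∫ z, interaction S.g S.α Ψ (S.momentumTerm Ψ h) n z
            ∂splitMeasure n).re
      = ∫ z, Real.sqrt 2 * q * Real.sqrt (n + 1)
        * (interaction S.g S.α (S.momentumTerm Ψ h) Ψ n z
          + interaction S.g S.α Ψ (S.momentumTerm Ψ h) n z).re ∂splitMeasure n := by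
    rw [← mul_add, ← integral_add hI1 hI2, Complex.re_ofReal_mul, integral_const_mul]
    have hre := integral_re hI
    simp only [RCLike.re_to_complex] at hre
    rw [hre]
    ring
  have hB1 := hD.const_mul ((n : ℝ) + 1)
  have hB2 := hW.const_mul (4 * q ^ 2)
  have hB3 := hE.const_mul ((n : ℝ) + 1)
  have hB4 := hR.const_mul (q ^ 2)
  rw [hlhs]
  refine (integral_mono_ae (hI.re.const_mul _) ((hB1.add hB2).add (hB3.add hB4))
    (S.coupling_ae_le h q n)).trans (le_of_eq ?_)
  rw [integral_add' (hB1.add hB2) (hB3.add hB4), integral_add' hB1 hB2, integral_add' hB3 hB4,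
    integral_const_mul, integral_const_mul, integral_const_mul, integral_const_mul, hD', hE', hW',
    hR']

end DiracPolaron

namespace DiracPolaron

/-! ### Relative boundedness of the interaction -/

variable (S : Model) {Ψ : SpinFock}

/-- `α · a(g) Ψ`. -/
def Model.annihilationTerm (Ψ : SpinFock) (h : ∀ s, Ψ s ∈ (dGamma photonEnergy).domain) :
    SpinFock :=
  ∑ j, matAct (S.α j) (WithLp.toLp 2 fun s => annihilation (S.g j)
    ⟨Ψ s, mem_annihilation_domain_of_dGamma (S.isWeighted_g j) ⟨Ψ s, h s⟩⟩)

/-- `α · a(g)* Ψ`. -/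
def Model.creationTerm (Ψ : SpinFock) (h : ∀ s, Ψ s ∈ (dGamma photonEnergy).domain) :
    SpinFock :=
  ∑ j, matAct (S.α j) (WithLp.toLp 2 fun s => creation (S.g j)
    ⟨Ψ s, mem_creation_domain_of_dGamma (S.isWeighted_g j) ⟨Ψ s, h s⟩⟩)

theorem Model.vec_momentumTerm_zero (h : ∀ s, Ψ s ∈ (dGamma photonEnergy).domain) :
    vec (S.momentumTerm Ψ h) 0 =ᵐ[configMeasure 0] fun _ => 0 := by
  filter_upwards [S.norm_vec_momentumTerm h 0] with x hx
  simpa [totalMomentum] using hx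

/-- The annihilation part pairs sector `n` of `α·dΓ(k)Ψ` with sector `n + 1` of `Ψ`, the creation
part does the opposite. After an index shift both are integrals over the same split configurations.
The shift loses nothing, since `α·dΓ(k)Ψ` has no vacuum component. -/
theorem Model.hasSum_coupling (h : ∀ s, Ψ s ∈ (dGamma photonEnergy).domain) :
    HasSum (fun n : ℕ =>
        ((Real.sqrt (n + 1) : ℂ) * ∫ z, interaction S.g S.α (S.momentumTerm Ψ h) Ψ n z
            ∂splitMeasure n
          + (Real.sqrt (n + 1) : ℂ) * ∫ z, interaction S.g S.α Ψ (S.momentumTerm Ψ h) n z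
            ∂splitMeasure n).re)
      (inner ℂ (S.momentumTerm Ψ h) (S.annihilationTerm Ψ h + S.creationTerm Ψ h)).re := by
  have h1 := hasSum_inner_vec (S.momentumTerm Ψ h) (S.annihilationTerm Ψ h)
  have h2 := (hasSum_nat_add_iff' 1).2
    (hasSum_inner_vec (S.creationTerm Ψ h) (S.momentumTerm Ψ h))
  have h0 : ∫ x, inner ℂ (vec (S.creationTerm Ψ h) 0 x) (vec (S.momentumTerm Ψ h) 0 x)
      ∂configMeasure 0 = 0 := by
    refine integral_eq_zero_of_ae ?_
    filter_upwards [S.vec_momentumTerm_zero h] with x hx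
    simp [hx]
  rw [Finset.sum_range_one, h0, sub_zero] at h2
  have h3 := Complex.hasSum_re (h1.add h2)
  have h4 : (inner ℂ (S.momentumTerm Ψ h) (S.annihilationTerm Ψ h + S.creationTerm Ψ h)).re
      = (inner ℂ (S.momentumTerm Ψ h) (S.annihilationTerm Ψ h)
        + inner ℂ (S.creationTerm Ψ h) (S.momentumTerm Ψ h)).re := by
    rw [inner_add_right, Complex.add_re, Complex.add_re,
      ← inner_conj_symm (S.momentumTerm Ψ h) (S.creationTerm Ψ h), Complex.conj_re]
  rw [h4]
  refine hasSum_of_eq h3 fun n => ?_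
  congr 2
  · exact (integral_inner_vec_annihilation S.g S.α _ Ψ _ n).symm
  · exact (integral_inner_creation_vec S.g S.α S.α_hermitian
      (fun j => annihilation_dense (S.isWeighted_g j)) _ Ψ _ n).symm

theorem Model.coupling_form_le (h : ∀ s, Ψ s ∈ (dGamma photonEnergy).domain) (q : ℝ) :
    Real.sqrt 2 * q *
        (inner ℂ (S.momentumTerm Ψ h) (S.annihilationTerm Ψ h + S.creationTerm Ψ h)).re
      ≤ ‖componentwise (dGamma photonEnergy) Ψ h‖ ^ 2 - ‖S.momentumTerm Ψ h‖ ^ 2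
        + 4 * q ^ 2 * ((inner ℂ (componentwise (dGamma photonEnergy) Ψ h) Ψ).re
          * ∫ y, (‖y.1‖⁻¹ * ‖S.ρ y.1‖) ^ 2 ∂photonMeasure)
        + ((inner ℂ (componentwise (dGamma photonEnergy) Ψ h) Ψ).re
          + q ^ 2 * (‖Ψ‖ ^ 2 * ∫ y, ‖S.ρ y.1‖ ^ 2 ∂photonMeasure)) := by
  -- The terms in `n + 1` photons sum to the full series without their vacuum term, which is
  -- nonnegative and can be restored.
  have hd := (hasSum_nat_add_iff' 1).2 (S.hasSum_defect h)
  have he := hasSum_energy_vec h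
  have he' := (hasSum_nat_add_iff' 1).2 he
  have hn := hasSum_norm_sq_vec Ψ
  rw [Finset.sum_range_one] at hd he'
  have hd0 : 0 ≤ ∫ x, (sumOver photonEnergy x ^ 2 - ‖totalMomentum x‖ ^ 2) * ‖vec Ψ 0 x‖ ^ 2
      ∂configMeasure 0 := integral_nonneg fun x => by
    have := norm_totalMomentum_le x
    have : ‖totalMomentum x‖ ^ 2 ≤ sumOver photonEnergy x ^ 2 := by gcongr
    exact mul_nonneg (by linarith) (by positivity)
  have he0 : 0 ≤ ∫ x, sumOver photonEnergy x * ‖vec Ψ 0 x‖ ^ 2 ∂configMeasure 0 :=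
    integral_nonneg fun x => mul_nonneg (sumOver_photonEnergy_nonneg x) (by positivity)
  have hle := hasSum_le (S.sector_coupling_le h q) ((S.hasSum_coupling h).mul_left _)
    ((hd.add ((he.mul_right _).mul_left (4 * q ^ 2))).add
      (he'.add ((hn.mul_right _).mul_left (q ^ 2))))
  linarith

theorem norm_sum_matAct_sq_le (Φ : Fin 3 → SpinFock) :
    ‖∑ j, matAct (S.α j) (Φ j)‖ ^ 2 ≤ 3 * ∑ j, ‖Φ j‖ ^ 2 := by
  have h1 : ‖∑ j, matAct (S.α j) (Φ j)‖ ≤ ∑ j, ‖Φ j‖ :=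
    (norm_sum_le _ _).trans_eq (Finset.sum_congr rfl fun j _ => S.norm_matAct_α j _)
  refine (pow_le_pow_left₀ (norm_nonneg _) h1 2).trans ?_
  simpa using sq_sum_le_card_mul_sum_sq (s := Finset.univ) (f := fun j => ‖Φ j‖)

theorem re_inner_componentwise (w : Photon → ℝ) (h : ∀ s, Ψ s ∈ (dGamma w).domain) :
    (inner ℂ (componentwise (dGamma w) Ψ h) Ψ).re
      = ∑ s, (inner ℂ (dGamma w ⟨Ψ s, h s⟩) (Ψ s)).re := by
  rw [PiLp.inner_apply, Complex.re_sum]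
  rfl

theorem norm_sq_componentwise (T : Fock →ₗ.[ℂ] Fock) (h : ∀ s, Ψ s ∈ T.domain) :
    ‖componentwise T Ψ h‖ ^ 2 = ∑ s, ‖T ⟨Ψ s, h s⟩‖ ^ 2 :=
  PiLp.norm_sq_eq_of_L2 _ _

theorem Model.exists_norm_annihilationTerm_sq_le : ∃ K : ℝ, 0 ≤ K ∧
    ∀ (Ψ : SpinFock) (h : ∀ s, Ψ s ∈ (dGamma photonEnergy).domain),
      ‖S.annihilationTerm Ψ h‖ ^ 2
        ≤ K * (inner ℂ (componentwise (dGamma photonEnergy) Ψ h) Ψ).re := by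
  refine ⟨3 * ∑ j, ∫ y, ‖((‖y.1‖⁻¹ : ℝ) : ℂ) * S.ρ y.1 * ((S.e y.2 y.1 j : ℝ) : ℂ)‖ ^ 2
    ∂photonMeasure, ?_, fun Ψ h => ?_⟩
  · exact mul_nonneg (by norm_num) (Finset.sum_nonneg fun j _ =>
      integral_nonneg fun y => by positivity)
  · refine (norm_sum_matAct_sq_le S _).trans ?_
    rw [mul_assoc, Finset.sum_mul]
    gcongr with j
    rw [PiLp.norm_sq_eq_of_L2, re_inner_componentwise, Finset.mul_sum]
    gcongr with s
    exact norm_annihilation_sq_le (S.isWeighted_g j) ⟨Ψ s, h s⟩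

theorem Model.exists_norm_creationTerm_sq_le : ∃ K L : ℝ, 0 ≤ K ∧ 0 ≤ L ∧
    ∀ (Ψ : SpinFock) (h : ∀ s, Ψ s ∈ (dGamma photonEnergy).domain),
      ‖S.creationTerm Ψ h‖ ^ 2 ≤ L * ‖Ψ‖ ^ 2
        + K * (inner ℂ (componentwise (dGamma photonEnergy) Ψ h) Ψ).re := by
  refine ⟨3 * ∑ j, ∫ y, ‖((‖y.1‖⁻¹ : ℝ) : ℂ) * S.ρ y.1 * ((S.e y.2 y.1 j : ℝ) : ℂ)‖ ^ 2
    ∂photonMeasure, 3 * ∑ j, ∫ y, ‖S.g j y‖ ^ 2 ∂photonMeasure, ?_, ?_, fun Ψ h => ?_⟩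
  · exact mul_nonneg (by norm_num) (Finset.sum_nonneg fun j _ =>
      integral_nonneg fun y => by positivity)
  · exact mul_nonneg (by norm_num) (Finset.sum_nonneg fun j _ =>
      integral_nonneg fun y => by positivity)
  · refine (norm_sum_matAct_sq_le S _).trans ?_
    rw [mul_assoc, mul_assoc, ← mul_add, Finset.sum_mul, Finset.sum_mul, ← Finset.sum_add_distrib]
    gcongr with j
    rw [PiLp.norm_sq_eq_of_L2, PiLp.norm_sq_eq_of_L2 _ Ψ, re_inner_componentwise, Finset.mul_sum,
      Finset.mul_sum, ← Finset.sum_add_distrib]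
    gcongr with s
    exact norm_creation_sq_le (S.isWeighted_g j) ⟨Ψ s, h s⟩

/-- The single constant is the sum of all coefficients plus one. Being at least one, it is dominated
by its own square, which covers the coefficient of `‖Ψ‖²`. -/
theorem remainder_le {q w r K K' L ε N : ℝ} (hw : 0 ≤ w) (hr : 0 ≤ r) (hK : 0 ≤ K) (hK' : 0 ≤ K')
    (hL : 0 ≤ L) (hε : 0 ≤ ε) (hN : 0 ≤ N) :
    4 * q ^ 2 * (ε * w) + (ε + q ^ 2 * (N * r)) + q ^ 2 * (K * ε + (L * N + K' * ε))
      ≤ 2 * (4 * q ^ 2 * w + 1 + q ^ 2 * K + q ^ 2 * K' + q ^ 2 * r + q ^ 2 * L) * ε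
        + (4 * q ^ 2 * w + 1 + q ^ 2 * K + q ^ 2 * K' + q ^ 2 * r + q ^ 2 * L) ^ 2 * N := by
  have h1 : 0 ≤ 4 * q ^ 2 * w + q ^ 2 * K + q ^ 2 * K' := by positivity
  have h2 : 0 ≤ q ^ 2 * r + q ^ 2 * L := by positivity
  have h3 : 4 * q ^ 2 * w + 1 + q ^ 2 * K + q ^ 2 * K' + q ^ 2 * r + q ^ 2 * L
      = (4 * q ^ 2 * w + q ^ 2 * K + q ^ 2 * K') + (q ^ 2 * r + q ^ 2 * L) + 1 := by ring
  rw [h3]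
  have h4 : 4 * q ^ 2 * (ε * w) + (ε + q ^ 2 * (N * r)) + q ^ 2 * (K * ε + (L * N + K' * ε))
      = (4 * q ^ 2 * w + q ^ 2 * K + q ^ 2 * K' + 1) * ε + (q ^ 2 * r + q ^ 2 * L) * N := by ring
  rw [h4]
  generalize 4 * q ^ 2 * w + q ^ 2 * K + q ^ 2 * K' = a at *
  generalize q ^ 2 * r + q ^ 2 * L = b at *
  gcongr <;> nlinarith

/-- `α · dΓ(k) + q α · A` is relatively bounded with respect to `dΓ(|k|)` with bound one, with
remainder controlled by the form of `dΓ(|k|)`. -/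
theorem Model.exists_norm_sq_le (q : ℝ) : ∃ C : ℝ, 0 < C ∧
    ∀ (Ψ : SpinFock) (h : ∀ s, Ψ s ∈ (dGamma photonEnergy).domain),
      ‖S.momentumTerm Ψ h + ((q / Real.sqrt 2 : ℝ) : ℂ)
          • (S.annihilationTerm Ψ h + S.creationTerm Ψ h)‖ ^ 2
        ≤ ‖componentwise (dGamma photonEnergy) Ψ h‖ ^ 2
          + 2 * C * (inner ℂ (componentwise (dGamma photonEnergy) Ψ h) Ψ).re + C ^ 2 * ‖Ψ‖ ^ 2 := by
  obtain ⟨K, hK, h1⟩ := S.exists_norm_annihilationTerm_sq_le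
  obtain ⟨K', L, hK', hL, h2⟩ := S.exists_norm_creationTerm_sq_le
  set w := ∫ y, (‖y.1‖⁻¹ * ‖S.ρ y.1‖) ^ 2 ∂photonMeasure with hw
  set r := ∫ y, ‖S.ρ y.1‖ ^ 2 ∂photonMeasure with hr
  have hw0 : 0 ≤ w := integral_nonneg fun y => by positivity
  have hr0 : 0 ≤ r := integral_nonneg fun y => by positivity
  refine ⟨4 * q ^ 2 * w + 1 + q ^ 2 * K + q ^ 2 * K' + q ^ 2 * r + q ^ 2 * L, by positivity,
    fun Ψ h => ?_⟩
  set C := 4 * q ^ 2 * w + 1 + q ^ 2 * K + q ^ 2 * K' + q ^ 2 * r + q ^ 2 * L with hC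
  set ε := (inner ℂ (componentwise (dGamma photonEnergy) Ψ h) Ψ).re with hε
  have hε0 : 0 ≤ ε := by
    rw [hε, re_inner_componentwise]
    exact Finset.sum_nonneg fun s _ => dGamma_nonneg photonEnergy_nonneg _
  have h3 := S.coupling_form_le h q
  have h4 := h1 Ψ h
  have h5 := h2 Ψ h
  set X := S.momentumTerm Ψ h
  set Y := S.annihilationTerm Ψ h
  set Z := S.creationTerm Ψ h
  have h6 : ‖Y + Z‖ ^ 2 ≤ 2 * ‖Y‖ ^ 2 + 2 * ‖Z‖ ^ 2 := by
    have := pow_le_pow_left₀ (norm_nonneg _) (norm_add_le Y Z) 2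
    nlinarith [sq_nonneg (‖Y‖ - ‖Z‖)]
  have h2s : Real.sqrt 2 ^ 2 = 2 := Real.sq_sqrt zero_le_two
  have hs0 : Real.sqrt 2 ≠ 0 := by positivity
  -- The cross term carries `2q/√2 = √2 q`. The `‖X‖²` appearing here cancels against the `-‖X‖²` of
  -- the defect in `Model.coupling_form_le`, leaving exactly one square of `dΓ(|k|)`.
  have h7 : ‖X + ((q / Real.sqrt 2 : ℝ) : ℂ) • (Y + Z)‖ ^ 2
      = ‖X‖ ^ 2 + Real.sqrt 2 * q * (inner ℂ X (Y + Z)).re + q ^ 2 / 2 * ‖Y + Z‖ ^ 2 := by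
    rw [norm_add_sq (𝕜 := ℂ), inner_smul_right, norm_smul, Complex.norm_real, mul_pow,
      Real.norm_eq_abs, sq_abs, div_pow, h2s]
    simp only [RCLike.re_to_complex, Complex.re_ofReal_mul]
    field_simp
    linear_combination (-2 * q * (inner ℂ X (Y + Z)).re) * h2s
  rw [h7]
  have h8 : q ^ 2 / 2 * ‖Y + Z‖ ^ 2 ≤ q ^ 2 * (K * ε + (L * ‖Ψ‖ ^ 2 + K' * ε)) := by
    have : q ^ 2 / 2 * ‖Y + Z‖ ^ 2 ≤ q ^ 2 / 2 * (2 * (K * ε) + 2 * (L * ‖Ψ‖ ^ 2 + K' * ε)) := by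
      gcongr
      linarith
    linarith
  have hN := sq_nonneg ‖Ψ‖
  have hX := remainder_le (q := q) hw0 hr0 hK hK' hL hε0 hN
  rw [← hC] at hX
  linarith

end DiracPolaron

namespace DiracPolaron

/-! ### Bounded perturbations -/

section Abstract

variable {E : Type*} [NormedAddCommGroup E] [InnerProductSpace ℂ E] {D : Submodule ℂ E}

/-- For `φ` orthogonal to the perturbed range, `⟨φ,(L + s)x⟩ = -⟨φ,Vx⟩`, while `s‖x‖ ≤ ‖(L + s)x‖`
by positivity. On the dense range of `L + s`, and so everywhere, `⟨φ,·⟩` is bounded by `(v/s)‖φ‖`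
with `v/s < 1`, which forces `φ = 0`. -/
theorem denseRange_add_of_bounded [CompleteSpace E] {L V : D →ₗ[ℂ] E} {v s : ℝ}
    (hpos : ∀ x : D, 0 ≤ (inner ℂ (L x) (x : E)).re) (hv : 0 ≤ v)
    (hV : ∀ x : D, ‖V x‖ ≤ v * ‖(x : E)‖) (hvs : v < s)
    (hL : DenseRange fun x : D => L x + (s : ℂ) • (x : E)) :
    DenseRange fun x : D => L x + V x + (s : ℂ) • (x : E) := by
  have hs : 0 < s := hv.trans_lt hvs
  let R : D →ₗ[ℂ] E := L + V + (s : ℂ) • D.subtype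
  have hR : ∀ x : D, R x = L x + V x + (s : ℂ) • (x : E) := fun x => rfl
  have hmain : (LinearMap.range R)ᗮ = ⊥ := by
    rw [Submodule.eq_bot_iff]
    intro φ hφ
    have h1 : ∀ x : D, ‖inner ℂ φ (L x + (s : ℂ) • (x : E))‖
        ≤ v / s * ‖φ‖ * ‖L x + (s : ℂ) • (x : E)‖ := by
      intro x
      have h2 := (Submodule.mem_orthogonal' _ _).1 hφ (R x) ⟨x, rfl⟩
      have h3 : L x + (s : ℂ) • (x : E) = R x - V x := by rw [hR]; abel
      have h4 : s * ‖(x : E)‖ ≤ ‖L x + (s : ℂ) • (x : E)‖ := by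
        have := mul_norm_le_norm_sub (γ := 0) (x := -s) (x : E) (L x) (by simpa using hpos x)
        simpa using this
      calc ‖inner ℂ φ (L x + (s : ℂ) • (x : E))‖ = ‖inner ℂ φ (V x)‖ := by
            rw [h3, inner_sub_right, h2, zero_sub, norm_neg]
        _ ≤ ‖φ‖ * (v * ‖(x : E)‖) := (norm_inner_le_norm _ _).trans (by gcongr; exact hV x)
        _ = v / s * ‖φ‖ * (s * ‖(x : E)‖) := by field_simp
        _ ≤ _ := by gcongr
    have h5 : ‖inner ℂ φ φ‖ ≤ v / s * ‖φ‖ * ‖φ‖ := by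
      have hcl : IsClosed {y : E | ‖inner ℂ φ y‖ ≤ v / s * ‖φ‖ * ‖y‖} :=
        isClosed_le (by fun_prop) (by fun_prop)
      refine closure_minimal ?_ hcl (hL φ)
      rintro _ ⟨x, rfl⟩
      exact h1 x
    have h6 : ‖inner ℂ φ φ‖ = ‖φ‖ ^ 2 := by
      rw [inner_self_eq_norm_sq_to_K]
      simp
    rw [h6] at h5
    have h7 : v / s < 1 := (div_lt_one hs).2 hvs
    by_contra h0
    have : 0 < ‖φ‖ := norm_pos_iff.2 h0
    nlinarith [mul_pos this this]
  rw [← Submodule.topologicalClosure_eq_top_iff] at hmain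
  have h7 : Dense ((LinearMap.range R : Submodule ℂ E) : Set E) :=
    Submodule.dense_iff_topologicalClosure_eq_top.2 hmain
  exact h7

theorem dense_of_surjective [CompleteSpace E] {A : D →ₗ[ℂ] E}
    (hsurj : Function.Surjective A) {c : ℝ} (hc : 0 < c)
    (hpos : ∀ x : D, c * ‖(x : E)‖ ^ 2 ≤ (inner ℂ (A x) (x : E)).re) : Dense (D : Set E) := by
  rw [Submodule.dense_iff_topologicalClosure_eq_top, Submodule.topologicalClosure_eq_top_iff,
    Submodule.eq_bot_iff]
  intro φ hφ
  obtain ⟨x, rfl⟩ := hsurj φ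
  have h1 := hpos x
  rw [(Submodule.mem_orthogonal' _ _).1 hφ x x.2, Complex.zero_re] at h1
  have h2 : ‖(x : E)‖ = 0 := by
    by_contra h
    have : 0 < ‖(x : E)‖ ^ 2 := by positivity
    nlinarith
  have h3 : x = 0 := Subtype.ext (norm_eq_zero.1 h2)
  rw [h3, map_zero]

theorem re_inner_add_smul (x y : E) (c : ℝ) :
    (inner ℂ (x + (c : ℂ) • y) y).re = (inner ℂ x y).re + c * ‖y‖ ^ 2 := by
  rw [inner_add_left, inner_smul_left, Complex.conj_ofReal, Complex.add_re, Complex.re_ofReal_mul,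
    re_inner_self_eq]

theorem norm_add_smul_sq (x y : E) (c : ℝ) :
    ‖x + (c : ℂ) • y‖ ^ 2 = ‖x‖ ^ 2 + 2 * c * (inner ℂ x y).re + c ^ 2 * ‖y‖ ^ 2 := by
  rw [norm_add_sq (𝕜 := ℂ), inner_smul_right, norm_smul, Complex.norm_real, mul_pow,
    Real.norm_eq_abs, sq_abs]
  simp only [RCLike.re_to_complex, Complex.re_ofReal_mul]
  ring

/-- The operator `V + K - P - q F` with domain `D`. -/
def combinedOp (V K P F : D →ₗ[ℂ] E) (q : ℝ) : E →ₗ.[ℂ] E := ⟨D, V + K - P - (q : ℂ) • F⟩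

theorem combinedOp_apply (V K P F : D →ₗ[ℂ] E) (q : ℝ) (x : D) :
    combinedOp V K P F q x = V x + K x - P x - (q : ℂ) • F x := rfl

/-! ### Semiboundedness, dense range and concavity for `V + K - P - qF` -/

section Combined

variable {V V' V'' K P F : D →ₗ[ℂ] E} {q q' v C : ℝ}

theorem combinedOp_symm (hVs : ∀ x y : D, inner ℂ (V x) (y : E) = inner ℂ (x : E) (V y))
    (hKs : ∀ x y : D, inner ℂ (K x) (y : E) = inner ℂ (x : E) (K y))
    (hPs : ∀ x y : D, inner ℂ (P x) (y : E) = inner ℂ (x : E) (P y))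
    (hFs : ∀ x y : D, inner ℂ (F x) (y : E) = inner ℂ (x : E) (F y))
    (x y : D) :
    inner ℂ (combinedOp V K P F q x) (y : E) = inner ℂ (x : E) (combinedOp V K P F q y) := by
  rw [combinedOp_apply, combinedOp_apply]
  simp only [inner_sub_left, inner_add_left, inner_smul_left, inner_sub_right, inner_add_right,
    inner_smul_right, Complex.conj_ofReal, hVs, hKs, hPs, hFs]

theorem dense_of_surjective_add [CompleteSpace E] (hK0 : ∀ x : D, 0 ≤ (inner ℂ (K x) (x : E)).re)
    (hKsurj : ∀ c : ℝ, 0 < c → ∀ y, ∃ x : D, K x + (c : ℂ) • (x : E) = y) :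
    Dense (D : Set E) := by
  refine dense_of_surjective (A := K + ((1 : ℝ) : ℂ) • D.subtype) (hKsurj 1 one_pos) one_pos
    fun x => ?_
  have := re_inner_add_smul (K x) (x : E) 1
  rw [LinearMap.add_apply, LinearMap.smul_apply, Submodule.subtype_apply, this]
  linarith [hK0 x]

/-- A relative bound with constant one in the sense of operator squares yields semiboundedness and
essential self-adjointness. -/
theorem bddBelow_and_denseRange_combinedOp [CompleteSpace E]
    (hKs : ∀ x y : D, inner ℂ (K x) (y : E) = inner ℂ (x : E) (K y))
    (hPs : ∀ x y : D, inner ℂ (P x) (y : E) = inner ℂ (x : E) (P y))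
    (hFs : ∀ x y : D, inner ℂ (F x) (y : E) = inner ℂ (x : E) (F y))
    (hv : 0 ≤ v) (hV : ∀ x : D, ‖V x‖ ≤ v * ‖(x : E)‖)
    (hK0 : ∀ x : D, 0 ≤ (inner ℂ (K x) (x : E)).re)
    (hKsurj : ∀ c : ℝ, 0 < c → ∀ y, ∃ x : D, K x + (c : ℂ) • (x : E) = y) (hC : 0 < C)
    (hrel : ∀ x : D, ‖P x + (q : ℂ) • F x‖ ^ 2
      ≤ ‖K x‖ ^ 2 + 2 * C * (inner ℂ (K x) (x : E)).re + C ^ 2 * ‖(x : E)‖ ^ 2) :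
    BddBelow (formValues (combinedOp V K P F q)) ∧ ∃ x₀ : ℝ, ∀ x < x₀,
      DenseRange fun u : (combinedOp V K P F q).domain =>
        combinedOp V K P F q u - (x : ℂ) • (u : E) := by
  -- The right side of `hrel` is `‖(K + C)x‖²`, so the hypothesis says precisely that `B` is
  -- dominated by `A` in norm.
  set A : D →ₗ[ℂ] E := K + (C : ℂ) • D.subtype with hAdef
  set B : D →ₗ[ℂ] E := -P - (q : ℂ) • F with hBdef
  have hAx : ∀ x : D, A x = K x + (C : ℂ) • (x : E) := fun x => rfl
  have hBx : ∀ x : D, B x = -P x - (q : ℂ) • F x := fun x => rfl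
  have hA : ∀ x y : D, inner ℂ (A x) (y : E) = inner ℂ (x : E) (A y) := fun x y => by
    simp only [hAx, inner_add_left, inner_add_right, inner_smul_left, inner_smul_right,
      Complex.conj_ofReal, hKs]
  have hB : ∀ x y : D, inner ℂ (B x) (y : E) = inner ℂ (x : E) (B y) := fun x y => by
    simp only [hBx, inner_sub_left, inner_sub_right, inner_neg_left, inner_neg_right,
      inner_smul_left, inner_smul_right, Complex.conj_ofReal, hPs, hFs]
  have hpos : ∀ x : D, C * ‖(x : E)‖ ^ 2 ≤ (inner ℂ (A x) (x : E)).re := fun x => by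
    rw [hAx, re_inner_add_smul]
    linarith [hK0 x]
  have hsurj : ∀ s : ℝ, 0 ≤ s → ∀ y, ∃ x : D, A x + (s : ℂ) • (x : E) = y := by
    intro s hs y
    obtain ⟨x, hx⟩ := hKsurj (C + s) (by linarith) y
    refine ⟨x, ?_⟩
    rw [← hx, hAx]
    push_cast
    module
  have hsurjA : Function.Surjective A := hKsurj C hC
  have hBA : ∀ x : D, ‖B x‖ ≤ ‖A x‖ := fun x => by
    refine (sq_le_sq₀ (norm_nonneg _) (norm_nonneg _)).1 ?_
    have h1 : B x = -(P x + (q : ℂ) • F x) := by rw [hBx]; abel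
    rw [hAx, norm_add_smul_sq, h1, norm_neg]
    exact hrel x
  have hform : ∀ x : D, 0 ≤ (inner ℂ ((A + B) x) (x : E)).re := by
    intro x
    have := abs_re_inner_le_of_norm_le hA hB hsurjA hC hpos hBA x
    rw [LinearMap.add_apply, inner_add_left, Complex.add_re]
    linarith [(abs_le.1 this).1]
  have hsplit : ∀ x : D, combinedOp V K P F q x = (A + B) x + V x + ((-C : ℝ) : ℂ) • (x : E) := by
    intro x
    rw [combinedOp_apply, LinearMap.add_apply, hAx, hBx]
    push_cast
    module
  constructor
  · refine ⟨-v - C, ?_⟩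
    rintro _ ⟨x, hx, rfl⟩
    rw [hsplit x, re_inner_add_smul, inner_add_left, Complex.add_re, hx]
    have h1 := hV x
    have h2 := (Complex.abs_re_le_norm _).trans (norm_inner_le_norm (𝕜 := ℂ) (V x) (x : E))
    rw [hx, mul_one] at h1 h2
    have h3 := (abs_le.1 (h2.trans h1)).1
    have h4 := hform x
    linarith
  -- Below this threshold the shift `s = -C - x` exceeds `v`: it is positive, as Wüst's theorem
  -- requires, and beats the bounded perturbation `V`.
  · refine ⟨-C - v, fun x hx => ?_⟩
    have hd := denseRange_of_norm_le hA hB (dense_of_surjective_add hK0 hKsurj) hsurj hC hpos hBA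
      (s := -C - x) (by linarith)
    have hd' := denseRange_add_of_bounded (L := A + B) (s := -C - x) hform hv hV (by linarith) hd
    have he : ∀ u : D, combinedOp V K P F q u - (x : ℂ) • (u : E)
        = (A + B) u + V u + ((-C - x : ℝ) : ℂ) • (u : E) := by
      intro u
      rw [hsplit u]
      push_cast
      module
    exact (funext he : (fun u : D => combinedOp V K P F q u - (x : ℂ) • (u : E)) = _) ▸ hd'

/-- On the common domain the expectation value at a fixed vector is the same convex combination of
the two expectation values, and each of these is at least its own infimum. -/
theorem convexCombination_sInf_le [Nontrivial E] (hdense : Dense (D : Set E)) {a b : ℝ}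
    (ha : 0 ≤ a) (hb : 0 ≤ b) (hab : a + b = 1)
    (hV : ∀ x, V'' x = (a : ℂ) • V x + (b : ℂ) • V' x)
    (hbdd : BddBelow (formValues (combinedOp V K P F q)))
    (hbdd' : BddBelow (formValues (combinedOp V' K P F q'))) :
    a * sInf (formValues (combinedOp V K P F q)) + b * sInf (formValues (combinedOp V' K P F q'))
      ≤ sInf (formValues (combinedOp V'' K P F (a * q + b * q'))) := by
  refine le_csInf (formValues_nonempty hdense) ?_
  rintro _ ⟨(x : D), hx, rfl⟩
  have h1 := csInf_le hbdd ⟨x, hx, rfl⟩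
  have h2 := csInf_le hbdd' ⟨x, hx, rfl⟩
  have h3 : combinedOp V'' K P F (a * q + b * q') x
      = (a : ℂ) • combinedOp V K P F q x + (b : ℂ) • combinedOp V' K P F q' x := by
    obtain rfl : b = 1 - a := by linarith
    rw [combinedOp_apply, combinedOp_apply, combinedOp_apply, hV]
    push_cast
    module
  rw [h3, inner_add_left, inner_smul_left, inner_smul_left, Complex.conj_ofReal,
    Complex.conj_ofReal, Complex.add_re, Complex.re_ofReal_mul, Complex.re_ofReal_mul]
  gcongr

end Combined

end Abstract

/-! ### Comparison of second quantizations -/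

theorem norm_sq_dGamma_le {w w' : Photon → ℝ}
    (h : ∀ n (x : Fin n → Photon), |sumOver w x| ≤ |sumOver w' x|) {ψ : Fock}
    (hψ : ψ ∈ (dGamma w).domain) (hψ' : ψ ∈ (dGamma w').domain) :
    ‖dGamma w ⟨ψ, hψ⟩‖ ^ 2 ≤ ‖dGamma w' ⟨ψ, hψ'⟩‖ ^ 2 := by
  refine hasSum_le (fun n => ?_) (hasSum_norm_sq_wave _) (hasSum_norm_sq_wave _)
  refine integral_mono_ae (integrable_norm_sq_wave _ n) (integrable_norm_sq_wave _ n) ?_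
  filter_upwards [wave_dGamma w ⟨ψ, hψ⟩ n, wave_dGamma w' ⟨ψ, hψ'⟩ n] with x h1 h2
  rw [h1, h2, norm_mul, norm_mul, Complex.norm_real, Complex.norm_real]
  gcongr
  exact h n x

theorem re_inner_dGamma_le {w w' : Photon → ℝ}
    (h : ∀ n (x : Fin n → Photon), sumOver w x ≤ sumOver w' x) {ψ : Fock}
    (hψ : ψ ∈ (dGamma w).domain) (hψ' : ψ ∈ (dGamma w').domain) :
    (inner ℂ (dGamma w ⟨ψ, hψ⟩) ψ).re ≤ (inner ℂ (dGamma w' ⟨ψ, hψ'⟩) ψ).re := by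
  refine hasSum_le (fun n => ?_) (hasSum_re_inner_dGamma w ⟨ψ, hψ⟩)
    (hasSum_re_inner_dGamma w' ⟨ψ, hψ'⟩)
  refine integral_mono (integrable_sumOver_mul _ n) (integrable_sumOver_mul _ n) fun x => ?_
  exact mul_le_mul_of_nonneg_right (h n x) (by positivity)

/-! ### Nontriviality of Fock space -/

/-- The vacuum: the measure on configurations of no photons is a unit mass at one point, so the
constant `1` there is a nonzero vector. -/
theorem exists_fock_ne_zero : ∃ φ : Fock, φ ≠ 0 := by
  have hmem : ∀ n, MemLp (fun _ : Fin n → Photon => if n = 0 then (1 : ℂ) else 0) 2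
      (configMeasure n) := by
    intro n
    rcases n with _ | n
    · have : IsFiniteMeasure (configMeasure 0) := by
        rw [configMeasure, Measure.pi_of_empty]
        infer_instance
      exact memLp_const _
    · simp
  have hsum : Summable fun n : ℕ => ∫ _x, ‖(if n = 0 then (1 : ℂ) else 0)‖ ^ 2 ∂configMeasure n :=
    summable_of_ne_finset_zero (s := {0}) fun n hn => by
      rw [Finset.mem_singleton] at hn
      simp [hn]
  obtain ⟨φ, hφ⟩ := exists_fock_of_summable
    (fun n _ => if n = 0 then (1 : ℂ) else 0) hmem (fun n s => Filter.EventuallyEq.rfl) hsum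
  refine ⟨φ, fun h0 => ?_⟩
  have h1 := hφ 0
  rw [h0] at h1
  have h2 : ∀ᵐ x ∂configMeasure 0, False := by
    filter_upwards [h1, wave_zero 0] with x hx hx'
    rw [hx'] at hx
    simp at hx
  rw [configMeasure, Measure.pi_of_empty] at h2
  simp at h2

instance : Nontrivial SpinFock := by
  obtain ⟨φ, hφ⟩ := exists_fock_ne_zero
  refine ⟨WithLp.toLp 2 fun _ => φ, 0, fun h => hφ ?_⟩
  exact congrFun (congrArg WithLp.ofLp h) 0

end DiracPolaron

namespace DiracPolaron

/-! ### The fibre Hamiltonian -/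

/-- The one-photon energy `ω_m`. -/
def massiveEnergy (m : ℝ) (x : Photon) : ℝ := (1 + m) * ‖x.1‖ + m

theorem measurable_massiveEnergy (m : ℝ) : Measurable (massiveEnergy m) :=
  (measurable_photonEnergy.const_mul (1 + m)).add_const m

theorem photonEnergy_le_massiveEnergy {m : ℝ} (hm : 0 ≤ m) (x : Photon) :
    photonEnergy x ≤ massiveEnergy m x := by
  unfold photonEnergy massiveEnergy
  nlinarith [norm_nonneg x.1]

theorem massiveEnergy_nonneg {m : ℝ} (hm : 0 ≤ m) (x : Photon) : 0 ≤ massiveEnergy m x :=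
  (photonEnergy_nonneg x).trans (photonEnergy_le_massiveEnergy hm x)

theorem sumOver_photonEnergy_le {m : ℝ} (hm : 0 ≤ m) (n : ℕ) (x : Fin n → Photon) :
    sumOver photonEnergy x ≤ sumOver (massiveEnergy m) x :=
  Finset.sum_le_sum fun i _ => photonEnergy_le_massiveEnergy hm (x i)

theorem abs_sumOver_photonEnergy_le {m : ℝ} (hm : 0 ≤ m) (n : ℕ) (x : Fin n → Photon) :
    |sumOver photonEnergy x| ≤ |sumOver (massiveEnergy m) x| := by
  rw [abs_of_nonneg (sumOver_photonEnergy_nonneg x)]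
  exact (sumOver_photonEnergy_le hm n x).trans (le_abs_self _)

theorem inner_matAct_of_symm {F : Type*} [NormedAddCommGroup F] [InnerProductSpace ℂ F]
    {B : Matrix (Fin 4) (Fin 4) ℂ} (hB : B.IsHermitian) {v v' w w' : PiLp 2 (fun _ : Fin 4 => F)}
    (h : ∀ s s', inner ℂ (v' s) (w s') = inner ℂ (v s) (w' s')) :
    inner ℂ (matAct B v') w = inner ℂ v (matAct B w') := by
  rw [inner_matAct_left hB]
  simp only [PiLp.inner_apply, matAct_apply, inner_sum, inner_smul_right, h]

theorem inner_sum_matAct_of_symm {F : Type*} [NormedAddCommGroup F] [InnerProductSpace ℂ F]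
    {B : Fin 3 → Matrix (Fin 4) (Fin 4) ℂ} (hB : ∀ j, (B j).IsHermitian)
    {v w : PiLp 2 (fun _ : Fin 4 => F)} {v' w' : Fin 3 → PiLp 2 (fun _ : Fin 4 => F)}
    (h : ∀ j s s', inner ℂ (v' j s) (w s') = inner ℂ (v s) (w' j s')) :
    inner ℂ (∑ j, matAct (B j) (v' j)) w = inner ℂ v (∑ j, matAct (B j) (w' j)) := by
  rw [sum_inner, inner_sum]
  exact Finset.sum_congr rfl fun j _ => inner_matAct_of_symm (hB j) (h j)

theorem sum_matAct_add {F : Type*} [NormedAddCommGroup F] [InnerProductSpace ℂ F]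
    {B : Fin 3 → Matrix (Fin 4) (Fin 4) ℂ} {v w u : Fin 3 → PiLp 2 (fun _ : Fin 4 => F)}
    (h : ∀ j s, u j s = v j s + w j s) :
    ∑ j, matAct (B j) (u j) = ∑ j, matAct (B j) (v j) + ∑ j, matAct (B j) (w j) := by
  rw [← Finset.sum_add_distrib]
  refine Finset.sum_congr rfl fun j _ => ?_
  rw [← map_add]
  congr 1
  ext s
  exact h j s

theorem sum_matAct_smul {F : Type*} [NormedAddCommGroup F] [InnerProductSpace ℂ F]
    {B : Fin 3 → Matrix (Fin 4) (Fin 4) ℂ} {c : ℂ} {v u : Fin 3 → PiLp 2 (fun _ : Fin 4 => F)}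
    (h : ∀ j s, u j s = c • v j s) :
    ∑ j, matAct (B j) (u j) = c • ∑ j, matAct (B j) (v j) := by
  rw [Finset.smul_sum]
  refine Finset.sum_congr rfl fun j _ => ?_
  rw [← map_smul]
  congr 1
  ext s
  exact h j s

theorem matAct_add_smul_add {F : Type*} [NormedAddCommGroup F] [InnerProductSpace ℂ F]
    (B C : Matrix (Fin 4) (Fin 4) ℂ) (c : ℂ) (v w : PiLp 2 (fun _ : Fin 4 => F)) :
    matAct B (v + w) + c • matAct C (v + w)
      = (matAct B v + c • matAct C v) + (matAct B w + c • matAct C w) := by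
  rw [map_add, map_add]
  module

theorem matAct_add_smul_smul {F : Type*} [NormedAddCommGroup F] [InnerProductSpace ℂ F]
    (B C : Matrix (Fin 4) (Fin 4) ℂ) (c d : ℂ) (v : PiLp 2 (fun _ : Fin 4 => F)) :
    matAct B (d • v) + c • matAct C (d • v) = d • (matAct B v + c • matAct C v) := by
  rw [map_smul, map_smul]
  module

/-- Linear subspaces of a Hilbert space. -/
abbrev HilbertSubspace (E : Type*) [NormedAddCommGroup E] [InnerProductSpace ℂ E] : Type _ :=
  Submodule ℂ E

/-- Linear maps from a subspace of a Hilbert space to the space. -/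
abbrev HilbertMap {E : Type*} [NormedAddCommGroup E] [InnerProductSpace ℂ E]
    (D : HilbertSubspace E) : Type _ := D →ₗ[ℂ] E

/-- The domain of the fibre Hamiltonian. -/
def fibreDomain (m : ℝ) : HilbertSubspace SpinFock where
  carrier := {Ψ | ∀ s, Ψ s ∈ (dGamma (massiveEnergy m)).domain}
  zero_mem' := fun _ => (dGamma (massiveEnergy m)).domain.zero_mem
  add_mem' := fun ha hb s => (dGamma (massiveEnergy m)).domain.add_mem (ha s) (hb s)
  smul_mem' := fun c _ ha s => (dGamma (massiveEnergy m)).domain.smul_mem c (ha s)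

variable (S : Model) {m : ℝ}

theorem mem_massive_of_fibreDomain (Ψ : fibreDomain m) (s : Fin 4) :
    (Ψ : SpinFock) s ∈ (dGamma (massiveEnergy m)).domain := Ψ.2 s

theorem mem_dGamma_of_fibreDomain (hm : 0 ≤ m) (Ψ : fibreDomain m) (s : Fin 4) :
    (Ψ : SpinFock) s ∈ (dGamma photonEnergy).domain :=
  dGamma_domain_le measurable_photonEnergy (abs_sumOver_photonEnergy_le hm)
    (mem_massive_of_fibreDomain Ψ s)

theorem mem_Prad_of_fibreDomain (hm : 0 ≤ m) (j : Fin 3) (Ψ : fibreDomain m) (s : Fin 4) :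
    (Ψ : SpinFock) s ∈ (Prad j).domain := mem_Prad_domain (mem_dGamma_of_fibreDomain hm Ψ s) j

theorem mem_A_of_fibreDomain (hm : 0 ≤ m) (j : Fin 3) (Ψ : fibreDomain m) (s : Fin 4) :
    (Ψ : SpinFock) s ∈ (S.A j).domain :=
  (fieldOperator_eq (S.isWeighted_g j) ⟨_, mem_dGamma_of_fibreDomain hm Ψ s⟩).1

/-- The free photon Hamiltonian on the common domain. -/
def kineticMap (m : ℝ) : HilbertMap (fibreDomain m) where
  toFun Ψ := componentwise (dGamma (massiveEnergy m)) Ψ (mem_massive_of_fibreDomain Ψ)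
  map_add' Ψ Φ := by
    ext1 s
    exact (dGamma (massiveEnergy m)).map_add ⟨_, mem_massive_of_fibreDomain Ψ s⟩
      ⟨_, mem_massive_of_fibreDomain Φ s⟩
  map_smul' c Ψ := by
    ext1 s
    exact (dGamma (massiveEnergy m)).map_smul c ⟨_, mem_massive_of_fibreDomain Ψ s⟩

/-- `α · dΓ(k)` on the common domain. -/
def Model.momentumMap (hm : 0 ≤ m) : HilbertMap (fibreDomain m) where
  toFun Ψ := ∑ j, matAct (S.α j) (componentwise (Prad j) Ψ (mem_Prad_of_fibreDomain hm j Ψ))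
  map_add' Ψ Φ := sum_matAct_add fun j s => (Prad j).map_add ⟨_, mem_Prad_of_fibreDomain hm j Ψ s⟩
    ⟨_, mem_Prad_of_fibreDomain hm j Φ s⟩
  map_smul' c Ψ := sum_matAct_smul fun j s =>
    (Prad j).map_smul c ⟨_, mem_Prad_of_fibreDomain hm j Ψ s⟩

/-- `α · A` on the common domain. -/
def Model.fieldMap (hm : 0 ≤ m) : HilbertMap (fibreDomain m) where
  toFun Ψ := ∑ j, matAct (S.α j) (componentwise (S.A j) Ψ (mem_A_of_fibreDomain S hm j Ψ))
  map_add' Ψ Φ := sum_matAct_add fun j s => (S.A j).map_add ⟨_, mem_A_of_fibreDomain S hm j Ψ s⟩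
    ⟨_, mem_A_of_fibreDomain S hm j Φ s⟩
  map_smul' c Ψ := sum_matAct_smul fun j s =>
    (S.A j).map_smul c ⟨_, mem_A_of_fibreDomain S hm j Ψ s⟩

/-- The matrix part `α · p + M β`. -/
def Model.matrixMap (m : ℝ) (p : R3) (M : ℝ) : HilbertMap (fibreDomain m) where
  toFun Ψ := matAct (S.slash p) (Ψ : SpinFock) + (M : ℂ) • matAct S.β (Ψ : SpinFock)
  map_add' _ _ := matAct_add_smul_add _ _ _ _ _
  map_smul' _ _ := matAct_add_smul_smul _ _ _ _ _

/-! ### Graphs of sums of partially defined operators -/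

section Graph

variable {E : Type*} [NormedAddCommGroup E] [InnerProductSpace ℂ E] {f g : E →ₗ.[ℂ] E} {x y z : E}

theorem add_mem_graph (hf : (x, y) ∈ f.graph) (hg : (x, z) ∈ g.graph) :
    (x, y + z) ∈ (f + g).graph := by
  rw [LinearPMap.mem_graph_iff] at *
  obtain ⟨⟨u, hu⟩, rfl, rfl⟩ := hf
  obtain ⟨⟨v, hv⟩, huv, rfl⟩ := hg
  obtain rfl : v = u := huv
  exact ⟨⟨v, hu, hv⟩, rfl, rfl⟩

theorem sub_mem_graph (hf : (x, y) ∈ f.graph) (hg : (x, z) ∈ g.graph) :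
    (x, y - z) ∈ (f - g).graph := by
  rw [LinearPMap.mem_graph_iff] at *
  obtain ⟨⟨u, hu⟩, rfl, rfl⟩ := hf
  obtain ⟨⟨v, hv⟩, huv, rfl⟩ := hg
  obtain rfl : v = u := huv
  exact ⟨⟨v, hu, hv⟩, rfl, rfl⟩

theorem smul_mem_graph (c : ℂ) (hf : (x, y) ∈ f.graph) : (x, c • y) ∈ (c • f).graph := by
  rw [LinearPMap.mem_graph_iff] at *
  obtain ⟨u, rfl, rfl⟩ := hf
  exact ⟨u, rfl, rfl⟩

theorem sum_mem_graph {T : Fin 3 → E →ₗ.[ℂ] E} {y : Fin 3 → E} (h : ∀ j, (x, y j) ∈ (T j).graph) :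
    (x, ∑ j, y j) ∈ (∑ j, T j).graph := by
  rw [Fin.sum_univ_three, Fin.sum_univ_three]
  exact add_mem_graph (add_mem_graph (h 0) (h 1)) (h 2)

end Graph

/-- Every summand is defined on the domain of `dΓ(ω_m)`. Working with graphs avoids unfolding the
nested intersection of domains. -/
theorem Model.mem_H_graph (hm : 0 ≤ m) (p : R3) (M q : ℝ) (Ψ : fibreDomain m) :
    ((Ψ : SpinFock), S.matrixMap m p M Ψ + kineticMap m Ψ - S.momentumMap hm Ψ
      - (q : ℂ) • S.fieldMap hm Ψ) ∈ (S.H m p M q).graph := by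
  have hid : ∀ B : Matrix (Fin 4) (Fin 4) ℂ,
      ((Ψ : SpinFock), matAct B (Ψ : SpinFock)) ∈ (tensorOp B idOp).graph := fun B =>
    (tensorOp B idOp).mem_graph ⟨Ψ, fun s => Submodule.mem_top⟩
  have h1 : S.matrixMap m p M Ψ
      = ∑ j, ((p j : ℝ) : ℂ) • matAct (S.α j) (Ψ : SpinFock)
        + (M : ℂ) • matAct S.β (Ψ : SpinFock) := by
    change matAct (S.slash p) (Ψ : SpinFock) + (M : ℂ) • matAct S.β (Ψ : SpinFock) = _
    simp only [Model.slash, matAct_sum_left, matAct_smul_left]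
  have h0 : ((Ψ : SpinFock), kineticMap m Ψ) ∈ (tensorOp 1 (Hf m)).graph := by
    have h := (tensorOp 1 (Hf m)).mem_graph ⟨Ψ, mem_massive_of_fibreDomain Ψ⟩
    have h' : tensorOp 1 (Hf m) ⟨Ψ, mem_massive_of_fibreDomain Ψ⟩ = kineticMap m Ψ :=
      matAct_one (componentwise (dGamma (massiveEnergy m)) Ψ (mem_massive_of_fibreDomain Ψ))
    rwa [h'] at h
  have h2 : ((Ψ : SpinFock), S.momentumMap hm Ψ) ∈ (∑ j, tensorOp (S.α j) (Prad j)).graph :=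
    sum_mem_graph fun j =>
      (tensorOp (S.α j) (Prad j)).mem_graph ⟨Ψ, mem_Prad_of_fibreDomain hm j Ψ⟩
  have h3 : ((Ψ : SpinFock), S.fieldMap hm Ψ) ∈ (∑ j, tensorOp (S.α j) (S.A j)).graph :=
    sum_mem_graph fun j =>
      (tensorOp (S.α j) (S.A j)).mem_graph ⟨Ψ, mem_A_of_fibreDomain S hm j Ψ⟩
  rw [h1]
  exact sub_mem_graph (sub_mem_graph (add_mem_graph (add_mem_graph
    (sum_mem_graph fun j => smul_mem_graph _ (hid (S.α j))) (smul_mem_graph _ (hid S.β))) h0) h2)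
    (smul_mem_graph _ h3)

/-- The fibre Hamiltonian is the combination of its summands on the common domain. -/
theorem Model.H_eq (hm : 0 ≤ m) (p : R3) (M q : ℝ) : S.H m p M q
    = combinedOp (S.matrixMap m p M) (kineticMap m) (S.momentumMap hm) (S.fieldMap hm) q := by
  have hgr : ∀ Ψ : fibreDomain m, ∃ h : (Ψ : SpinFock) ∈ (S.H m p M q).domain,
      S.H m p M q ⟨Ψ, h⟩ = S.matrixMap m p M Ψ + kineticMap m Ψ - S.momentumMap hm Ψ
      - (q : ℂ) • S.fieldMap hm Ψ := by
    intro Ψ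
    obtain ⟨⟨u, hu⟩, h1, h2⟩ := (LinearPMap.mem_graph_iff _).1 (S.mem_H_graph hm p M q Ψ)
    obtain rfl : u = Ψ := h1
    exact ⟨hu, h2⟩
  -- One inclusion reads off the `H_f` component of the intersection of domains; the other holds
  -- because the domain of `H_f` lies in the domains of all other summands.
  refine LinearPMap.ext (le_antisymm (fun Ψ h => h.1.1.2)
    fun Ψ h => (hgr ⟨Ψ, h⟩).1) fun Ψ h h' => ?_
  exact (hgr ⟨Ψ, h'⟩).2

end DiracPolaron

namespace DiracPolaron

/-! ### Properties of the summands -/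

section Matrices

variable {F : Type*} [NormedAddCommGroup F] [InnerProductSpace ℂ F]

theorem inner_matAct_add_smul (S : Model) (p : R3) (M : ℝ) (v w : PiLp 2 (fun _ : Fin 4 => F)) :
    inner ℂ (matAct (S.slash p) v + (M : ℂ) • matAct S.β v) w
      = inner ℂ v (matAct (S.slash p) w + (M : ℂ) • matAct S.β w) := by
  rw [inner_add_left, inner_add_right, inner_smul_left, inner_smul_right, Complex.conj_ofReal,
    inner_matAct_left (S.slash_isHermitian p), inner_matAct_left S.β_hermitian]

theorem norm_matAct_add_smul_le (S : Model) (p : R3) (M : ℝ) (v : PiLp 2 (fun _ : Fin 4 => F)) :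
    ‖matAct (S.slash p) v + (M : ℂ) • matAct S.β v‖ ≤ (‖p‖ + |M|) * ‖v‖ := by
  have h1 : ‖matAct S.β v‖ = ‖v‖ := by
    have h := norm_matAct_sq S.β_hermitian (c := 1) (by rw [S.β_sq]; simp) v
    rw [one_mul] at h
    exact (sq_eq_sq₀ (norm_nonneg _) (by positivity)).1 h
  refine (norm_add_le _ _).trans (le_of_eq ?_)
  rw [norm_smul, Complex.norm_real, S.norm_matAct_slash, h1, Real.norm_eq_abs, add_mul]

theorem matAct_convexCombination (S : Model) (p p' : R3) (M M' a b : ℝ)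
    (v : PiLp 2 (fun _ : Fin 4 => F)) :
    matAct (S.slash (a • p + b • p')) v + ((a * M + b * M' : ℝ) : ℂ) • matAct S.β v
      = (a : ℂ) • (matAct (S.slash p) v + (M : ℂ) • matAct S.β v)
        + (b : ℂ) • (matAct (S.slash p') v + (M' : ℂ) • matAct S.β v) := by
  have h : ∀ (c : ℝ) (u : R3), S.slash (c • u) = (c : ℂ) • S.slash u := by
    intro c u
    simp only [Model.slash, Finset.smul_sum, smul_smul, PiLp.smul_apply, smul_eq_mul,
      Complex.ofReal_mul]
  rw [S.slash_add, h, h, matAct_add_left, matAct_smul_left, matAct_smul_left]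
  push_cast
  module

theorem sum_matAct_smul_add {B : Fin 3 → Matrix (Fin 4) (Fin 4) ℂ} {c : ℂ}
    {u v w : Fin 3 → PiLp 2 (fun _ : Fin 4 => F)} (h : ∀ j s, u j s = c • (v j s + w j s)) :
    ∑ j, matAct (B j) (u j) = c • (∑ j, matAct (B j) (v j) + ∑ j, matAct (B j) (w j)) := by
  rw [← Finset.sum_add_distrib, Finset.smul_sum]
  refine Finset.sum_congr rfl fun j _ => ?_
  rw [← map_add, ← map_smul]
  congr 1
  ext s
  exact h j s

end Matrices

variable (S : Model) {m : ℝ} (hm : 0 ≤ m)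

theorem inner_kineticMap (Ψ Φ : fibreDomain m) :
    inner ℂ (kineticMap m Ψ) (Φ : SpinFock) = inner ℂ (Ψ : SpinFock) (kineticMap m Φ) := by
  rw [PiLp.inner_apply, PiLp.inner_apply]
  exact Finset.sum_congr rfl fun s _ => dGamma_symm (massiveEnergy m)
    ⟨_, mem_massive_of_fibreDomain Ψ s⟩ ⟨_, mem_massive_of_fibreDomain Φ s⟩

theorem re_inner_kineticMap_nonneg (hm : 0 ≤ m) (Ψ : fibreDomain m) :
    0 ≤ (inner ℂ (kineticMap m Ψ) (Ψ : SpinFock)).re := by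
  have h := re_inner_componentwise (massiveEnergy m) (mem_massive_of_fibreDomain Ψ)
  exact (Finset.sum_nonneg fun s _ => dGamma_nonneg (massiveEnergy_nonneg hm) _).trans_eq h.symm

theorem exists_kineticMap_add_eq (hm : 0 ≤ m) (c : ℝ) (hc : 0 < c) (Φ : SpinFock) :
    ∃ Ψ : fibreDomain m, kineticMap m Ψ + (c : ℂ) • (Ψ : SpinFock) = Φ := by
  choose ψ hψ using fun s => dGamma_add_surjective (measurable_massiveEnergy m)
    (massiveEnergy_nonneg hm) hc (Φ s)
  refine ⟨⟨WithLp.toLp 2 fun s => ψ s, fun s => (ψ s).2⟩, ?_⟩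
  ext1 s
  exact hψ s

theorem Model.inner_momentumMap (Ψ Φ : fibreDomain m) :
    inner ℂ (S.momentumMap hm Ψ) (Φ : SpinFock) = inner ℂ (Ψ : SpinFock) (S.momentumMap hm Φ) :=
  inner_sum_matAct_of_symm (F := Fock) (v := (Ψ : SpinFock)) (w := (Φ : SpinFock))
    (v' := fun j => componentwise (Prad j) Ψ (mem_Prad_of_fibreDomain hm j Ψ))
    (w' := fun j => componentwise (Prad j) Φ (mem_Prad_of_fibreDomain hm j Φ))
    S.α_hermitian fun j s s' => dGamma_symm (fun x => x.1 j)
      ⟨_, mem_Prad_of_fibreDomain hm j Ψ s⟩ ⟨_, mem_Prad_of_fibreDomain hm j Φ s'⟩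

theorem Model.A_apply (j : Fin 3) (ψ : (dGamma photonEnergy).domain)
    (h : (ψ : Fock) ∈ (S.A j).domain) : S.A j ⟨ψ, h⟩ = (Real.sqrt 2 : ℂ)⁻¹
      • (annihilation (S.g j) ⟨ψ, mem_annihilation_domain_of_dGamma (S.isWeighted_g j) ψ⟩
        + creation (S.g j) ⟨ψ, mem_creation_domain_of_dGamma (S.isWeighted_g j) ψ⟩) :=
  (fieldOperator_eq (S.isWeighted_g j) ψ).2

theorem Model.inner_A (j : Fin 3) (ψ φ : (dGamma photonEnergy).domain)
    (h : (ψ : Fock) ∈ (S.A j).domain) (h' : (φ : Fock) ∈ (S.A j).domain) :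
    inner ℂ (S.A j ⟨ψ, h⟩) (φ : Fock) = inner ℂ (ψ : Fock) (S.A j ⟨φ, h'⟩) := by
  rw [S.A_apply, S.A_apply, ← Complex.ofReal_inv, inner_smul_left, inner_smul_right,
    Complex.conj_ofReal, inner_annihilation_add_creation (S.isWeighted_g j)]

theorem Model.inner_fieldMap (Ψ Φ : fibreDomain m) :
    inner ℂ (S.fieldMap hm Ψ) (Φ : SpinFock) = inner ℂ (Ψ : SpinFock) (S.fieldMap hm Φ) :=
  inner_sum_matAct_of_symm (F := Fock) (v := (Ψ : SpinFock)) (w := (Φ : SpinFock))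
    (v' := fun j => componentwise (S.A j) Ψ (mem_A_of_fibreDomain S hm j Ψ))
    (w' := fun j => componentwise (S.A j) Φ (mem_A_of_fibreDomain S hm j Φ))
    S.α_hermitian fun j s s' => S.inner_A j ⟨_, mem_dGamma_of_fibreDomain hm Ψ s⟩
      ⟨_, mem_dGamma_of_fibreDomain hm Φ s'⟩ _ _

theorem Model.fieldMap_apply (Ψ : fibreDomain m) : S.fieldMap hm Ψ
    = (Real.sqrt 2 : ℂ)⁻¹ • (S.annihilationTerm Ψ (mem_dGamma_of_fibreDomain hm Ψ)
      + S.creationTerm Ψ (mem_dGamma_of_fibreDomain hm Ψ)) :=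
  sum_matAct_smul_add (F := Fock)
    (u := fun j => componentwise (S.A j) Ψ (mem_A_of_fibreDomain S hm j Ψ))
    (v := fun j => WithLp.toLp 2 fun s => annihilation (S.g j) ⟨(Ψ : SpinFock) s,
      mem_annihilation_domain_of_dGamma (S.isWeighted_g j) ⟨_, mem_dGamma_of_fibreDomain hm Ψ s⟩⟩)
    (w := fun j => WithLp.toLp 2 fun s => creation (S.g j) ⟨(Ψ : SpinFock) s,
      mem_creation_domain_of_dGamma (S.isWeighted_g j) ⟨_, mem_dGamma_of_fibreDomain hm Ψ s⟩⟩)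
    fun j s => S.A_apply j ⟨_, mem_dGamma_of_fibreDomain hm Ψ s⟩ _

/-- Since `|k| ≤ ω_m(k)` for `m ≥ 0`, both the norm and the form of `dΓ(|k|)` are below those of
`dΓ(ω_m)`, so the massless bound carries over with the same `C`. -/
theorem Model.exists_relative_bound (q : ℝ) : ∃ C : ℝ, 0 < C ∧ ∀ Ψ : fibreDomain m,
    ‖S.momentumMap hm Ψ + (q : ℂ) • S.fieldMap hm Ψ‖ ^ 2 ≤ ‖kineticMap m Ψ‖ ^ 2
      + 2 * C * (inner ℂ (kineticMap m Ψ) (Ψ : SpinFock)).re + C ^ 2 * ‖(Ψ : SpinFock)‖ ^ 2 := by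
  obtain ⟨C, hC, h⟩ := S.exists_norm_sq_le q
  refine ⟨C, hC, fun Ψ => ?_⟩
  have hΨ := mem_dGamma_of_fibreDomain hm Ψ
  have h1 : S.momentumMap hm Ψ + (q : ℂ) • S.fieldMap hm Ψ
      = S.momentumTerm Ψ hΨ + ((q / Real.sqrt 2 : ℝ) : ℂ)
        • (S.annihilationTerm Ψ hΨ + S.creationTerm Ψ hΨ) := by
    rw [S.fieldMap_apply, smul_smul]
    push_cast
    rfl
  have h3 : ‖componentwise (dGamma photonEnergy) Ψ hΨ‖ ^ 2 ≤ ‖kineticMap m Ψ‖ ^ 2 := by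
    refine (norm_sq_componentwise _ hΨ).trans_le (le_trans ?_
      (norm_sq_componentwise _ (mem_massive_of_fibreDomain Ψ)).ge)
    exact Finset.sum_le_sum fun s _ => norm_sq_dGamma_le (abs_sumOver_photonEnergy_le hm) _ _
  have h4 : (inner ℂ (componentwise (dGamma photonEnergy) Ψ hΨ) (Ψ : SpinFock)).re
      ≤ (inner ℂ (kineticMap m Ψ) (Ψ : SpinFock)).re := by
    refine (re_inner_componentwise _ hΨ).trans_le (le_trans ?_
      (re_inner_componentwise _ (mem_massive_of_fibreDomain Ψ)).ge)
    exact Finset.sum_le_sum fun s _ => re_inner_dGamma_le (sumOver_photonEnergy_le hm) _ _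
  rw [h1]
  refine (h Ψ hΨ).trans ?_
  gcongr

/-! ### Essential self-adjointness and concavity -/

/-- The fibre Hamiltonian as the combination of its summands on the common domain. -/
def Model.fibreHamiltonian (p : R3) (M q : ℝ) : SpinFock →ₗ.[ℂ] SpinFock :=
  combinedOp (S.matrixMap m p M) (kineticMap m) (S.momentumMap hm) (S.fieldMap hm) q

theorem Model.bddBelow_and_denseRange (p : R3) (M q : ℝ) :
    BddBelow (formValues (S.fibreHamiltonian hm p M q)) ∧
      ∃ x₀ : ℝ, ∀ x < x₀, DenseRange fun Ψ : (S.fibreHamiltonian hm p M q).domain =>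
        S.fibreHamiltonian hm p M q Ψ - (x : ℂ) • (Ψ : SpinFock) := by
  obtain ⟨C, hC, hrel⟩ := S.exists_relative_bound hm q
  exact bddBelow_and_denseRange_combinedOp inner_kineticMap (S.inner_momentumMap hm)
    (S.inner_fieldMap hm) (v := ‖p‖ + |M|) (by positivity)
    (fun Ψ => norm_matAct_add_smul_le S p M (Ψ : SpinFock))
    (re_inner_kineticMap_nonneg hm) (exists_kineticMap_add_eq hm) hC hrel

theorem fibreDomain_dense (hm : 0 ≤ m) : Dense (fibreDomain m : Set SpinFock) :=
  dense_of_surjective_add (re_inner_kineticMap_nonneg hm) (exists_kineticMap_add_eq hm)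

theorem Model.isGLB_energySpectrum (p : R3) (M q : ℝ) :
    IsGLB (S.energySpectrum m p M q) (sInf (formValues (S.fibreHamiltonian hm p M q))) := by
  obtain ⟨hbdd, x₀, hx₀⟩ := S.bddBelow_and_denseRange hm p M q
  unfold Model.energySpectrum
  rw [S.H_eq hm]
  exact isGLB_spectrumOf_closure (T := S.fibreHamiltonian hm p M q) (fibreDomain_dense hm)
    (combinedOp_symm (fun Ψ Φ => inner_matAct_add_smul S p M (Ψ : SpinFock) Φ) inner_kineticMap
      (S.inner_momentumMap hm) (S.inner_fieldMap hm)) hbdd hx₀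

/-- The empty set has no greatest lower bound in `ℝ`, so the spectrum has real points and the
infimum in `groundEnergy` is not a default value. -/
theorem Model.groundEnergy_eq (p : R3) (M q : ℝ) :
    S.groundEnergy m p M q = sInf (formValues (S.fibreHamiltonian hm p M q)) := by
  have h := S.isGLB_energySpectrum hm p M q
  have hne : (S.energySpectrum m p M q).Nonempty := by
    by_contra hne
    rw [Set.not_nonempty_iff_eq_empty] at hne
    rw [hne, isGLB_empty_iff] at h
    have := h (sInf (formValues (S.fibreHamiltonian hm p M q)) + 1)
    linarith
  exact h.csInf_eq hne

end DiracPolaron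

end

/-! ### Finiteness and concavity of the ground state energy -/

theorem propositionP1p3 (S : DiracPolaron.Model) (m : ℝ) (hm : 0 ≤ m) :
    (∀ (p : DiracPolaron.R3) (M q : ℝ),
      IsGLB (S.energySpectrum m p M q) (S.groundEnergy m p M q)) ∧
    ConcaveOn ℝ (Set.univ : Set (DiracPolaron.R3 × ℝ × ℝ))
      (fun z => S.groundEnergy m z.1 z.2.1 z.2.2) := by
  refine ⟨fun p M q => ?_, convex_univ, ?_⟩
  · rw [S.groundEnergy_eq hm]
    exact S.isGLB_energySpectrum hm p M q
  · rintro ⟨p, M, q⟩ - ⟨p', M', q'⟩ - a b ha hb hab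
    simp only [S.groundEnergy_eq hm, smul_eq_mul, Prod.smul_mk, Prod.mk_add_mk]
    -- Only the matrix part and the coupling constant depend on `(p,M,q)`, both linearly; the
    -- domain, the kinetic term, the momentum term and the field are fixed.
    exact DiracPolaron.convexCombination_sInf_le (DiracPolaron.fibreDomain_dense hm) ha hb hab
      (fun Ψ => DiracPolaron.matAct_convexCombination S p p' M M' a b (Ψ : DiracPolaron.SpinFock))
      (S.bddBelow_and_denseRange hm p M q).1 (S.bddBelow_and_denseRange hm p' M' q').1
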